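/- **Notation.** $\|\cdot\|$ is the Euclidean norm on $\mathbb{R}^n$ and the corresponding operator norm for (multi)linear maps; $\mathbf{B}^n_r(x_0)$ is the open ball of radius $r$ about $x_0$ in $\mathbb{R}^n$, and $\mathbf{B}^n_r=\mathbf{B}^n_r(0)$. For a $C^k$ map $f$ on an open set $U\subset\mathbb{R}^n$ put $\|f\|_{C^k}=\max_{1\le p\le k}\sup_{x\in U}\|D^pf(x)\|$. For a symmetric $n\times n$ matrix $A$, $\sigma_1(A)\ge\dots\ge\sigma_n(A)\ge 0$ are its singular values. **Theorem (quantitative Morse Lemma).** There is a function $M(K,\sigma,k)>0$, depending only on $K$, $\sigma$ and $k$, with the following property. Let $k\ge 3$, let $U\subset\mathbb{R}^n$ be open, $x_0\in U$, and let $f:U\to\mathbb{R}$ be of class $C^k$ with $\|f\|_{C^k}\le K$. Suppose that $$Df(x_0)=0,\qquad \operatorname{rank}D^2f(x_0)=n,$$ and put $\sigma=\sigma_n(D^2f(x_0))$, where $D^2f(x_0)$ is identified with the Hessian matrix of $f$ at $x_0$. Suppose also that $U$ contains the ball $\mathbf{B}^n_{\rho}(x_0)$ of radius $$\rho=\frac{1}{8K(K+1)\left(1+\frac{(K+1)^2}{\sigma^2}\right)}.$$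 Let $$\delta=\frac{\sigma^{5/2}}{32(K+1)^{9/2}}\min\left(1,\ \frac{2\sigma^2}{3(n^2+n+1)},\ \frac{\sigma^{3/2}}{2(n^2+n+1)}\right).$$ Then there exists a $C^{k-1}$ diffeomorphism $\varphi:\mathbf{B}^n_\delta\to\varphi(\mathbf{B}^n_\delta)$ onto an open subset of $U$, with $\varphi(0)=x_0$ and $$\|D\varphi(x)\|\le\frac{32(K+1)^5}{\sigma^{5/2}}\quad(x\in\mathbf{B}^n_\delta),\qquad \|\varphi\|_{C^{k-1}}\le M(K,\sigma,k),$$ and signs $\varepsilon_1,\dots,\varepsilon_n\in\{1,-1\}$ such that $$f\circ\varphi(x_1,\dots,x_n)=f(x_0)+\sum_{i=1}^n\varepsilon_i x_i^2\qquad\text{for all }x\in\mathbf{B}^n_\delta .$$ -/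

import Mathlib

open scoped ENNReal

noncomputable section

namespace QuantMorse

/-- The `C^k`-norm of a map on a set `U` (used for open `U`): the maximum over `1 ≤ p ≤ k` of the
supremum over `x ∈ U` of the operator norm of the `p`-th derivative at `x`. The value of the map
itself (order `0`) does not enter. It is `∞` if some derivative is unbounded. -/
def ckNorm {E F : Type*} [NormedAddCommGroup E] [NormedSpace ℝ E] [NormedAddCommGroup F]
    [NormedSpace ℝ F] (k : ℕ) (f : E → F) (U : Set E) : ℝ≥0∞ :=
  ⨆ p ∈ Finset.Icc 1 k, ⨆ x ∈ U, ENNReal.ofReal ‖iteratedFDeriv ℝ p f x‖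

theorem ckNorm_le_ofReal_iff {E F : Type*} [NormedAddCommGroup E] [NormedSpace ℝ E]
    [NormedAddCommGroup F] [NormedSpace ℝ F] {k : ℕ} {f : E → F} {U : Set E} {K : ℝ}
    (hK : 0 ≤ K) :
    ckNorm k f U ≤ ENNReal.ofReal K ↔
      ∀ p, 1 ≤ p → p ≤ k → ∀ x ∈ U, ‖iteratedFDeriv ℝ p f x‖ ≤ K := by
  simp only [ckNorm, iSup_le_iff, Finset.mem_Icc, and_imp, ENNReal.ofReal_le_ofReal_iff hK]

/-- The Hessian of `f` at `x` as a linear endomorphism of `ℝⁿ`: the derivative of the gradient,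
characterized by `⟪hessian f x u, v⟫ = D²f(x)(u, v)` for `f` of class `C²`. -/
def hessian {n : ℕ} (f : EuclideanSpace ℝ (Fin n) → ℝ) (x : EuclideanSpace ℝ (Fin n)) :
    EuclideanSpace ℝ (Fin n) →L[ℝ] EuclideanSpace ℝ (Fin n) :=
  fderiv ℝ (gradient f) x

/-- The singular values `σ₀(L) = 1` (a convention) and `σ₁(L) ≥ σ₂(L) ≥ …`, the index starting
at `1`. Mathlib's sequence `LinearMap.singularValues` starts at `0`. -/
def sigma {n : ℕ} (L : EuclideanSpace ℝ (Fin n) →L[ℝ] EuclideanSpace ℝ (Fin n)) : ℕ → ℝ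
  | 0 => 1
  | i + 1 => L.toLinearMap.singularValues i

/-- The radius of the ball on which the chart is defined. -/
def chartRadius (n : ℕ) (K σ : ℝ) : ℝ :=
  σ ^ (5 / 2 : ℝ) / (32 * (K + 1) ^ (9 / 2 : ℝ)) *
    min 1 (min (2 * σ ^ 2 / (3 * ((n : ℝ) ^ 2 + n + 1)))
      (σ ^ (3 / 2 : ℝ) / (2 * ((n : ℝ) ^ 2 + n + 1))))

/-- The radius of a ball around the critical point that the domain of `f` has to contain. -/
def domainRadius (K σ : ℝ) : ℝ :=
  1 / (8 * K * (K + 1) * (1 + (K + 1) ^ 2 / σ ^ 2))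

end QuantMorse

end

noncomputable section

namespace QuantMorse

open Set Filter Topology Metric

/-! ### Pointwise bounds for iterated derivatives -/

section Pointwise

variable {E F G H : Type*} [NormedAddCommGroup E] [NormedSpace ℝ E] [NormedAddCommGroup F]
  [NormedSpace ℝ F] [NormedAddCommGroup G] [NormedSpace ℝ G] [NormedAddCommGroup H]
  [NormedSpace ℝ H] {N : ℕ}

/-! Translate the critical point to 0, let H be the Hessian operator, and write f = T + R with T the
Taylor polynomial of order k. Then T(y) = f(0) + ½⟨Hy,y⟩ + ½⟨Q(y)y,y⟩, where Q (`hessTail`) is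
polynomial, has symmetric values and vanishes at 0. The goal is a map v near the identity with f(y)
= f(0) + ½⟨Hv(y),v(y)⟩; then φ is the inverse of v, preceded by a linear diagonalization of H. The
usual v(y) = √(1 + H⁻¹B(y)) y, with B the integral remainder of f, loses two derivatives. Treating T
and R separately loses only one.

For T, the iterates Y_m of Y ↦ ½(e − Y²) at e = H⁻¹Q are polynomial in y and self-adjoint for the
form of H. Hence p = y + Y_m(y)y satisfies ½⟨Hp,p⟩ = ½⟨(H+Q)y,y⟩ up to an error of order |y|^(m+3),
which joins R to form ρ (`half_inner_preMap`). For ρ, put v = p + cH⁻¹p with a scalar c solving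
c|p|² + ½c²⟨H⁻¹p,p⟩ = ρ; this makes the identity exact (`half_inner_normalMap`). The derivatives
D^jρ are o(|y|^(k−j)), so those of the correction cH⁻¹p are o(|y|^(k−1−j)). The correction is C^k
off 0, and its singularity at 0 is removable in the class C^(k−1) (`contDiffAt_zero_of_isLittleO`).

Two kinds of estimates are needed. Explicit ones, of first order only (`FirstBound`), give ‖Dv − 1‖
≤ ½ on the ball of radius r = 2√(2/σ)δ, so the inverse exists on the ball of radius r/2 with
derivative at most 2. For higher orders only the existence of M matters. There `JetBound` is stated
for a family, applied to all dimensions, functions and points at once, so that one constant serves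
them all without being tracked. `exists_morse_chart` collects both, and `exists_diagonalization`
supplies the linear change of variables. -/

theorem exists_isOpen_contDiffOn {f : E → F} {x : E} {s : Set E} (hf : ContDiffAt ℝ N f x)
    (hs : s ∈ 𝓝 x) : ∃ u ⊆ s, IsOpen u ∧ x ∈ u ∧ ContDiffOn ℝ N f u := by
  have h := (hf.eventually (by simp)).and hs
  obtain ⟨u, hu, huo, hxu⟩ := _root_.mem_nhds_iff.1 h
  exact ⟨u, fun y hy => (hu hy).2, huo, hxu, fun y hy => (hu hy).1.contDiffWithinAt⟩

theorem norm_iteratedFDeriv_bilinear_le (B : F →L[ℝ] G →L[ℝ] H) {f : E → F} {g : E → G} {x : E}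
    (hf : ContDiffAt ℝ N f x) (hg : ContDiffAt ℝ N g x) {j : ℕ} (hj : j ≤ N) :
    ‖iteratedFDeriv ℝ j (fun y => B (f y) (g y)) x‖ ≤ ‖B‖ * ∑ i ∈ Finset.range (j + 1),
      (j.choose i : ℝ) * ‖iteratedFDeriv ℝ i f x‖ * ‖iteratedFDeriv ℝ (j - i) g x‖ := by
  obtain ⟨u, -, huo, hxu, hu⟩ := exists_isOpen_contDiffOn hf univ_mem
  obtain ⟨v, hvu, hvo, hxv, hv⟩ := exists_isOpen_contDiffOn hg (huo.mem_nhds hxu)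
  have := B.norm_iteratedFDerivWithin_le_of_bilinear (hu.mono hvu) hv hvo.uniqueDiffOn hxv
    (n := j) (by exact_mod_cast hj)
  simpa only [iteratedFDerivWithin_of_isOpen _ hvo hxv] using this

theorem norm_iteratedFDeriv_comp_le_at {g : F → G} {f : E → F} {x : E}
    (hg : ContDiffAt ℝ N g (f x)) (hf : ContDiffAt ℝ N f x) {j : ℕ} (hj : j ≤ N) {C D : ℝ}
    (hC : ∀ i ≤ j, ‖iteratedFDeriv ℝ i g (f x)‖ ≤ C)
    (hD : ∀ i, 1 ≤ i → i ≤ j → ‖iteratedFDeriv ℝ i f x‖ ≤ D ^ i) :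
    ‖iteratedFDeriv ℝ j (g ∘ f) x‖ ≤ j.factorial * C * D ^ j := by
  obtain ⟨t, -, hto, hxt, ht⟩ := exists_isOpen_contDiffOn hg univ_mem
  obtain ⟨v, hvt, hvo, hxv, hv⟩ := exists_isOpen_contDiffOn hf
    (hf.continuousAt.preimage_mem_nhds (hto.mem_nhds hxt))
  have := norm_iteratedFDerivWithin_comp_le (n := j) ht hv (by exact_mod_cast hj)
    hto.uniqueDiffOn hvo.uniqueDiffOn hvt hxv (C := C) (D := D)
    (fun i hi => by rw [iteratedFDerivWithin_of_isOpen _ hto hxt]; exact hC i hi)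
    (fun i hi hi' => by rw [iteratedFDerivWithin_of_isOpen _ hvo hxv]; exact hD i hi hi')
  rwa [iteratedFDerivWithin_of_isOpen _ hvo hxv] at this

end Pointwise

/-! ### Uniform weighted bounds on jets in families -/

section Jets

variable {ι : Type*} {E F G H : ι → Type*} [∀ i, NormedAddCommGroup (E i)]
  [∀ i, NormedSpace ℝ (E i)] [∀ i, NormedAddCommGroup (F i)] [∀ i, NormedSpace ℝ (F i)]
  [∀ i, NormedAddCommGroup (G i)] [∀ i, NormedSpace ℝ (G i)]
  [∀ i, NormedAddCommGroup (H i)] [∀ i, NormedSpace ℝ (H i)] {N : ℕ}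

/-- The members of a family `g i` are of class `C^N` at `x i`, and their derivatives there satisfy
`‖D^j (g i) (x i)‖ ≤ C * A i * (D i) ^ j` for `j ≤ N`, with `C` independent of `i`. -/
def JetBound (N : ℕ) (g : ∀ i, E i → F i) (x : ∀ i, E i) (A D : ι → ℝ) : Prop :=
  ∃ C, 0 ≤ C ∧ ∀ i, ContDiffAt ℝ N (g i) (x i) ∧
    ∀ j ≤ N, ‖iteratedFDeriv ℝ j (g i) (x i)‖ ≤ C * A i * D i ^ j

namespace JetBound

variable {f g : ∀ i, E i → F i} {x : ∀ i, E i} {A A' D : ι → ℝ}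

theorem order_mono {M : ℕ} (h : JetBound N f x A D) (hM : M ≤ N) : JetBound M f x A D := by
  obtain ⟨C, hC, h⟩ := h
  exact ⟨C, hC, fun i => ⟨(h i).1.of_le (by exact_mod_cast hM), fun j hj => (h i).2 j (hj.trans hM)⟩⟩

theorem mono (h : JetBound N f x A D) (hD : ∀ i, 0 ≤ D i) {c : ℝ} (hc : 0 ≤ c)
    (hA : ∀ i, A i ≤ c * A' i) : JetBound N f x A' D := by
  obtain ⟨C, hC, h⟩ := h
  refine ⟨C * c, by positivity, fun i => ⟨(h i).1, fun j hj => ((h i).2 j hj).trans ?_⟩⟩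
  have := hD i
  rw [mul_assoc C c]
  gcongr
  exact hA i

theorem congr (h : JetBound N f x A D) (hfg : ∀ i, f i =ᶠ[𝓝 (x i)] g i) :
    JetBound N g x A D := by
  obtain ⟨C, hC, h⟩ := h
  refine ⟨C, hC, fun i => ⟨(h i).1.congr_of_eventuallyEq (hfg i).symm, fun j hj => ?_⟩⟩
  rw [← ((hfg i).iteratedFDeriv ℝ j).self_of_nhds]
  exact (h i).2 j hj

theorem add (hf : JetBound N f x A D) (hg : JetBound N g x A D) :
    JetBound N (fun i y => f i y + g i y) x A D := by
  obtain ⟨C, hC, hf⟩ := hf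
  obtain ⟨C', hC', hg⟩ := hg
  refine ⟨C + C', by positivity, fun i => ⟨(hf i).1.add (hg i).1, fun j hj => ?_⟩⟩
  rw [fun_iteratedFDeriv_add_apply ((hf i).1.of_le (by exact_mod_cast hj))
    ((hg i).1.of_le (by exact_mod_cast hj)), add_mul, add_mul]
  exact (norm_add_le _ _).trans (add_le_add ((hf i).2 j hj) ((hg i).2 j hj))

theorem bilinear {g : ∀ i, E i → G i} (B : ∀ i, F i →L[ℝ] G i →L[ℝ] H i) {c : ℝ}
    (hB : ∀ i, ‖B i‖ ≤ c) (hf : JetBound N f x A D) (hg : JetBound N g x A' D)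
    (hA : ∀ i, 0 ≤ A i) (hA' : ∀ i, 0 ≤ A' i) (hD : ∀ i, 0 ≤ D i) :
    JetBound N (fun i y => B i (f i y) (g i y)) x (fun i => A i * A' i) D := by
  obtain ⟨C, hC, hf⟩ := hf
  obtain ⟨C', hC', hg⟩ := hg
  refine ⟨|c| * (2 ^ N * (C * C')), by positivity, fun i =>
    ⟨(B i).isBoundedBilinearMap.contDiff.contDiffAt.comp₂ (hf i).1 (hg i).1, fun j hj => ?_⟩⟩
  refine (norm_iteratedFDeriv_bilinear_le (B i) (hf i).1 (hg i).1 hj).trans ?_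
  have hAi := hA i
  have hAi' := hA' i
  have hDi := hD i
  have key : ∑ l ∈ Finset.range (j + 1), (j.choose l : ℝ) * ‖iteratedFDeriv ℝ l (f i) (x i)‖ *
      ‖iteratedFDeriv ℝ (j - l) (g i) (x i)‖ ≤ 2 ^ N * (C * C') * (A i * A' i) * D i ^ j := by
    calc _ ≤ ∑ l ∈ Finset.range (j + 1), (j.choose l : ℝ) *
          ((C * C') * (A i * A' i) * D i ^ j) := by
          refine Finset.sum_le_sum fun l hl => ?_
          have hl' : l ≤ j := Nat.lt_succ_iff.1 (Finset.mem_range.1 hl)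
          have e : C * C' * (A i * A' i) * D i ^ j
              = (C * A i * D i ^ l) * (C' * A' i * D i ^ (j - l)) := by
            rw [← Nat.add_sub_cancel' hl', pow_add, Nat.add_sub_cancel' hl']; ring
          rw [e, mul_assoc]
          gcongr
          · exact (hf i).2 l (hl'.trans hj)
          · exact (hg i).2 (j - l) ((Nat.sub_le _ _).trans hj)
      _ = 2 ^ j * ((C * C') * (A i * A' i) * D i ^ j) := by
          rw [← Finset.sum_mul]; congr 1; exact_mod_cast Nat.sum_range_choose j
      _ ≤ 2 ^ N * ((C * C') * (A i * A' i) * D i ^ j) := by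
          gcongr
          norm_num
      _ = _ := by ring
  calc _ ≤ |c| * (2 ^ N * (C * C') * (A i * A' i) * D i ^ j) := by
        gcongr
        exact (hB i).trans (le_abs_self c)
    _ = _ := by ring

theorem const (c : ∀ i, F i) (hc : ∀ i, ‖c i‖ ≤ A i) (hA : ∀ i, 0 ≤ A i) (hD : ∀ i, 0 ≤ D i) :
    JetBound N (fun i _ => c i) x A D := by
  refine ⟨1, zero_le_one, fun i => ⟨contDiffAt_const, fun j _ => ?_⟩⟩
  have := hA i
  have := hD i
  rcases Nat.eq_zero_or_pos j with rfl | hj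
  · simpa using hc i
  · rw [iteratedFDeriv_const_of_ne hj.ne']
    simp only [Pi.zero_apply, norm_zero, one_mul]
    positivity

theorem linear (L : ∀ i, F i →L[ℝ] G i) {c : ℝ} (hL : ∀ i, ‖L i‖ ≤ c) (hf : JetBound N f x A D)
    (hA : ∀ i, 0 ≤ A i) (hD : ∀ i, 0 ≤ D i) : JetBound N (fun i y => L i (f i y)) x A D := by
  obtain ⟨C, hC, hf⟩ := hf
  refine ⟨|c| * C, by positivity, fun i =>
    ⟨(L i).contDiff.contDiffAt.comp _ (hf i).1, fun j hj => ?_⟩⟩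
  refine ((L i).norm_iteratedFDeriv_comp_left (hf i).1 (by exact_mod_cast hj)).trans ?_
  have := hA i
  have := hD i
  calc _ ≤ |c| * (C * A i * D i ^ j) := by
        gcongr
        · exact (hL i).trans (le_abs_self c)
        · exact (hf i).2 j hj
    _ = _ := by ring

theorem smul_const (c : ℝ) (hf : JetBound N f x A D) (hA : ∀ i, 0 ≤ A i) (hD : ∀ i, 0 ≤ D i) :
    JetBound N (fun i y => c • f i y) x A D :=
  hf.linear (fun i => c • ContinuousLinearMap.id ℝ (F i)) (c := |c|)
    (fun i => (norm_smul_le c (ContinuousLinearMap.id ℝ (F i))).trans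
      (mul_le_of_le_one_right (norm_nonneg c) ContinuousLinearMap.norm_id_le)) hA hD

theorem clm_apply {f : ∀ i, E i → F i →L[ℝ] G i} {g : ∀ i, E i → F i} (hf : JetBound N f x A D)
    (hg : JetBound N g x A' D) (hA : ∀ i, 0 ≤ A i) (hA' : ∀ i, 0 ≤ A' i) (hD : ∀ i, 0 ≤ D i) :
    JetBound N (fun i y => f i y (g i y)) x (fun i => A i * A' i) D :=
  bilinear (fun i => ContinuousLinearMap.id ℝ (F i →L[ℝ] G i)) (c := 1)
    (fun _ => ContinuousLinearMap.norm_id_le) hf hg hA hA' hD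

theorem clm_comp {f : ∀ i, E i → G i →L[ℝ] H i} {g : ∀ i, E i → F i →L[ℝ] G i}
    (hf : JetBound N f x A D) (hg : JetBound N g x A' D) (hA : ∀ i, 0 ≤ A i)
    (hA' : ∀ i, 0 ≤ A' i) (hD : ∀ i, 0 ≤ D i) :
    JetBound N (fun i y => (f i y).comp (g i y)) x (fun i => A i * A' i) D :=
  bilinear (fun i => ContinuousLinearMap.compL ℝ (F i) (G i) (H i)) (c := 1)
    (fun _ => ContinuousLinearMap.norm_compL_le _ _ _ _) hf hg hA hA' hD

theorem smul {f : ∀ i, E i → ℝ} (hf : JetBound N f x A D) (hg : JetBound N g x A' D)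
    (hA : ∀ i, 0 ≤ A i) (hA' : ∀ i, 0 ≤ A' i) (hD : ∀ i, 0 ≤ D i) :
    JetBound N (fun i y => f i y • g i y) x (fun i => A i * A' i) D :=
  bilinear (fun _ => ContinuousLinearMap.lsmul ℝ ℝ) (c := 1)
    (fun _ => ContinuousLinearMap.opNorm_lsmul_le) hf hg hA hA' hD

theorem mul {f g : ∀ i, E i → ℝ} (hf : JetBound N f x A D) (hg : JetBound N g x A' D)
    (hA : ∀ i, 0 ≤ A i) (hA' : ∀ i, 0 ≤ A' i) (hD : ∀ i, 0 ≤ D i) :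
    JetBound N (fun i y => f i y * g i y) x (fun i => A i * A' i) D :=
  hf.smul hg hA hA' hD

theorem comp {g : ∀ i, F i → G i} (hg : JetBound N g (fun i => f i (x i)) (fun _ => 1) (fun _ => 1))
    (hf : JetBound N f x (fun _ => 1) D) (hD : ∀ i, 0 ≤ D i) :
    JetBound N (fun i y => g i (f i y)) x (fun _ => 1) D := by
  obtain ⟨C, hC, hf⟩ := hf
  obtain ⟨C', hC', hg⟩ := hg
  refine ⟨N.factorial * C' * (C + 1) ^ N, by positivity, fun i =>
    ⟨(hg i).1.comp (x i) (hf i).1, fun j hj => ?_⟩⟩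
  have := hD i
  -- The composition estimate wants the inner derivatives bounded by powers of one number. Since C +
  -- 1 ≥ 1, C ≤ (C + 1)^l for l ≥ 1.
  refine (norm_iteratedFDeriv_comp_le_at (hg i).1 (hf i).1 hj (C := C') (D := (C + 1) * D i)
    (fun l hl => by simpa using (hg i).2 l (hl.trans hj)) (fun l hl hl' => ?_)).trans ?_
  · refine ((hf i).2 l (hl'.trans hj)).trans ?_
    rw [mul_one, mul_pow]
    gcongr
    calc C ≤ C + 1 := by linarith
      _ ≤ _ := le_self_pow₀ (by linarith) (by omega)
  · rw [mul_pow, mul_one, ← mul_assoc]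
    gcongr
    linarith

/-- Serves inductions on the order for maps whose derivative is expressed through the map itself,
such as inversion and local inverses. -/
theorem succ (hf : ∀ i, ContDiffAt ℝ (N + 1 : ℕ) (f i) (x i))
    (h0 : ∃ C, ∀ i, ‖f i (x i)‖ ≤ C * A i)
    (h : JetBound N (fun i => fderiv ℝ (f i)) x (fun i => A i * D i) D)
    (hA : ∀ i, 0 ≤ A i) (hD : ∀ i, 0 ≤ D i) : JetBound (N + 1) f x A D := by
  obtain ⟨C, hC, h⟩ := h
  obtain ⟨C', h0⟩ := h0
  refine ⟨|C'| + C, by positivity, fun i => ⟨hf i, fun j hj => ?_⟩⟩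
  have := hA i
  have := hD i
  rcases j with _ | j
  · simp only [norm_iteratedFDeriv_zero, pow_zero, mul_one]
    refine (h0 i).trans ?_
    gcongr
    linarith [le_abs_self C']
  · rw [← norm_iteratedFDeriv_fderiv]
    refine ((h i).2 j (by omega)).trans ?_
    rw [pow_succ']
    have : 0 ≤ |C'| * (A i * (D i * D i ^ j)) := by positivity
    nlinarith

theorem fderiv (h : JetBound (N + 1) f x A D) :
    JetBound N (fun i => fderiv ℝ (f i)) x (fun i => A i * D i) D := by
  obtain ⟨C, hC, h⟩ := h
  refine ⟨C, hC, fun i => ⟨(h i).1.fderiv_right (by norm_cast), fun j hj => ?_⟩⟩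
  rw [norm_iteratedFDeriv_fderiv]
  refine ((h i).2 (j + 1) (by omega)).trans (le_of_eq ?_)
  ring

/-- With D = ‖x‖⁻¹ a weight ‖x‖^d describes maps that scale like degree d; the identity has degree
one. -/
theorem id (hD : ∀ i, D i * ‖x i‖ = 1) : JetBound N (fun i (y : E i) => y) x (fun i => ‖x i‖) D := by
  refine ⟨1, zero_le_one, fun i => ⟨contDiffAt_id, fun j _ => ?_⟩⟩
  have hx : 0 < ‖x i‖ := by
    rcases (norm_nonneg (x i)).eq_or_lt with h | h
    · have := hD i; rw [← h] at this; simp at this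
    · exact h
  have hDi : 0 < D i := by
    have := hD i
    by_contra! h'
    nlinarith
  rcases j with _ | _ | j
  · simp
  · rw [norm_iteratedFDeriv_one, fderiv_fun_id]
    simp only [one_mul, zero_add, pow_one, mul_comm ‖x i‖, hD i]
    exact ContinuousLinearMap.norm_id_le
  · rw [← norm_iteratedFDeriv_fderiv,
      show _root_.fderiv ℝ (fun y : E i => y) = fun _ => ContinuousLinearMap.id ℝ (E i) from
        funext fun _ => fderiv_fun_id, iteratedFDeriv_const_of_ne (by omega)]
    simp only [Pi.zero_apply, norm_zero]
    positivity

/-- The derivative of inversion is h ↦ −a⁻¹ha⁻¹, so bounds through order N give bounds for the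
derivative through order N. Nothing about the ring enters except the bound on the inverses. -/
theorem ringInverse {R : ι → Type*} [∀ i, NormedRing (R i)] [∀ i, NormedAlgebra ℝ (R i)]
    [∀ i, CompleteSpace (R i)] (a : ∀ i, (R i)ˣ) {c : ℝ} (ha : ∀ i, ‖(↑(a i)⁻¹ : R i)‖ ≤ c) :
    ∀ N, JetBound N (fun i => (Ring.inverse : R i → R i)) (fun i => (a i : R i))
      (fun _ => 1) (fun _ => 1)
  | 0 => ⟨|c|, abs_nonneg c, fun i => ⟨contDiffAt_ringInverse ℝ (a i), fun j hj => by
      obtain rfl : j = 0 := by omega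
      simpa using (ha i).trans (le_abs_self c)⟩⟩
  | N + 1 => by
    have ih := ringInverse a ha N
    refine succ (fun i => contDiffAt_ringInverse ℝ (a i)) ⟨c, fun i => by simpa using ha i⟩ ?_
      (fun _ => zero_le_one) (fun _ => zero_le_one)
    have h := (bilinear (fun i => ContinuousLinearMap.mulLeftRight ℝ (R i)) (c := 1)
      (fun i => ContinuousLinearMap.opNorm_mulLeftRight_le ℝ (R i)) ih ih (fun _ => zero_le_one)
      (fun _ => zero_le_one) (fun _ => zero_le_one)).smul_const (-1) (by simp) (by simp)
    refine JetBound.congr h fun i => ?_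
    filter_upwards [Units.isOpen.mem_nhds (a i).isUnit] with y hy
    obtain ⟨u, rfl⟩ := hy
    rw [fderiv_inverse, Ring.inverse_unit, neg_one_smul]

theorem of_isCompact {h : ℝ → ℝ} {s u : Set ℝ} (hs : IsCompact s) (hu : IsOpen u) (hsu : s ⊆ u)
    (hh : ContDiffOn ℝ N h u) {t : ι → ℝ} (ht : ∀ i, t i ∈ s) :
    JetBound N (fun _ => h) t (fun _ => 1) (fun _ => 1) := by
  have key : ∀ j : ℕ, ∃ C, j ≤ N → ∀ y ∈ s, ‖iteratedFDeriv ℝ j h y‖ ≤ C := by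
    intro j
    by_cases hj : j ≤ N
    · have hc : ContinuousOn (iteratedFDeriv ℝ j h) s :=
        ((hh.continuousOn_iteratedFDerivWithin (by exact_mod_cast hj) hu.uniqueDiffOn).congr
          fun y hy => (iteratedFDerivWithin_of_isOpen j hu hy).symm).mono hsu
      obtain ⟨C, hC⟩ := hs.exists_bound_of_continuousOn hc
      exact ⟨C, fun _ => hC⟩
    · exact ⟨0, fun h => absurd h hj⟩
  choose C hC using key
  refine ⟨∑ j ∈ Finset.range (N + 1), |C j|, Finset.sum_nonneg fun _ _ => abs_nonneg _, fun i =>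
    ⟨hh.contDiffAt (hu.mem_nhds (hsu (ht i))), fun j hj => ?_⟩⟩
  rw [one_pow, mul_one, mul_one]
  exact (hC j hj _ (ht i)).trans ((le_abs_self _).trans (Finset.single_le_sum
    (f := fun j => |C j|) (fun _ _ => abs_nonneg _) (Finset.mem_range.2 (by omega))))

end JetBound

end Jets

/-! ### Symmetry of higher derivatives and Taylor polynomials -/

section Taylor

variable {E F : Type*} [NormedAddCommGroup E] [NormedSpace ℝ E] [NormedAddCommGroup F]
  [NormedSpace ℝ F]

/-- The first two slots are the two outermost differentiations, so this is the symmetry of the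
second derivative of Dⁿf. -/
theorem iteratedFDeriv_comp_swap_zero {f : E → F} {x : E} {n : ℕ}
    (hf : ContDiffAt ℝ (n + 2 : ℕ) f x) (v : Fin (n + 2) → E) :
    iteratedFDeriv ℝ (n + 2) f x (v ∘ Equiv.swap 0 1) = iteratedFDeriv ℝ (n + 2) f x v := by
  have hg : ContDiffAt ℝ 2 (iteratedFDeriv ℝ n f) x :=
    hf.iteratedFDeriv_right (by norm_cast; omega)
  have hs : IsSymmSndFDerivAt ℝ (iteratedFDeriv ℝ n f) x := hg.isSymmSndFDerivAt (by simp)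
  have key : ∀ w : Fin (n + 2) → E, iteratedFDeriv ℝ (n + 2) f x w =
      fderiv ℝ (fderiv ℝ (iteratedFDeriv ℝ n f)) x (w 0) (w 1) (Fin.tail (Fin.tail w)) := by
    intro w
    have hd : DifferentiableAt ℝ (iteratedFDeriv ℝ (n + 1) f) x :=
      (hf.iteratedFDeriv_right (i := n + 1) (m := 1) (by norm_cast; omega)).differentiableAt
        (by simp)
    have hd' : DifferentiableAt ℝ (fderiv ℝ (iteratedFDeriv ℝ n f)) x :=
      (hg.fderiv_right (m := 1) (by norm_num)).differentiableAt (by simp)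
    rw [hd.iteratedFDeriv_succ_apply_left']
    simp only [iteratedFDeriv_succ_apply_left]
    rw [fderiv_continuousMultilinear_apply_const_apply
      (hd'.clm_apply (differentiableAt_const _)), fderiv_clm_apply hd' (differentiableAt_const _)]
    simp [Fin.tail]
  rw [key, key, hs.eq]
  have : Fin.tail (Fin.tail (v ∘ Equiv.swap 0 1)) = Fin.tail (Fin.tail v) := by
    funext i
    simp only [Fin.tail, Function.comp_apply]
    rw [Equiv.swap_apply_of_ne_of_ne] <;> simp [Fin.ext_iff]
  rw [this]
  simp

/-- A symmetry of Dⁿf that holds near x survives one more differentiation, acting on the remaining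
slots. -/
theorem iteratedFDeriv_succ_comp_of_forall {f : E → F} {x : E} {n : ℕ}
    (hf : ContDiffAt ℝ (n + 1 : ℕ) f x) {σ : Equiv.Perm (Fin n)}
    (h : ∀ᶠ y in 𝓝 x, ∀ v, iteratedFDeriv ℝ n f y (v ∘ σ) = iteratedFDeriv ℝ n f y v)
    {v w : Fin (n + 1) → E} (h0 : w 0 = v 0) (ht : Fin.tail w = Fin.tail v ∘ σ) :
    iteratedFDeriv ℝ (n + 1) f x w = iteratedFDeriv ℝ (n + 1) f x v := by
  have hd : DifferentiableAt ℝ (iteratedFDeriv ℝ n f) x :=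
    (hf.iteratedFDeriv_right (i := n) (m := 1) (by norm_cast; omega)).differentiableAt (by simp)
  rw [hd.iteratedFDeriv_succ_apply_left', hd.iteratedFDeriv_succ_apply_left', h0, ht]
  congr 1
  exact Filter.EventuallyEq.fderiv_eq (by filter_upwards [h] with y hy using hy _)

/-- The `n`-th derivative of a function of class `C^n` is symmetric. -/
theorem iteratedFDeriv_comp_perm_of_contDiffAt {f : E → F} {n : ℕ} : ∀ {x : E},
    ContDiffAt ℝ n f x → ∀ (σ : Equiv.Perm (Fin n)) (v : Fin n → E),
    iteratedFDeriv ℝ n f x (v ∘ σ) = iteratedFDeriv ℝ n f x v := by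
  induction n with
  | zero => intro x _ σ v; congr 1; exact Subsingleton.elim _ _
  | succ n ih =>
    intro x hf σ
    -- Adjacent transpositions generate. The one moving slot 0 comes from second derivatives; the
    -- others differentiate the symmetry of the order below, known on a neighbourhood.
    have hσ : σ ∈ Submonoid.closure (Set.range fun i : Fin n => Equiv.swap i.castSucc i.succ) := by
      rw [Equiv.Perm.mclosure_swap_castSucc_succ]; trivial
    induction hσ using Submonoid.closure_induction with
    | one => intro v; rfl
    | mul a b _ _ ha hb =>
      intro v
      rw [Equiv.Perm.coe_mul, ← Function.comp_assoc, hb, ha]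
    | mem a ha =>
      obtain ⟨i, rfl⟩ := ha
      intro v
      rcases n with _ | n
      · exact i.elim0
      refine Fin.cases ?_ (fun j => ?_) i
      · exact iteratedFDeriv_comp_swap_zero hf v
      · refine iteratedFDeriv_succ_comp_of_forall hf (σ := Equiv.swap j.castSucc j.succ)
          ?_ ?_ ?_
        · have : ∀ᶠ y in 𝓝 x, ContDiffAt ℝ (n + 1 : ℕ) f y :=
            (hf.of_le (by norm_cast; omega)).eventually (by simp)
          filter_upwards [this] with y hy using fun v => ih hy _ v
        · simp only [Function.comp_apply]
          rw [Equiv.swap_apply_of_ne_of_ne] <;> simp [Fin.ext_iff]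
        · funext l
          simp only [Fin.tail, Function.comp_apply]
          congr 1
          rw [← Fin.succ_castSucc, ← Function.Injective.map_swap (Fin.succ_injective _)]

/-- The diagonal embedding has norm at most one for the sup norm on the product, so the derivatives
of the multilinear map itself control those of its restriction. -/
theorem norm_iteratedFDeriv_diag_le {n : ℕ} (c : E [×n]→L[ℝ] F) (j : ℕ) (y : E) :
    ‖iteratedFDeriv ℝ j (fun y => c fun _ => y) y‖ ≤ n.descFactorial j * ‖c‖ * ‖y‖ ^ (n - j) := by
  let L : E →L[ℝ] (Fin n → E) := ContinuousLinearMap.pi fun _ => ContinuousLinearMap.id ℝ E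
  have hL : ‖L‖ ≤ 1 := L.opNorm_le_bound zero_le_one fun z => by
    rw [one_mul]; exact pi_norm_const_le z
  have h1 : iteratedFDeriv ℝ j (fun y => c fun _ => y) y =
      (iteratedFDeriv ℝ j c (L y)).compContinuousLinearMap fun _ => L :=
    L.iteratedFDeriv_comp_right (f := c) c.contDiff y le_rfl
  rw [h1]
  refine (ContinuousMultilinearMap.norm_compContinuousLinearMap_le _ _).trans ?_
  refine (mul_le_of_le_one_right (norm_nonneg _)
    (Finset.prod_le_one (fun _ _ => norm_nonneg _) fun _ _ => hL)).trans ?_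
  refine (c.norm_iteratedFDeriv_le j (L y)).trans ?_
  rw [Fintype.card_fin]
  gcongr
  exact pi_norm_const_le y

theorem contDiff_diag {n : ℕ} (c : E [×n]→L[ℝ] F) {m : WithTop ℕ∞} :
    ContDiff ℝ m fun y : E => c fun _ => y :=
  c.contDiff.comp (contDiff_pi.2 fun _ => contDiff_id)

/-- The Taylor polynomial of order `k` of `f` at `0`. -/
def taylorPoly (k : ℕ) (f : E → F) (y : E) : F :=
  ∑ n ∈ Finset.range (k + 1), (n.factorial : ℝ)⁻¹ • iteratedFDeriv ℝ n f 0 fun _ => y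

theorem contDiff_taylorPoly (k : ℕ) (f : E → F) {m : WithTop ℕ∞} : ContDiff ℝ m (taylorPoly k f) :=
  ContDiff.sum fun _ _ => (contDiff_diag _).const_smul _

theorem iteratedFDeriv_taylorPoly_zero [CompleteSpace F] {k : ℕ} {f : E → F}
    (hf : ContDiffAt ℝ k f 0) {j : ℕ} (hj : j ≤ k) :
    iteratedFDeriv ℝ j (taylorPoly k f) 0 = iteratedFDeriv ℝ j f 0 := by
  let p : FormalMultilinearSeries ℝ E F := fun n =>
    if n ≤ k then (n.factorial : ℝ)⁻¹ • iteratedFDeriv ℝ n f 0 else 0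
  have hp : HasFiniteFPowerSeriesOnBall (taylorPoly k f) p 0 (k + 1) ⊤ := by
    refine HasFiniteFPowerSeriesOnBall.mk' (fun m hm => ?_) ENNReal.zero_lt_top fun y _ => ?_
    · simp only [p]
      rw [if_neg (by omega)]
    · rw [zero_add, taylorPoly]
      refine Finset.sum_congr rfl fun n hn => ?_
      have : n ≤ k := by have := Finset.mem_range.1 hn; omega
      simp [p, this]
  ext v
  -- The j-th derivative of a power series at its centre sums the j-th coefficient over all
  -- permutations of the arguments. By symmetry the j! summands agree and cancel 1/j!.
  rw [hp.toHasFPowerSeriesOnBall.iteratedFDeriv_eq_sum_of_completeSpace]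
  have : ∀ σ : Equiv.Perm (Fin j), (p j fun i => v (σ i)) =
      (j.factorial : ℝ)⁻¹ • iteratedFDeriv ℝ j f 0 v := by
    intro σ
    simp only [p, if_pos hj]
    rw [smul_apply]
    congr 1
    exact iteratedFDeriv_comp_perm_of_contDiffAt (hf.of_le (by exact_mod_cast hj)) σ v
  rw [Finset.sum_congr rfl fun σ _ => this σ, Finset.sum_const, Finset.card_univ,
    Fintype.card_perm, Fintype.card_fin, ← Nat.cast_smul_eq_nsmul ℝ, smul_smul,
    mul_inv_cancel₀ (by exact_mod_cast j.factorial_ne_zero), one_smul]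

theorem sum_range_pow_le_two {r : ℝ} (h0 : 0 ≤ r) (h1 : r ≤ 1 / 2) (n : ℕ) :
    ∑ i ∈ Finset.range n, r ^ i ≤ 2 := by
  have := geom_sum_mul_neg r n
  have h2 : 0 ≤ r ^ n := by positivity
  have h3 : 0 ≤ ∑ i ∈ Finset.range n, r ^ i := Finset.sum_nonneg fun i _ => by positivity
  nlinarith

/-- The factor 1/n! absorbs the n!/(n − j)! from differentiation, leaving a geometric series in ‖y‖
≤ 1/2. Order 0 is excluded because K does not control f(0). -/
theorem norm_iteratedFDeriv_taylorPoly_le {k : ℕ} {f : E → F} {K : ℝ} (hK0 : 0 ≤ K)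
    (hK : ∀ p, 1 ≤ p → p ≤ k → ‖iteratedFDeriv ℝ p f 0‖ ≤ K) {y : E} (hy : ‖y‖ ≤ 1 / 2) {j : ℕ}
    (hj : 1 ≤ j) : ‖iteratedFDeriv ℝ j (taylorPoly k f) y‖ ≤ 2 * K := by
  have h1 : iteratedFDeriv ℝ j (taylorPoly k f) y = ∑ n ∈ Finset.range (k + 1),
      iteratedFDeriv ℝ j (fun y => (n.factorial : ℝ)⁻¹ • iteratedFDeriv ℝ n f 0 fun _ => y) y :=
    iteratedFDeriv_fun_sum_apply fun n _ => ((contDiff_diag _).const_smul _).contDiffAt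
  have h2 : ∀ n ∈ Finset.range (k + 1), ‖iteratedFDeriv ℝ j
      (fun y => (n.factorial : ℝ)⁻¹ • iteratedFDeriv ℝ n f 0 fun _ => y) y‖ ≤
      if j ≤ n then K * ‖y‖ ^ (n - j) else 0 := by
    intro n hn
    rw [iteratedFDeriv_const_smul_apply' (contDiff_diag _).contDiffAt, norm_smul, norm_inv,
      RCLike.norm_natCast]
    have h3 := norm_iteratedFDeriv_diag_le (iteratedFDeriv ℝ n f 0) j y
    split_ifs with hjn
    · have h4 : (n.descFactorial j : ℝ) ≤ n.factorial := by
        exact_mod_cast Nat.le_of_dvd n.factorial_pos (by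
          rw [← Nat.factorial_mul_descFactorial hjn]; exact dvd_mul_left _ _)
      have h5 : (0 : ℝ) < n.factorial := by exact_mod_cast n.factorial_pos
      rw [inv_mul_le_iff₀ h5]
      refine h3.trans ?_
      have := hK n (by omega) (by have := Finset.mem_range.1 hn; omega)
      rw [mul_assoc]
      gcongr
    · rw [Nat.descFactorial_of_lt (by omega)] at h3
      simp only [Nat.cast_zero, zero_mul] at h3
      rw [le_antisymm h3 (norm_nonneg _), mul_zero]
  rw [h1]
  refine (norm_sum_le_of_le _ h2).trans ?_
  rw [← Finset.sum_filter]
  have h6 : ∑ n ∈ Finset.range (k + 1) with j ≤ n, K * ‖y‖ ^ (n - j)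
      = ∑ i ∈ Finset.range (k + 1 - j), K * ‖y‖ ^ i := by
    refine Finset.sum_nbij' (fun n => n - j) (fun i => i + j) ?_ ?_ ?_ ?_ ?_ <;>
      simp only [Finset.mem_filter, Finset.mem_range] <;> intros <;> (try constructor) <;>
      omega
  rw [h6, ← Finset.mul_sum, mul_comm]
  exact mul_le_mul_of_nonneg_right (sum_range_pow_le_two (norm_nonneg y) hy _) hK0

/-- The mean value inequality on the ball of radius ‖y‖ turns a bound for order j + 1 into one for
order j with one more factor ‖y‖. -/
theorem norm_iteratedFDeriv_le_of_vanishing {k : ℕ} {g : E → F} {r ε : ℝ} (hε : 0 ≤ ε)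
    (hg : ∀ y, ‖y‖ ≤ r → ContDiffAt ℝ k g y) (h0 : ∀ j < k, iteratedFDeriv ℝ j g 0 = 0)
    (hb : ∀ y, ‖y‖ ≤ r → ‖iteratedFDeriv ℝ k g y‖ ≤ ε) {m : ℕ} : ∀ j, j + m = k →
    ∀ y, ‖y‖ ≤ r → ‖iteratedFDeriv ℝ j g y‖ ≤ ε * ‖y‖ ^ m := by
  induction m with
  | zero => intro j hj y hy; obtain rfl : j = k := by omega
            simpa using hb y hy
  | succ m ih =>
    intro j hj y hy
    have hball : ∀ z ∈ closedBall (0 : E) ‖y‖, ‖z‖ ≤ r := fun z hz =>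
      (mem_closedBall_zero_iff.1 hz).trans hy
    have := (convex_closedBall (0 : E) ‖y‖).norm_image_sub_le_of_norm_fderiv_le
      (f := iteratedFDeriv ℝ j g) (C := ε * ‖y‖ ^ m) (𝕜 := ℝ) (x := 0) (y := y)
      (fun z hz => ((hg z (hball z hz)).iteratedFDeriv_right (m := 1)
        (by norm_cast; omega)).differentiableAt (by simp))
      (fun z hz => by
        rw [norm_fderiv_iteratedFDeriv]
        refine (ih (j + 1) (by omega) z (hball z hz)).trans ?_
        gcongr
        exact mem_closedBall_zero_iff.1 hz) (by simp) (by simp)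
    rw [h0 j (by omega), sub_zero, sub_zero] at this
    rw [pow_succ, ← mul_assoc]
    exact this

end Taylor

/-! ### The Hessian and the higher order part of the Taylor polynomial as operators -/

section Hess

theorem iteratedFDeriv_add_two_apply {E : Type*} [NormedAddCommGroup E]
    [NormedSpace ℝ E] (n : ℕ) (f : E → ℝ) (x : E) (m : Fin (n + 2) → E) :
    iteratedFDeriv ℝ (n + 2) f x m = iteratedFDeriv ℝ n (fderiv ℝ (fderiv ℝ f)) x
      (Fin.init (Fin.init m)) (Fin.init m (Fin.last n)) (m (Fin.last (n + 1))) := by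
  rw [iteratedFDeriv_succ_apply_right, iteratedFDeriv_succ_apply_right]

variable {E : Type*} [NormedAddCommGroup E] [InnerProductSpace ℝ E] [CompleteSpace E]

/-- The Riesz representation of a functional, as a real linear map. -/
def riesz : (E →L[ℝ] ℝ) →L[ℝ] E :=
  LinearMap.mkContinuous
    { toFun := fun l => (InnerProductSpace.toDual ℝ E).symm l
      map_add' := fun a b => map_add _ a b
      map_smul' := fun c a => by simp } 1 fun l => by simp

@[simp] theorem inner_riesz (l : E →L[ℝ] ℝ) (v : E) : inner ℝ (riesz l) v = l v :=
  InnerProductSpace.toDual_symm_apply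

theorem norm_riesz_apply (l : E →L[ℝ] ℝ) : ‖riesz l‖ = ‖l‖ :=
  LinearIsometryEquiv.norm_map _ _

/-- The operator representing a bilinear form. -/
def formOperator : (E →L[ℝ] E →L[ℝ] ℝ) →L[ℝ] (E →L[ℝ] E) :=
  ContinuousLinearMap.compL ℝ E (E →L[ℝ] ℝ) E riesz

@[simp] theorem inner_formOperator (A : E →L[ℝ] E →L[ℝ] ℝ) (u v : E) :
    inner ℝ (formOperator A u) v = A u v := inner_riesz _ _

theorem norm_formOperator_apply_le (A : E →L[ℝ] E →L[ℝ] ℝ) : ‖formOperator A‖ ≤ ‖A‖ :=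
  ContinuousLinearMap.opNorm_le_bound _ (norm_nonneg A) fun u => by
    change ‖riesz (A u)‖ ≤ _
    rw [norm_riesz_apply]
    exact A.le_opNorm u

theorem fderiv_gradient {f : E → ℝ} {x : E} (hf : ContDiffAt ℝ 2 f x) :
    fderiv ℝ (gradient f) x = formOperator (fderiv ℝ (fderiv ℝ f) x) := by
  have hd : DifferentiableAt ℝ (fderiv ℝ f) x :=
    (hf.fderiv_right (m := 1) (by norm_num)).differentiableAt (by simp)
  exact (riesz.hasFDerivAt.comp x hd.hasFDerivAt).fderiv

/-- The coefficient of degree `i + 1` of the operator `hessTail`. -/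
def hessCoeff (i : ℕ) (f : E → ℝ) : E [×(i + 1)]→L[ℝ] (E →L[ℝ] E) :=
  (2 / (i + 3).factorial : ℝ) • formOperator.compContinuousMultilinearMap
    (iteratedFDeriv ℝ (i + 1) (fderiv ℝ (fderiv ℝ f)) 0)

theorem inner_hessCoeff (i : ℕ) (f : E → ℝ) (m : Fin (i + 1) → E) (u v : E) :
    inner ℝ (hessCoeff i f m u) v =
      2 / (i + 3).factorial * iteratedFDeriv ℝ (i + 1) (fderiv ℝ (fderiv ℝ f)) 0 m u v := by
  simp only [hessCoeff, smul_apply, inner_smul_left, RCLike.conj_to_real,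
    ContinuousLinearMap.compContinuousMultilinearMap_coe, Function.comp_apply, inner_formOperator]

theorem norm_hessCoeff_le {i : ℕ} {f : E → ℝ} {K : ℝ} (hK : ‖iteratedFDeriv ℝ (i + 3) f 0‖ ≤ K) :
    ‖hessCoeff i f‖ ≤ 2 / (i + 3).factorial * K := by
  have hK0 : 0 ≤ K := (norm_nonneg _).trans hK
  refine ContinuousMultilinearMap.opNorm_le_bound (by positivity) fun m => ?_
  have h : ‖hessCoeff i f m‖ ≤ 2 / (i + 3).factorial *
      ‖iteratedFDeriv ℝ (i + 1) (fderiv ℝ (fderiv ℝ f)) 0 m‖ := by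
    simp only [hessCoeff, smul_apply, ContinuousLinearMap.compContinuousMultilinearMap_coe,
      Function.comp_apply]
    rw [norm_smul, Real.norm_of_nonneg (by positivity)]
    gcongr
    exact norm_formOperator_apply_le _
  refine h.trans ?_
  rw [mul_assoc]
  gcongr
  refine (ContinuousMultilinearMap.le_opNorm _ _).trans ?_
  rw [norm_iteratedFDeriv_fderiv, norm_iteratedFDeriv_fderiv]
  gcongr

/-- The part of order at least one of the operator `P`, for which the Taylor polynomial of `f` of
order `k` at `0` is `f 0 + Df(0) y + ⟪P y y, y⟫ / 2`. -/
def hessTail (k : ℕ) (f : E → ℝ) (y : E) : E →L[ℝ] E :=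
  ∑ i ∈ Finset.range (k - 2), hessCoeff i f fun _ => y

/-- In the term of degree i + 3 two slots are split off as a bilinear form; the factor 2/(i+3)! in
`hessCoeff` compensates the ½ in front of the inner product. -/
theorem taylorPoly_eq_hessTail {k : ℕ} (hk : 2 ≤ k) (f : E → ℝ) (y : E) :
    taylorPoly k f y = f 0 + fderiv ℝ f 0 y +
      1 / 2 * inner ℝ (formOperator (fderiv ℝ (fderiv ℝ f) 0) y) y +
      1 / 2 * inner ℝ (hessTail k f y y) y := by
  obtain ⟨m, rfl⟩ := Nat.exists_eq_add_of_le hk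
  have hterm : ∀ i : ℕ, iteratedFDeriv ℝ (i + 2) f 0 (fun _ => y) =
      iteratedFDeriv ℝ i (fderiv ℝ (fderiv ℝ f)) 0 (fun _ => y) y y := by
    intro i
    exact iteratedFDeriv_add_two_apply i f 0 _
  rw [taylorPoly, show 2 + m + 1 = m + 3 by ring, Finset.sum_range_succ', Finset.sum_range_succ',
    Finset.sum_range_succ']
  simp only [hessTail, show 2 + m - 2 = m by omega, _root_.sum_apply, sum_inner,
    Finset.mul_sum]
  have h1 : iteratedFDeriv ℝ (0 + 1) f 0 (fun _ => y) = fderiv ℝ f 0 y := by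
    simp
  have h2 : iteratedFDeriv ℝ (0 + 1 + 1) f 0 (fun _ => y) = fderiv ℝ (fderiv ℝ f) 0 y y := by
    rw [hterm 0]; simp
  rw [h1, h2]
  simp only [show ∀ i : ℕ, i + 1 + 1 + 1 = (i + 1) + 2 from fun i => rfl, hterm,
    inner_hessCoeff]
  simp only [smul_eq_mul, Nat.factorial]
  have h3 : ∀ i ∈ Finset.range m, ((i + 1 + 2).factorial : ℝ)⁻¹ * iteratedFDeriv ℝ (i + 1)
      (fderiv ℝ (fderiv ℝ f)) 0 (fun _ => y) y y = 1 / 2 * (2 / (((i + 2 + 1) * ((i + 1 + 1) *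
        ((i + 1) * i.factorial)) : ℕ) : ℝ) * iteratedFDeriv ℝ (i + 1)
      (fderiv ℝ (fderiv ℝ f)) 0 (fun _ => y) y y) := by
    intro i _
    simp only [Nat.factorial]
    push_cast
    field_simp
  simp only [Nat.factorial] at h3
  rw [Finset.sum_congr rfl h3]
  simp
  ring

/-- Exchanging u and v swaps the last two slots of a derivative of f at 0, which is symmetric in all
its slots. -/
theorem inner_hessTail_comm {k : ℕ} {f : E → ℝ} (hf : ContDiffAt ℝ k f 0) (y u v : E) :
    inner ℝ (hessTail k f y u) v = inner ℝ (hessTail k f y v) u := by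
  simp only [hessTail, _root_.sum_apply, sum_inner, inner_hessCoeff]
  refine Finset.sum_congr rfl fun i hi => ?_
  congr 1
  have hi' : i + 1 + 2 ≤ k := by have := Finset.mem_range.1 hi; omega
  have key : ∀ u v : E, iteratedFDeriv ℝ (i + 1) (fderiv ℝ (fderiv ℝ f)) 0 (fun _ => y) u v =
      iteratedFDeriv ℝ (i + 1 + 2) f 0
        (Fin.snoc (α := fun _ => E) (Fin.snoc (α := fun _ => E) (fun _ => y) u) v) := by
    intro u v
    rw [iteratedFDeriv_add_two_apply]
    simp
  rw [key, key, ← iteratedFDeriv_comp_perm_of_contDiffAt (hf.of_le (by exact_mod_cast hi'))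
    (Equiv.swap (Fin.last _) (Fin.castSucc (Fin.last _)))]
  congr 1
  funext l
  refine Fin.lastCases ?_ (fun l => ?_) l
  · simp
  · refine Fin.lastCases ?_ (fun l => ?_) l
    · simp
    · simp only [Function.comp_apply]
      rw [Equiv.swap_apply_of_ne_of_ne]
      · simp
      · exact (Fin.castSucc_lt_last _).ne
      · exact fun h => (Fin.castSucc_lt_last _).ne (Fin.castSucc_injective _ h)

theorem contDiff_hessTail (k : ℕ) (f : E → ℝ) {m : WithTop ℕ∞} : ContDiff ℝ m (hessTail k f) :=
  ContDiff.sum fun _ _ => contDiff_diag _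

theorem norm_iteratedFDeriv_hessTail_le_sum {k : ℕ} {f : E → ℝ} {K : ℝ}
    (hK : ∀ p, 1 ≤ p → p ≤ k → ‖iteratedFDeriv ℝ p f 0‖ ≤ K) (j : ℕ) (y : E) :
    ‖iteratedFDeriv ℝ j (hessTail k f) y‖ ≤ ∑ i ∈ Finset.range (k - 2),
      2 / (i + 3).factorial * ((i + 1).descFactorial j * K * ‖y‖ ^ (i + 1 - j)) := by
  have h1 : iteratedFDeriv ℝ j (hessTail k f) y = ∑ i ∈ Finset.range (k - 2),
      iteratedFDeriv ℝ j (fun y => hessCoeff i f fun _ => y) y :=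
    iteratedFDeriv_fun_sum_apply fun i _ => (contDiff_diag _).contDiffAt
  rw [h1]
  refine norm_sum_le_of_le _ fun i hi => (norm_iteratedFDeriv_diag_le _ j y).trans ?_
  have h2 := norm_hessCoeff_le (i := i) (f := f) (K := K)
    (hK _ (by omega) (by have := Finset.mem_range.1 hi; omega))
  calc _ ≤ (i + 1).descFactorial j * (2 / (i + 3).factorial * K) * ‖y‖ ^ (i + 1 - j) := by gcongr
    _ = _ := by ring

theorem hessTail_coeff_le (i : ℕ) : 2 * ((i : ℝ) + 1) / (i + 3).factorial ≤ 1 / 2 := by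
  have h : ((i + 3).factorial : ℝ) = (i + 3) * ((i + 2) * ((i + 1) * i.factorial)) := by
    simp only [Nat.factorial]; push_cast; ring
  have h1 : (1 : ℝ) ≤ i.factorial := by exact_mod_cast i.factorial_pos
  have h0 : (0 : ℝ) ≤ i := by positivity
  rw [h, div_le_div_iff₀ (by positivity) (by norm_num)]
  have h2 : (4 : ℝ) ≤ (i + 3) * (i + 2) := by nlinarith
  have h3 : ((i : ℝ) + 1) ≤ (i + 1) * i.factorial := by nlinarith
  nlinarith [mul_le_mul h2 h3 (by positivity) (by positivity)]

variable {k : ℕ} {f : E → ℝ} {K : ℝ} {y : E}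

theorem norm_hessTail_le (hK0 : 0 ≤ K) (hK : ∀ p, 1 ≤ p → p ≤ k → ‖iteratedFDeriv ℝ p f 0‖ ≤ K)
    (hy : ‖y‖ ≤ 1 / 2) : ‖hessTail k f y‖ ≤ K * ‖y‖ := by
  have := norm_iteratedFDeriv_hessTail_le_sum hK 0 y
  rw [norm_iteratedFDeriv_zero] at this
  refine this.trans ?_
  calc _ ≤ ∑ i ∈ Finset.range (k - 2), 1 / 2 * (K * ‖y‖) * ‖y‖ ^ i := by
        refine Finset.sum_le_sum fun i _ => ?_
        have h1 := hessTail_coeff_le i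
        have h2 : (2 : ℝ) / (i + 3).factorial ≤ 2 * ((i : ℝ) + 1) / (i + 3).factorial := by
          gcongr
          have : (0 : ℝ) ≤ i := by positivity
          linarith
        simp only [Nat.descFactorial_zero, Nat.cast_one, one_mul, Nat.sub_zero, pow_succ]
        calc _ ≤ 1 / 2 * (K * (‖y‖ ^ i * ‖y‖)) :=
              mul_le_mul_of_nonneg_right (h2.trans h1) (by positivity)
          _ = _ := by ring
    _ ≤ 1 / 2 * (K * ‖y‖) * 2 := by
        rw [← Finset.mul_sum]
        gcongr
        exact sum_range_pow_le_two (norm_nonneg y) hy _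
    _ = _ := by ring

theorem norm_fderiv_hessTail_le (hK0 : 0 ≤ K)
    (hK : ∀ p, 1 ≤ p → p ≤ k → ‖iteratedFDeriv ℝ p f 0‖ ≤ K) (hy : ‖y‖ ≤ 1 / 2) :
    ‖fderiv ℝ (hessTail k f) y‖ ≤ K := by
  have := norm_iteratedFDeriv_hessTail_le_sum hK 1 y
  rw [norm_iteratedFDeriv_one] at this
  refine this.trans ?_
  calc _ ≤ ∑ i ∈ Finset.range (k - 2), 1 / 2 * K * ‖y‖ ^ i := by
        refine Finset.sum_le_sum fun i _ => ?_
        have h1 := hessTail_coeff_le i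
        simp only [Nat.descFactorial_one, Nat.add_sub_cancel]
        calc _ = 2 * ((i : ℝ) + 1) / (i + 3).factorial * (K * ‖y‖ ^ i) := by push_cast; ring
          _ ≤ 1 / 2 * (K * ‖y‖ ^ i) := by gcongr
          _ = _ := by ring
    _ ≤ 1 / 2 * K * 2 := by
        rw [← Finset.mul_sum]
        gcongr
        exact sum_range_pow_le_two (norm_nonneg y) hy _
    _ = _ := by ring

/-- A polynomial without constant term scales near 0 no worse than a map of degree one; the terms
differentiated more often than their degree vanish. -/
theorem norm_iteratedFDeriv_hessTail_le (hK0 : 0 ≤ K)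
    (hK : ∀ p, 1 ≤ p → p ≤ k → ‖iteratedFDeriv ℝ p f 0‖ ≤ K) (hy : ‖y‖ ≤ 1 / 2) (hy0 : y ≠ 0)
    (j : ℕ) : ‖iteratedFDeriv ℝ j (hessTail k f) y‖ ≤ k * K * ‖y‖ * ‖y‖⁻¹ ^ j := by
  refine (norm_iteratedFDeriv_hessTail_le_sum hK j y).trans ?_
  have hpos : 0 < ‖y‖ := norm_pos_iff.2 hy0
  calc _ ≤ ∑ i ∈ Finset.range (k - 2), K * ‖y‖ * ‖y‖⁻¹ ^ j := by
        refine Finset.sum_le_sum fun i _ => ?_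
        by_cases hj : j ≤ i + 1
        · have h1 : ((i + 1).descFactorial j : ℝ) ≤ (i + 1).factorial := by
            exact_mod_cast Nat.le_of_dvd (Nat.factorial_pos _) (by
              rw [← Nat.factorial_mul_descFactorial hj]; exact dvd_mul_left _ _)
          have h2 : ((i + 1).factorial : ℝ) * 2 ≤ (i + 3).factorial := by
            rw [show ((i + 3).factorial : ℝ) = (i + 1 + 1 + 1) * ((i + 1 + 1) * (i + 1).factorial) by
              rw [Nat.factorial_succ, Nat.factorial_succ (i + 1)]; push_cast; ring]
            have h3 : (0 : ℝ) ≤ i := by positivity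
            have h4 : (0 : ℝ) ≤ (i + 1).factorial := by positivity
            have h5 : (2 : ℝ) ≤ (i + 1 + 1 + 1) * (i + 1 + 1) := by nlinarith
            nlinarith
          have h6 : (0 : ℝ) < (i + 3).factorial := by positivity
          have h7 : ‖y‖ ^ (i + 1 - j) ≤ ‖y‖ * ‖y‖⁻¹ ^ j := by
            rw [inv_pow, ← div_eq_mul_inv, le_div_iff₀ (by positivity), ← pow_add,
              Nat.sub_add_cancel hj, pow_succ]
            exact mul_le_of_le_one_left hpos.le (pow_le_one₀ hpos.le (by linarith))
          calc _ ≤ 2 / ((i + 3).factorial : ℝ) * ((i + 1).factorial * K * (‖y‖ * ‖y‖⁻¹ ^ j)) := by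
                gcongr
            _ = (i + 1).factorial * 2 / ((i + 3).factorial : ℝ) * (K * ‖y‖ * ‖y‖⁻¹ ^ j) := by ring
            _ ≤ 1 * (K * ‖y‖ * ‖y‖⁻¹ ^ j) := by
                gcongr
                rwa [div_le_one h6]
            _ = _ := one_mul _
        · rw [Nat.descFactorial_of_lt (by omega)]
          simp only [Nat.cast_zero, zero_mul, mul_zero]
          positivity
    _ = (k - 2 : ℕ) * (K * ‖y‖ * ‖y‖⁻¹ ^ j) := by rw [Finset.sum_const, Finset.card_range, nsmul_eq_mul]
    _ ≤ k * (K * ‖y‖ * ‖y‖⁻¹ ^ j) := by gcongr; omega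
    _ = _ := by ring

end Hess

/-! ### Approximate square roots and the correction of the remainder -/

section SqrtIter

variable {A : Type*} [Ring A] [Algebra ℝ A]

/-- The fixed point iteration for `1 + Y = √(1 + e)`. -/
def sqrtIter : ℕ → A → A
  | 0, _ => 0
  | m + 1, e => (1 / 2 : ℝ) • (e - sqrtIter m e * sqrtIter m e)

/-- The fixed point equation Y = ½(e − Y²) is (1 + Y)² = 1 + e rearranged, so the defect of an
iterate is twice the next increment. -/
theorem one_add_sqrtIter_mul_self (m : ℕ) (e : A) :
    (1 + sqrtIter m e) * (1 + sqrtIter m e) =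
      1 + e - (2 : ℝ) • (sqrtIter (m + 1) e - sqrtIter m e) := by
  rw [sqrtIter, smul_sub, smul_smul]
  norm_num
  rw [two_smul]
  noncomm_ring

/-- A noncommutative difference of squares. Each increment is the previous one times iterates that
are O(‖y‖), hence the gain of one order per step. -/
theorem sqrtIter_succ_succ_sub (m : ℕ) (e : A) :
    sqrtIter (m + 2) e - sqrtIter (m + 1) e = (-1 / 2 : ℝ) •
      (sqrtIter (m + 1) e * (sqrtIter (m + 1) e - sqrtIter m e) +
        (sqrtIter (m + 1) e - sqrtIter m e) * sqrtIter m e) := by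
  have h : sqrtIter (m + 2) e - sqrtIter (m + 1) e = (1 / 2 : ℝ) • (sqrtIter m e * sqrtIter m e -
      sqrtIter (m + 1) e * sqrtIter (m + 1) e) := by
    conv_lhs => rw [sqrtIter]; rhs; rw [sqrtIter]
    rw [← smul_sub]
    congr 1
    abel
  rw [h, neg_div, neg_smul, ← smul_neg]
  congr 1
  noncomm_ring

end SqrtIter

/-! ### The normalizing map and the exact identity it satisfies -/

section Correction

variable {E : Type*} [NormedAddCommGroup E] [InnerProductSpace ℝ E]

/-- The real inner product as a continuous bilinear map. -/
def realInner : E →L[ℝ] E →L[ℝ] ℝ :=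
  LinearMap.mkContinuous₂ (innerₗ E) 1 fun x y => by
    simpa using norm_inner_le_norm (𝕜 := ℝ) x y

theorem norm_realInner_le : ‖(realInner : E →L[ℝ] E →L[ℝ] ℝ)‖ ≤ 1 :=
  LinearMap.mkContinuous₂_norm_le _ zero_le_one _

/-- The solution `h` of `h + t * h ^ 2 / 2 = 1` that is smooth near `t = 0`. -/
def quadRoot (t : ℝ) : ℝ := 2 / (1 + √(1 + 2 * t))

theorem quadRoot_spec {t : ℝ} (ht : -(1 / 2) ≤ t) : quadRoot t + t * quadRoot t ^ 2 / 2 = 1 := by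
  have h0 := Real.sqrt_nonneg (1 + 2 * t)
  have h1 := Real.sq_sqrt (show 0 ≤ 1 + 2 * t by linarith)
  rw [quadRoot]
  set s := √(1 + 2 * t)
  have : t = (s ^ 2 - 1) / 2 := by linarith
  rw [this]
  field_simp
  ring

variable (H Hi : E →L[ℝ] E) (Q : E → E →L[ℝ] E) (R : E → ℝ) (m : ℕ)

/-- The approximate square root of `1 + H⁻¹ Q`, minus `1`. -/
def rootMap (y : E) : E →L[ℝ] E := sqrtIter m (Hi.comp (Q y))

/-- The polynomial first approximation of the normalizing map. -/
def preMap (y : E) : E := y + rootMap Hi Q m y y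

/-- The remainder left by `preMap`. -/
def remTerm (y : E) : ℝ :=
  R y + inner ℝ (H ((rootMap Hi Q (m + 1) y - rootMap Hi Q m y) y)) y

/-- The squared norm of `preMap`. -/
def sqTerm (y : E) : ℝ := inner ℝ (preMap Hi Q m y) (preMap Hi Q m y)

/-- The relative size of the remainder. -/
def ratioTerm (y : E) : ℝ :=
  remTerm H Hi Q R m y * inner ℝ (Hi (preMap Hi Q m y)) (preMap Hi Q m y) *
    ((sqTerm Hi Q m y)⁻¹ * (sqTerm Hi Q m y)⁻¹)

/-- The correction term of the normalizing map. -/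
def corrMap (y : E) : E :=
  (remTerm H Hi Q R m y * (sqTerm Hi Q m y)⁻¹ * quadRoot (ratioTerm H Hi Q R m y)) •
    Hi (preMap Hi Q m y)

/-- The normalizing map. -/
def normalMap (y : E) : E := preMap Hi Q m y + corrMap H Hi Q R m y

variable {H Hi Q R m}

/-- Self-adjointness for the form of H starts from H(H⁻¹Q) = Q being symmetric and passes to
squares. It allows (1 + Y)ᵀH(1 + Y) to be replaced by H(1 + Y)². -/
theorem inner_rootMap (hH : ∀ u v, inner ℝ (H u) v = inner ℝ u (H v)) (hHi : ∀ u, H (Hi u) = u)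
    {y : E} (hQ : ∀ u v, inner ℝ (Q y u) v = inner ℝ (Q y v) u) : ∀ (m : ℕ) (u v : E),
    inner ℝ (H (rootMap Hi Q m y u)) v = inner ℝ (H u) (rootMap Hi Q m y v)
  | 0, u, v => by simp [rootMap, sqrtIter]
  | m + 1, u, v => by
    have ih := inner_rootMap hH hHi hQ m
    have h1 : ∀ u, rootMap Hi Q (m + 1) y u =
        (1 / 2 : ℝ) • (Hi (Q y u) - rootMap Hi Q m y (rootMap Hi Q m y u)) := fun u => rfl
    rw [h1, h1, map_smul, inner_smul_left, inner_smul_right, map_sub, inner_sub_left,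
      inner_sub_right, ih, ih, hHi, hH u (Hi _), hHi, hQ, real_inner_comm u]
    rfl

theorem half_inner_preMap (hH : ∀ u v, inner ℝ (H u) v = inner ℝ u (H v))
    (hHi : ∀ u, H (Hi u) = u) {y : E} (hQ : ∀ u v, inner ℝ (Q y u) v = inner ℝ (Q y v) u) :
    1 / 2 * inner ℝ (H (preMap Hi Q m y)) (preMap Hi Q m y) + remTerm H Hi Q R m y =
      1 / 2 * inner ℝ (H y) y + 1 / 2 * inner ℝ (Q y y) y + R y := by
  have h1 := DFunLike.congr_fun (one_add_sqrtIter_mul_self m (Hi.comp (Q y))) y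
  have h2 : preMap Hi Q m y + rootMap Hi Q m y (preMap Hi Q m y) = y + Hi (Q y y) -
      (2 : ℝ) • (rootMap Hi Q (m + 1) y - rootMap Hi Q m y) y := by
    simpa [preMap, rootMap] using h1
  have h3 : inner ℝ (H (preMap Hi Q m y)) (preMap Hi Q m y) =
      inner ℝ (H (preMap Hi Q m y + rootMap Hi Q m y (preMap Hi Q m y))) y := by
    conv_lhs => rw [show inner ℝ (H (preMap Hi Q m y)) (preMap Hi Q m y) =
      inner ℝ (H (preMap Hi Q m y)) (y + rootMap Hi Q m y y) from rfl]
    rw [inner_add_right, ← inner_rootMap hH hHi hQ, map_add, inner_add_left]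
  rw [h3, h2, map_sub, map_add, hHi, map_smul, inner_sub_left, inner_add_left, inner_smul_left,
    remTerm]
  simp only [RCLike.conj_to_real]
  ring

/-- Moving from p to p + cH⁻¹p raises half the form by c|p|² + ½c²⟨H⁻¹p,p⟩. For c = ρh/|p|² this is
ρ as soon as h + th²/2 = 1, the equation solved by `quadRoot`. -/
theorem half_inner_normalMap (hH : ∀ u v, inner ℝ (H u) v = inner ℝ u (H v))
    (hHi : ∀ u, H (Hi u) = u) {y : E} (hQ : ∀ u v, inner ℝ (Q y u) v = inner ℝ (Q y v) u)
    (h0 : sqTerm Hi Q m y ≠ 0) (hz : -(1 / 2) ≤ ratioTerm H Hi Q R m y) :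
    1 / 2 * inner ℝ (H (normalMap H Hi Q R m y)) (normalMap H Hi Q R m y) =
      1 / 2 * inner ℝ (H y) y + 1 / 2 * inner ℝ (Q y y) y + R y := by
  rw [← half_inner_preMap (m := m) hH hHi hQ, normalMap, corrMap]
  have h1 := quadRoot_spec hz
  set p := preMap Hi Q m y
  set t := ratioTerm H Hi Q R m y with ht
  set ρ := remTerm H Hi Q R m y
  set s := sqTerm Hi Q m y with hs
  have hs' : inner ℝ p p = s := rfl
  have ht' : t = ρ * inner ℝ (Hi p) p * (s⁻¹ * s⁻¹) := rfl
  simp only [map_add, map_smul, inner_add_left, inner_add_right, inner_smul_left, inner_smul_right,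
    hHi, RCLike.conj_to_real]
  rw [hH p (Hi p), hHi, hs', real_inner_comm (Hi p) p]
  generalize quadRoot t = q at h1
  rw [ht'] at h1
  field_simp at h1 ⊢
  linear_combination ρ * h1

end Correction

/-! ### Jets of the correction -/

section CorrectionJets

variable {ι : Type*} {E F : ι → Type*} [∀ i, NormedAddCommGroup (E i)]
  [∀ i, InnerProductSpace ℝ (E i)] [∀ i, NormedAddCommGroup (F i)] [∀ i, NormedSpace ℝ (F i)]
  {N : ℕ} {x : ∀ i, E i}

theorem JetBound.scale {f : ∀ i, E i → F i} {A D : ι → ℝ} (hf : JetBound N f x A D) {c : ι → ℝ}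
    (hc : ∀ i, 0 ≤ c i) : JetBound N (fun i y => c i • f i y) x (fun i => c i * A i) D := by
  obtain ⟨C, hC, hf⟩ := hf
  refine ⟨C, hC, fun i => ⟨contDiffAt_const.smul (hf i).1, fun j hj => ?_⟩⟩
  rw [iteratedFDeriv_const_smul_apply' ((hf i).1.of_le (by exact_mod_cast hj)), norm_smul,
    Real.norm_of_nonneg (hc i)]
  have := mul_le_mul_of_nonneg_left ((hf i).2 j hj) (hc i)
  exact this.trans (le_of_eq (by ring))

theorem JetBound.inner {f g : ∀ i, E i → E i} {A A' D : ι → ℝ} (hf : JetBound N f x A D)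
    (hg : JetBound N g x A' D) (hA : ∀ i, 0 ≤ A i) (hA' : ∀ i, 0 ≤ A' i) (hD : ∀ i, 0 ≤ D i) :
    JetBound N (fun i y => inner ℝ (f i y) (g i y)) x (fun i => A i * A' i) D :=
  bilinear (fun _ => realInner) (fun _ => norm_realInner_le) hf hg hA hA' hD

theorem contDiffOn_quadRoot : ContDiffOn ℝ N quadRoot (Ioo (-(1 / 2)) (1 / 2)) := by
  refine contDiffOn_const.div (contDiffOn_const.add (ContDiffOn.sqrt ?_ ?_)) ?_
  · fun_prop
  · intro t ht
    have := ht.1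
    linarith
  · intro t _
    positivity

variable {H Hi : ∀ i, E i →L[ℝ] E i} {Q : ∀ i, E i → E i →L[ℝ] E i} {R : ∀ i, E i → ℝ}
  {c : ℝ}

theorem jetBound_rootMap {A D : ι → ℝ} (hA : ∀ i, 0 ≤ A i) (hA1 : ∀ i, A i ≤ 1)
    (hD : ∀ i, 0 ≤ D i) (hHi : ∀ i, ‖Hi i‖ ≤ c) (hQ : JetBound N Q x A D) : ∀ m,
    JetBound N (fun i => rootMap (Hi i) (Q i) m) x A D
  | 0 => JetBound.const (fun _ => 0) (fun i => by simpa using hA i) hA hD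
  | m + 1 => by
    have ih := jetBound_rootMap hA hA1 hD hHi hQ m
    have h1 : JetBound N (fun i y => (Hi i).comp (Q i y)) x A D :=
      hQ.linear (fun i => ContinuousLinearMap.compL ℝ (E i) (E i) (E i) (Hi i)) (c := 1 * c)
        (fun i => (ContinuousLinearMap.le_opNorm _ _).trans (mul_le_mul
          (ContinuousLinearMap.norm_compL_le _ _ _ _) (hHi i) (norm_nonneg _) zero_le_one)) hA hD
    have h2 := (ih.clm_comp ih hA hA hD).mono (A' := A) hD zero_le_one
      fun i => by rw [one_mul]; exact mul_le_of_le_one_left (hA i) (hA1 i)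
    have h3 := (h1.add (h2.smul_const (-1) hA hD)).smul_const (1 / 2) hA hD
    refine h3.congr fun i => Eventually.of_forall fun y => ?_
    change _ = (1 / 2 : ℝ) • (_ - _)
    rw [sub_eq_add_neg]
    simp only [neg_one_smul]
    rfl

/-- The polynomial part is smooth at 0, where weights in ‖x‖⁻¹ are useless; constant weights cover
all points alike. -/
theorem jetBound_preMap_one (hx1 : ∀ i, ‖x i‖ ≤ 1) (hHi : ∀ i, ‖Hi i‖ ≤ c)
    (hQ : JetBound N Q x (fun _ => 1) (fun _ => 1)) (m : ℕ) :
    JetBound N (fun i => preMap (Hi i) (Q i) m) x (fun _ => 1) (fun _ => 1) := by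
  have h1 : ∀ i : ι, (0 : ℝ) ≤ 1 := fun _ => zero_le_one
  have hid : JetBound N (fun i (y : E i) => y) x (fun _ => 1) (fun _ => 1) := by
    rcases N with _ | N
    · refine ⟨1, zero_le_one, fun i => ⟨contDiffAt_id, fun j hj => ?_⟩⟩
      obtain rfl : j = 0 := by omega
      simpa using hx1 i
    · refine JetBound.succ (fun i => contDiffAt_id) ⟨1, fun i => by simpa using hx1 i⟩ ?_ h1 h1
      exact (JetBound.const (fun i => ContinuousLinearMap.id ℝ (E i))
        (fun i => by simpa using ContinuousLinearMap.norm_id_le (𝕜 := ℝ) (E := E i))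
        (by simp) h1).congr fun i => Eventually.of_forall fun y => fderiv_fun_id.symm
  exact hid.add (((jetBound_rootMap h1 (fun _ => le_rfl) h1 hHi hQ m).clm_apply hid h1 h1 h1).mono
    h1 zero_le_one fun i => by simp)

theorem jetBound_rootMap_sub (hx : ∀ i, x i ≠ 0) (hx1 : ∀ i, ‖x i‖ ≤ 1) (hHi : ∀ i, ‖Hi i‖ ≤ c)
    (hQ : JetBound N Q x (fun i => ‖x i‖) (fun i => ‖x i‖⁻¹)) : ∀ m,
    JetBound N (fun i y => rootMap (Hi i) (Q i) (m + 1) y - rootMap (Hi i) (Q i) m y) x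
      (fun i => ‖x i‖ ^ (m + 1)) (fun i => ‖x i‖⁻¹)
  | 0 => by
    refine JetBound.congr ((jetBound_rootMap (fun _ => norm_nonneg _) hx1
      (fun _ => by positivity) hHi hQ 1).mono
      (c := 1) (fun i => by positivity)
      zero_le_one fun i => by simp) fun i => Eventually.of_forall fun y => ?_
    simp [rootMap, sqrtIter]
  | m + 1 => by
    have ih := jetBound_rootMap_sub hx hx1 hHi hQ m
    have hr : ∀ i, 0 ≤ ‖x i‖ := fun i => norm_nonneg _
    have hrm : ∀ i, 0 ≤ ‖x i‖ ^ (m + 1) := fun i => by positivity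
    have hD : ∀ i, 0 ≤ ‖x i‖⁻¹ := fun i => by positivity
    have h1 := ((jetBound_rootMap (fun _ => norm_nonneg _) hx1
      (fun _ => by positivity) hHi hQ (m + 1)).clm_comp ih hr hrm hD).mono
      (A' := fun i => ‖x i‖ ^ (m + 1 + 1)) (c := 1) hD zero_le_one fun i => by
        rw [one_mul, pow_succ' _ (m + 1)]
    have h2 := (ih.clm_comp (jetBound_rootMap (fun _ => norm_nonneg _) hx1
      (fun _ => by positivity) hHi hQ m) hrm hr hD).mono
      (A' := fun i => ‖x i‖ ^ (m + 1 + 1)) (c := 1) hD zero_le_one fun i => by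
        rw [one_mul, pow_succ _ (m + 1)]
    refine ((h1.add h2).smul_const (-1 / 2) (fun i => by positivity) hD).congr fun i =>
      Eventually.of_forall fun y => ?_
    exact (sqrtIter_succ_succ_sub m ((Hi i).comp (Q i y))).symm

theorem jetBound_preMap (hx : ∀ i, x i ≠ 0) (hx1 : ∀ i, ‖x i‖ ≤ 1) (hHi : ∀ i, ‖Hi i‖ ≤ c)
    (hQ : JetBound N Q x (fun i => ‖x i‖) (fun i => ‖x i‖⁻¹)) (m : ℕ) :
    JetBound N (fun i => preMap (Hi i) (Q i) m) x (fun i => ‖x i‖) (fun i => ‖x i‖⁻¹) := by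
  have hr : ∀ i, 0 ≤ ‖x i‖ := fun i => norm_nonneg _
  have hD : ∀ i, 0 ≤ ‖x i‖⁻¹ := fun i => by positivity
  have hid : JetBound N (fun i (y : E i) => y) x (fun i => ‖x i‖) (fun i => ‖x i‖⁻¹) :=
    JetBound.id fun i => inv_mul_cancel₀ (norm_ne_zero_iff.2 (hx i))
  exact hid.add (((jetBound_rootMap (fun _ => norm_nonneg _) hx1
      (fun _ => by positivity) hHi hQ m).clm_apply hid hr hr hD).mono hD zero_le_one
    fun i => by rw [one_mul]; exact mul_le_of_le_one_left (hr i) (hx1 i))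

variable {ε : ι → ℝ} {k m : ℕ}

/-- The defect of the approximate root has weight ‖x‖^(m+3). Since k ≤ m and ‖x‖ ≤ ε, the weight
ε‖x‖^k of R dominates it. -/
theorem jetBound_remTerm (hx : ∀ i, x i ≠ 0) (hx1 : ∀ i, ‖x i‖ ≤ 1) (hHi : ∀ i, ‖Hi i‖ ≤ c)
    {cH : ℝ} (hH : ∀ i, ‖H i‖ ≤ cH)
    (hQ : JetBound N Q x (fun i => ‖x i‖) (fun i => ‖x i‖⁻¹))
    (hR : JetBound N R x (fun i => ε i * ‖x i‖ ^ k) (fun i => ‖x i‖⁻¹))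
    (hε : ∀ i, ‖x i‖ ≤ ε i) (hkm : k ≤ m) :
    JetBound N (fun i => remTerm (H i) (Hi i) (Q i) (R i) m) x (fun i => ε i * ‖x i‖ ^ k)
      (fun i => ‖x i‖⁻¹) := by
  have hr : ∀ i, 0 ≤ ‖x i‖ := fun i => norm_nonneg _
  have hrm : ∀ i, 0 ≤ ‖x i‖ ^ (m + 1) := fun i => by positivity
  have hD : ∀ i, 0 ≤ ‖x i‖⁻¹ := fun i => by positivity
  have hid : JetBound N (fun i (y : E i) => y) x (fun i => ‖x i‖) (fun i => ‖x i‖⁻¹) :=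
    JetBound.id fun i => inv_mul_cancel₀ (norm_ne_zero_iff.2 (hx i))
  have h1 := (jetBound_rootMap_sub hx hx1 hHi hQ m).clm_apply hid hrm hr hD
  have h2 := (h1.linear H hH (fun i => by positivity) hD).inner hid (fun i => by positivity) hr hD
  refine hR.add (h2.mono hD zero_le_one fun i => ?_)
  rw [one_mul]
  calc ‖x i‖ ^ (m + 1) * ‖x i‖ * ‖x i‖ = ‖x i‖ * ‖x i‖ ^ (m + 2) := by ring
    _ ≤ ε i * ‖x i‖ ^ k := mul_le_mul (hε i) (pow_le_pow_of_le_one (hr i) (hx1 i) (by omega))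
      (by positivity) ((hr i).trans (hε i))

/-- Dividing by ‖x‖² first gives a function of weight one with value at least 1/4, to which the
bounds for inversion apply uniformly; the scaling is then undone. -/
theorem jetBound_inv_sqTerm (hx : ∀ i, x i ≠ 0) (hx1 : ∀ i, ‖x i‖ ≤ 1) (hHi : ∀ i, ‖Hi i‖ ≤ c)
    (hQ : JetBound N Q x (fun i => ‖x i‖) (fun i => ‖x i‖⁻¹))
    (hlow : ∀ i, ‖x i‖ / 2 ≤ ‖preMap (Hi i) (Q i) m (x i)‖) :
    JetBound N (fun i y => (sqTerm (Hi i) (Q i) m y)⁻¹) x (fun i => (‖x i‖ ^ 2)⁻¹)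
      (fun i => ‖x i‖⁻¹) := by
  have hr : ∀ i, 0 ≤ ‖x i‖ := fun i => norm_nonneg _
  have hr' : ∀ i, 0 < ‖x i‖ := fun i => norm_pos_iff.2 (hx i)
  have hD : ∀ i, 0 ≤ ‖x i‖⁻¹ := fun i => by positivity
  have hp := jetBound_preMap hx hx1 hHi hQ m
  have h1 : JetBound N (fun i => sqTerm (Hi i) (Q i) m) x (fun i => ‖x i‖ * ‖x i‖)
    (fun i => ‖x i‖⁻¹) := hp.inner hp hr hr hD
  have h2 := (h1.scale (c := fun i => (‖x i‖ ^ 2)⁻¹) fun i => by positivity).mono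
    (A' := fun _ => 1) hD zero_le_one fun i => by
      have := hr' i
      rw [one_mul]
      field_simp
      exact le_rfl
  have hval : ∀ i, 1 / 4 ≤ (‖x i‖ ^ 2)⁻¹ • sqTerm (Hi i) (Q i) m (x i) := fun i => by
    have h3 := hr' i
    have h4 := hlow i
    rw [sqTerm, real_inner_self_eq_norm_sq, smul_eq_mul, inv_mul_eq_div,
      div_le_div_iff₀ (by norm_num) (by positivity)]
    nlinarith
  let u : ∀ i, ℝˣ := fun i => Units.mk0 _ (show (‖x i‖ ^ 2)⁻¹ • sqTerm (Hi i) (Q i) m (x i) ≠ 0 by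
    have := hval i; linarith)
  have h3 := JetBound.ringInverse u (c := 4) (fun i => by
    rw [Units.val_inv_eq_inv_val, norm_inv, Real.norm_of_nonneg (by
      simp only [u, Units.val_mk0]; have := hval i; linarith)]
    simp only [u, Units.val_mk0]
    rw [show (4 : ℝ) = (1 / 4)⁻¹ by norm_num]
    exact inv_anti₀ (by norm_num) (hval i)) N
  have h4 := (JetBound.comp (f := fun i y => (‖x i‖ ^ 2)⁻¹ • sqTerm (Hi i) (Q i) m y) h3 h2 hD).scale
    (c := fun i => (‖x i‖ ^ 2)⁻¹) fun i => by positivity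
  refine (h4.mono (A' := fun i => (‖x i‖ ^ 2)⁻¹) hD zero_le_one fun i => by simp).congr fun i =>
    Eventually.of_forall fun y => ?_
  have := hr' i
  simp only [Ring.inverse_eq_inv', smul_eq_mul, mul_inv_rev, inv_inv]
  field_simp

/-- Counting weights: the ratio has ε‖x‖^k·‖x‖²·‖x‖⁻⁴, bounded because k ≥ 2, and the correction has
ε‖x‖^k·‖x‖⁻²·‖x‖ = ε‖x‖^(k−1). -/
theorem jetBound_corrMap (hx : ∀ i, x i ≠ 0) (hx1 : ∀ i, ‖x i‖ ≤ 1) (hHi : ∀ i, ‖Hi i‖ ≤ c)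
    {cH : ℝ} (hH : ∀ i, ‖H i‖ ≤ cH)
    (hQ : JetBound N Q x (fun i => ‖x i‖) (fun i => ‖x i‖⁻¹))
    (hR : JetBound N R x (fun i => ε i * ‖x i‖ ^ k) (fun i => ‖x i‖⁻¹))
    (hε : ∀ i, ‖x i‖ ≤ ε i) {cε : ℝ} (hcε : ∀ i, ε i ≤ cε) (hk : 2 ≤ k) (hkm : k ≤ m)
    (hlow : ∀ i, ‖x i‖ / 2 ≤ ‖preMap (Hi i) (Q i) m (x i)‖)
    (hratio : ∀ i, |ratioTerm (H i) (Hi i) (Q i) (R i) m (x i)| ≤ 1 / 4) :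
    JetBound N (fun i => corrMap (H i) (Hi i) (Q i) (R i) m) x
      (fun i => ε i * ‖x i‖ ^ (k - 1)) (fun i => ‖x i‖⁻¹) := by
  have hr : ∀ i, 0 ≤ ‖x i‖ := fun i => norm_nonneg _
  have hr' : ∀ i, 0 < ‖x i‖ := fun i => norm_pos_iff.2 (hx i)
  have hε0 : ∀ i, 0 ≤ ε i := fun i => (hr i).trans (hε i)
  have hεr : ∀ i, 0 ≤ ε i * ‖x i‖ ^ k := fun i => mul_nonneg (hε0 i) (by positivity)
  have hD : ∀ i, 0 ≤ ‖x i‖⁻¹ := fun i => by positivity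
  have hs0 : ∀ i, 0 ≤ (‖x i‖ ^ 2)⁻¹ := fun i => by positivity
  have hp := jetBound_preMap hx hx1 hHi hQ m
  have hHp := hp.linear Hi hHi hr hD
  have hs := jetBound_inv_sqTerm hx hx1 hHi hQ hlow
  have hrem := jetBound_remTerm hx hx1 hHi hH hQ hR hε hkm
  obtain ⟨l, rfl⟩ := Nat.exists_eq_add_of_le hk
  have hz : JetBound N (fun i => ratioTerm (H i) (Hi i) (Q i) (R i) m) x (fun _ => 1)
      (fun i => ‖x i‖⁻¹) := by
    have h1 := (hrem.mul (hHp.inner hp hr hr hD) hεr (fun i => mul_nonneg (hr i) (hr i)) hD).mul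
      (hs.mul hs hs0 hs0 hD) (fun i => mul_nonneg (hεr i) (mul_nonneg (hr i) (hr i)))
      (fun i => mul_nonneg (hs0 i) (hs0 i)) hD
    refine h1.mono (c := |cε|) hD (abs_nonneg _) fun i => ?_
    have h2 := hr' i
    calc _ = ε i * ‖x i‖ ^ l := by field_simp; ring
      _ ≤ |cε| * 1 := mul_le_mul ((hcε i).trans (le_abs_self _)) (pow_le_one₀ (hr i) (hx1 i))
        (by positivity) (abs_nonneg _)
  have hq : JetBound N (fun i y => quadRoot (ratioTerm (H i) (Hi i) (Q i) (R i) m y)) x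
      (fun _ => 1) (fun i => ‖x i‖⁻¹) :=
    JetBound.comp (g := fun _ => quadRoot) (JetBound.of_isCompact (s := Icc (-(1 / 4)) (1 / 4))
      isCompact_Icc isOpen_Ioo (Icc_subset_Ioo (by norm_num) (by norm_num)) contDiffOn_quadRoot
      fun i => abs_le.1 (hratio i)) hz hD
  have h1 := ((hrem.mul hs hεr hs0 hD).mul hq (fun i => mul_nonneg (hεr i) (hs0 i))
    (fun _ => zero_le_one) hD).smul hHp (fun i => mul_nonneg (mul_nonneg (hεr i) (hs0 i))
      zero_le_one) hr hD
  refine h1.mono hD zero_le_one fun i => le_of_eq ?_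
  have h2 := hr' i
  rw [show 2 + l - 1 = l + 1 by omega]
  field_simp
  ring

end CorrectionJets

/-! ### First order bounds with explicit constants -/

section FirstOrder

variable {E F G W : Type*} [NormedAddCommGroup E] [NormedSpace ℝ E] [NormedAddCommGroup F]
  [NormedSpace ℝ F] [NormedAddCommGroup G] [NormedSpace ℝ G] [NormedAddCommGroup W]
  [NormedSpace ℝ W]

/-- `g` is differentiable at `x`, with value at most `a * r ^ p` and derivative at most
`b * r ^ (p - 1)`. -/
structure FirstBound (g : E → F) (x : E) (r : ℝ) (p : ℤ) (a b : ℝ) : Prop where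
  diff : DifferentiableAt ℝ g x
  val : ‖g x‖ ≤ a * r ^ p
  der : ‖fderiv ℝ g x‖ ≤ b * r ^ (p - 1)

namespace FirstBound

variable {x : E} {r : ℝ} {p q : ℤ} {a b a' b' : ℝ}

theorem mono {g : E → F} (h : FirstBound g x r p a b) (hr : 0 < r) (ha : a ≤ a') (hb : b ≤ b') :
    FirstBound g x r p a' b' :=
  ⟨h.diff, h.val.trans (by gcongr), h.der.trans (by gcongr)⟩

/-- Trades a degree for a factor r. Products of small terms return to the degree of their main term,
the spare r being absorbed by the smallness conditions. -/
theorem lower {g : E → F} (h : FirstBound g x r q a b) (hr : 0 < r) (e : q = p + 1) :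
    FirstBound g x r p (a * r) (b * r) := by
  subst e
  refine ⟨h.diff, h.val.trans (le_of_eq ?_), h.der.trans (le_of_eq ?_)⟩
  · rw [zpow_add_one₀ hr.ne']; ring
  · rw [show p + 1 - 1 = (p - 1) + 1 by ring, zpow_add_one₀ hr.ne']; ring

theorem add {f g : E → F} (hf : FirstBound f x r p a b) (hg : FirstBound g x r p a' b') :
    FirstBound (fun y => f y + g y) x r p (a + a') (b + b') := by
  refine ⟨hf.diff.add hg.diff, ?_, ?_⟩
  · rw [add_mul]
    exact (norm_add_le _ _).trans (add_le_add hf.val hg.val)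
  · rw [fderiv_fun_add hf.diff hg.diff, add_mul]
    exact (norm_add_le _ _).trans (add_le_add hf.der hg.der)

theorem const_smul {f : E → F} (hf : FirstBound f x r p a b) (c : ℝ) :
    FirstBound (fun y => c • f y) x r p (|c| * a) (|c| * b) := by
  refine ⟨hf.diff.const_smul c, ?_, ?_⟩
  · rw [norm_smul, mul_assoc]
    exact mul_le_mul_of_nonneg_left hf.val (abs_nonneg c)
  · rw [fderiv_fun_const_smul hf.diff, norm_smul, mul_assoc]
    exact mul_le_mul_of_nonneg_left hf.der (abs_nonneg c)

theorem neg {f : E → F} (hf : FirstBound f x r p a b) :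
    FirstBound (fun y => -f y) x r p a b := by
  simpa using hf.const_smul (-1)

theorem sub {f g : E → F} (hf : FirstBound f x r p a b) (hg : FirstBound g x r p a' b') :
    FirstBound (fun y => f y - g y) x r p (a + a') (b + b') := by
  simpa [sub_eq_add_neg] using hf.add hg.neg

theorem bilinear (B : F →L[ℝ] G →L[ℝ] W) (hB : ‖B‖ ≤ 1) {f : E → F} {g : E → G} (hr : 0 < r)
    (hf : FirstBound f x r p a b) (hg : FirstBound g x r q a' b') :
    FirstBound (fun y => B (f y) (g y)) x r (p + q) (a * a') (a * b' + b * a') := by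
  have h0 : 0 ≤ a * r ^ p := (norm_nonneg _).trans hf.val
  have h1 : 0 ≤ b * r ^ (p - 1) := (norm_nonneg _).trans hf.der
  have hd := B.hasFDerivAt_of_bilinear hf.diff.hasFDerivAt hg.diff.hasFDerivAt
  have hB' : ∀ u v, ‖B u v‖ ≤ ‖u‖ * ‖v‖ := fun u v => (B.le_opNorm₂ u v).trans (by
    have := mul_nonneg (norm_nonneg u) (norm_nonneg v)
    nlinarith)
  refine ⟨hd.differentiableAt, ?_, ?_⟩
  · refine (hB' _ _).trans ((mul_le_mul hf.val hg.val (norm_nonneg _) h0).trans (le_of_eq ?_))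
    rw [zpow_add₀ hr.ne']; ring
  · rw [hd.fderiv]
    refine ContinuousLinearMap.opNorm_le_bound _ ?_ fun v => ?_
    · have h2 : 0 ≤ a' * r ^ q := (norm_nonneg _).trans hg.val
      have h3 : 0 ≤ b' * r ^ (q - 1) := (norm_nonneg _).trans hg.der
      have e : (a * b' + b * a') * r ^ (p + q - 1) =
          (a * r ^ p) * (b' * r ^ (q - 1)) + (b * r ^ (p - 1)) * (a' * r ^ q) := by
        rw [show p + q - 1 = p + (q - 1) by ring, zpow_add₀ hr.ne']
        have : r ^ p * r ^ (q - 1) = r ^ (p - 1) * r ^ q := by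
          rw [← zpow_add₀ hr.ne', ← zpow_add₀ hr.ne']; congr 1; ring
        linear_combination (b * a') * this
      rw [e]
      positivity
    · have h4 : ‖B (f x) (fderiv ℝ g x v)‖ ≤ (a * r ^ p) * (b' * r ^ (q - 1)) * ‖v‖ :=
        (hB' _ _).trans (by
          rw [mul_assoc]
          exact mul_le_mul hf.val (((fderiv ℝ g x).le_opNorm v).trans
            (mul_le_mul_of_nonneg_right hg.der (norm_nonneg v))) (norm_nonneg _) h0)
      have h5 : ‖B (fderiv ℝ f x v) (g x)‖ ≤ (b * r ^ (p - 1)) * ‖v‖ * (a' * r ^ q) :=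
        (hB' _ _).trans (mul_le_mul (((fderiv ℝ f x).le_opNorm v).trans
            (mul_le_mul_of_nonneg_right hf.der (norm_nonneg v))) hg.val (norm_nonneg _)
            (mul_nonneg h1 (norm_nonneg v)))
      refine (norm_add_le _ _).trans ((add_le_add h4 h5).trans (le_of_eq ?_))
      have h6 : r ^ p * r ^ (q - 1) = r ^ (p + q - 1) := by
        rw [← zpow_add₀ hr.ne']; congr 1; ring
      have h7 : r ^ (p - 1) * r ^ q = r ^ (p + q - 1) := by
        rw [← zpow_add₀ hr.ne']; congr 1; ring
      linear_combination (a * b' * ‖v‖) * h6 + (b * a' * ‖v‖) * h7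

theorem linear (L : F →L[ℝ] G) {c : ℝ} (hL : ‖L‖ ≤ c) {f : E → F} (hf : FirstBound f x r p a b) :
    FirstBound (fun y => L (f y)) x r p (c * a) (c * b) := by
  have hd := L.hasFDerivAt.comp x hf.diff.hasFDerivAt
  refine ⟨hd.differentiableAt, (L.le_opNorm _).trans ?_, ?_⟩
  · rw [mul_assoc]
    exact mul_le_mul hL hf.val (norm_nonneg _) ((norm_nonneg _).trans hL)
  · rw [show fderiv ℝ (fun y => L (f y)) x = L.comp (fderiv ℝ f x) from hd.fderiv, mul_assoc]
    exact (ContinuousLinearMap.opNorm_comp_le _ _).trans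
      (mul_le_mul hL hf.der (norm_nonneg _) ((norm_nonneg _).trans hL))

theorem clm_apply {f : E → F →L[ℝ] G} {g : E → F} (hr : 0 < r)
    (hf : FirstBound f x r p a b) (hg : FirstBound g x r q a' b') :
    FirstBound (fun y => f y (g y)) x r (p + q) (a * a') (a * b' + b * a') :=
  bilinear (F := F →L[ℝ] G) (G := F) (W := G) (ContinuousLinearMap.id ℝ (F →L[ℝ] G))
    ContinuousLinearMap.norm_id_le hr hf hg

theorem clm_comp {f : E → G →L[ℝ] W} {g : E → F →L[ℝ] G} (hr : 0 < r)
    (hf : FirstBound f x r p a b) (hg : FirstBound g x r q a' b') :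
    FirstBound (fun y => (f y).comp (g y)) x r (p + q) (a * a') (a * b' + b * a') :=
  bilinear (ContinuousLinearMap.compL ℝ F G W) (ContinuousLinearMap.norm_compL_le _ _ _ _) hr hf hg

theorem smul {f : E → ℝ} {g : E → F} (hr : 0 < r)
    (hf : FirstBound f x r p a b) (hg : FirstBound g x r q a' b') :
    FirstBound (fun y => f y • g y) x r (p + q) (a * a') (a * b' + b * a') :=
  bilinear (ContinuousLinearMap.lsmul ℝ ℝ) ContinuousLinearMap.opNorm_lsmul_le hr hf hg

theorem mul {f g : E → ℝ} (hr : 0 < r)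
    (hf : FirstBound f x r p a b) (hg : FirstBound g x r q a' b') :
    FirstBound (fun y => f y * g y) x r (p + q) (a * a') (a * b' + b * a') :=
  hf.smul hr hg

theorem inner {E : Type*} [NormedAddCommGroup E] [InnerProductSpace ℝ E] {x : E} {f g : E → E}
    (hr : 0 < r) (hf : FirstBound f x r p a b) (hg : FirstBound g x r q a' b') :
    FirstBound (fun y => inner ℝ (f y) (g y)) x r (p + q) (a * a') (a * b' + b * a') :=
  bilinear realInner norm_realInner_le hr hf hg

theorem comp_real {h : ℝ → ℝ} {f : E → ℝ} {h' c d : ℝ} (hh : HasDerivAt h h' (f x))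
    (hf : FirstBound f x r p a b) (hc : |h (f x)| ≤ c * r ^ q) (hd : |h'| ≤ d * r ^ (q - p)) (hr : 0 < r)
    (hd0 : 0 ≤ d) : FirstBound (fun y => h (f y)) x r q c (d * b) := by
  have hD := hh.hasFDerivAt.comp x hf.diff.hasFDerivAt
  refine ⟨hD.differentiableAt, hc, ?_⟩
  rw [show fderiv ℝ (fun y => h (f y)) x = _ from hD.fderiv]
  refine (ContinuousLinearMap.opNorm_comp_le _ _).trans ?_
  rw [show ‖ContinuousLinearMap.toSpanSingleton ℝ h'‖ = |h'| by simp]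
  refine (mul_le_mul hd hf.der (norm_nonneg _) (by positivity)).trans (le_of_eq ?_)
  have : r ^ (q - p) * r ^ (p - 1) = r ^ (q - 1) := by
    rw [← zpow_add₀ hr.ne']; congr 1; ring
  linear_combination d * b * this

theorem id {x : E} : FirstBound (fun y : E => y) x ‖x‖ 1 1 1 :=
  ⟨differentiableAt_id, by simp, by
    rw [fderiv_fun_id]; simpa using ContinuousLinearMap.norm_id_le (𝕜 := ℝ) (E := E)⟩

end FirstBound

end FirstOrder

/-! ### Explicit first order bounds for the normalizing map -/

section CorrectionFirstOrder

variable {E : Type*} [NormedAddCommGroup E] [InnerProductSpace ℝ E] {H Hi : E →L[ℝ] E}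
  {Q : E → E →L[ℝ] E} {R : E → ℝ} {x : E} {K s κ : ℝ}

/-- The bound κ = K/s reproduces itself: the linear term contributes κ/2, and the square is smaller
by a factor of order κ‖x‖. -/
theorem firstBound_rootMap (hx : x ≠ 0) (hs : 0 < s) (hκ0 : 0 ≤ κ) (hκ : K = κ * s)
    (hκx : κ * ‖x‖ ≤ 1 / 200) (hHi : ‖Hi‖ ≤ s⁻¹) (hQ : FirstBound Q x ‖x‖ 1 K K) : ∀ m,
    FirstBound (rootMap Hi Q m) x ‖x‖ 1 κ κ
  | 0 => ⟨differentiableAt_const _, by simp [rootMap, sqrtIter]; positivity, by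
      rw [show rootMap Hi Q 0 = fun _ => 0 from rfl, fderiv_fun_const]
      simpa using hκ0⟩
  | m + 1 => by
    have hr : 0 < ‖x‖ := norm_pos_iff.2 hx
    have ih := firstBound_rootMap hx hs hκ0 hκ hκx hHi hQ m
    have h1 : FirstBound (fun y => Hi.comp (Q y)) x ‖x‖ 1 κ κ := by
      have := hQ.linear (ContinuousLinearMap.compL ℝ E E E Hi) (c := s⁻¹)
        ((ContinuousLinearMap.le_opNorm _ _).trans ((mul_le_mul
          (ContinuousLinearMap.norm_compL_le _ _ _ _) hHi (norm_nonneg _) zero_le_one).trans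
          (one_mul _).le))
      have e : s⁻¹ * K = κ := by rw [hκ]; field_simp
      rwa [e] at this
    have h2 := (ih.clm_comp hr ih).lower (p := 1) hr (by norm_num)
    refine ((h1.sub h2).const_smul (1 / 2)).mono hr ?_ ?_ <;> rw [abs_of_pos (by norm_num)] <;>
      nlinarith

/-- The increments start at Y₂ − Y₁, since Y₁ − Y₀ is only of degree one. This is why the later
estimates use the index m + 1. -/
theorem firstBound_rootMap_sub (hx : x ≠ 0) (hs : 0 < s) (hκ0 : 0 ≤ κ) (hκ : K = κ * s)
    (hκx : κ * ‖x‖ ≤ 1 / 200) (hHi : ‖Hi‖ ≤ s⁻¹) (hQ : FirstBound Q x ‖x‖ 1 K K) : ∀ m,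
    FirstBound (fun y => rootMap Hi Q (m + 2) y - rootMap Hi Q (m + 1) y) x ‖x‖ 2
      (κ ^ 2) (2 * κ ^ 2) := by
  have hr : 0 < ‖x‖ := norm_pos_iff.2 hx
  have hY := firstBound_rootMap hx hs hκ0 hκ hκx hHi hQ
  have hrw : ∀ m, (fun y => rootMap Hi Q (m + 2) y - rootMap Hi Q (m + 1) y) = fun y =>
      (-1 / 2 : ℝ) • ((rootMap Hi Q (m + 1) y).comp (rootMap Hi Q (m + 1) y - rootMap Hi Q m y) +
        (rootMap Hi Q (m + 1) y - rootMap Hi Q m y).comp (rootMap Hi Q m y)) := fun m =>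
    funext fun y => sqrtIter_succ_succ_sub m (Hi.comp (Q y))
  intro m
  induction m with
  | zero =>
    have e : (fun y => rootMap Hi Q (0 + 2) y - rootMap Hi Q (0 + 1) y) = fun y =>
        (-1 / 2 : ℝ) • (rootMap Hi Q 1 y).comp (rootMap Hi Q 1 y) := by
      rw [hrw 0]
      funext y
      simp [show rootMap Hi Q 0 y = 0 from rfl]
    rw [e]
    refine (((hY 1).clm_comp hr (hY 1)).const_smul (-1 / 2)).mono hr ?_ ?_ <;>
      rw [abs_of_neg (by norm_num)] <;> nlinarith
  | succ m ih =>
    rw [hrw (m + 1)]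
    have h1 := ((hY (m + 2)).clm_comp hr ih).lower (p := 2) hr (by norm_num)
    have h2 := (ih.clm_comp hr (hY (m + 1))).lower (p := 2) hr (by norm_num)
    have h3 : 0 ≤ κ ^ 2 := by positivity
    refine ((h1.add h2).const_smul (-1 / 2)).mono hr ?_ ?_ <;>
      rw [abs_of_neg (by norm_num)] <;> nlinarith

theorem firstBound_preMap_sub (hx : x ≠ 0) (hs : 0 < s) (hκ0 : 0 ≤ κ) (hκ : K = κ * s)
    (hκx : κ * ‖x‖ ≤ 1 / 200) (hHi : ‖Hi‖ ≤ s⁻¹) (hQ : FirstBound Q x ‖x‖ 1 K K) (m : ℕ) :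
    FirstBound (fun y => rootMap Hi Q m y y) x ‖x‖ 1 (1 / 200) (1 / 100) := by
  have hr : 0 < ‖x‖ := norm_pos_iff.2 hx
  refine (((firstBound_rootMap hx hs hκ0 hκ hκx hHi hQ m).clm_apply hr
    FirstBound.id).lower (p := 1) hr (by norm_num)).mono hr ?_ ?_ <;> nlinarith

theorem firstBound_preMap (hx : x ≠ 0) (hs : 0 < s) (hκ0 : 0 ≤ κ) (hκ : K = κ * s)
    (hκx : κ * ‖x‖ ≤ 1 / 200) (hHi : ‖Hi‖ ≤ s⁻¹) (hQ : FirstBound Q x ‖x‖ 1 K K) (m : ℕ) :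
    FirstBound (preMap Hi Q m) x ‖x‖ 1 1.01 1.01 := by
  have hr : 0 < ‖x‖ := norm_pos_iff.2 hx
  exact (FirstBound.id.add (firstBound_preMap_sub hx hs hκ0 hκ hκx hHi hQ m)).mono hr
    (by norm_num) (by norm_num)

theorem norm_preMap_ge (hx : x ≠ 0) (hs : 0 < s) (hκ0 : 0 ≤ κ) (hκ : K = κ * s)
    (hκx : κ * ‖x‖ ≤ 1 / 200) (hHi : ‖Hi‖ ≤ s⁻¹) (hQ : FirstBound Q x ‖x‖ 1 K K) (m : ℕ) :
    0.99 * ‖x‖ ≤ ‖preMap Hi Q m x‖ := by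
  have h := (firstBound_preMap_sub hx hs hκ0 hκ hκx hHi hQ m).val
  rw [zpow_one] at h
  have h2 := norm_sub_norm_le x (-(rootMap Hi Q m x x))
  rw [sub_neg_eq_add, norm_neg] at h2
  have h3 : ‖x + rootMap Hi Q m x x‖ = ‖preMap Hi Q m x‖ := rfl
  have := norm_nonneg x
  linarith

/-- The defect of the root contributes multiples of Kκ²‖x‖ to the constants, which is what the
condition on κ²‖x‖ is for. -/
theorem firstBound_remTerm (hx : x ≠ 0) (hs : 0 < s) (hκ0 : 0 ≤ κ) (hκ : K = κ * s)
    (hκx : κ * ‖x‖ ≤ 1 / 200) (hκx' : κ ^ 2 * ‖x‖ ≤ 1 / 200) (hHi : ‖Hi‖ ≤ s⁻¹) (hH : ‖H‖ ≤ K)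
    (hQ : FirstBound Q x ‖x‖ 1 K K) (hR : FirstBound R x ‖x‖ 3 (3 * K) (3 * K)) (m : ℕ) :
    FirstBound (remTerm H Hi Q R (m + 1)) x ‖x‖ 3 (4 * K) (4 * K) := by
  have hr : 0 < ‖x‖ := norm_pos_iff.2 hx
  have hK : 0 ≤ K := (norm_nonneg _).trans hH
  have h1 := (firstBound_rootMap_sub hx hs hκ0 hκ hκx hHi hQ m).clm_apply hr FirstBound.id
  have h2 := ((h1.linear H hH).inner hr FirstBound.id).lower (p := 3) hr (by norm_num)
  refine (hR.add h2).mono hr ?_ ?_ <;> nlinarith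

theorem firstBound_inv_sqTerm (hx : x ≠ 0) (hs : 0 < s) (hκ0 : 0 ≤ κ) (hκ : K = κ * s)
    (hκx : κ * ‖x‖ ≤ 1 / 200) (hHi : ‖Hi‖ ≤ s⁻¹) (hQ : FirstBound Q x ‖x‖ 1 K K) (m : ℕ) :
    FirstBound (fun y => (sqTerm Hi Q m y)⁻¹) x ‖x‖ (-2) 1.1 2.3 := by
  have hr : 0 < ‖x‖ := norm_pos_iff.2 hx
  have hp := firstBound_preMap hx hs hκ0 hκ hκx hHi hQ m
  have hsq : FirstBound (sqTerm Hi Q m) x ‖x‖ 2 1.0201 2.0402 :=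
    (hp.inner hr hp).mono hr (by norm_num) (by norm_num)
  have hlow : 0.98 * ‖x‖ ^ 2 ≤ sqTerm Hi Q m x := by
    have h1 := norm_preMap_ge hx hs hκ0 hκ hκx hHi hQ m
    rw [sqTerm, real_inner_self_eq_norm_sq]
    nlinarith
  have hpos : 0 < sqTerm Hi Q m x := lt_of_lt_of_le (by positivity) hlow
  refine ((hsq.comp_real (h := fun t => t⁻¹) (q := -2) (c := 1.1) (d := 1.1)
    (hasDerivAt_inv hpos.ne') ?_ ?_ hr (by norm_num))).mono hr le_rfl (by norm_num)
  · rw [abs_of_pos (by positivity), zpow_neg, ← div_eq_mul_inv, inv_eq_one_div,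
      div_le_div_iff₀ hpos (by positivity)]
    simp only [zpow_ofNat]
    nlinarith
  · rw [abs_neg, abs_of_pos (by positivity), show (-2 - 2 : ℤ) = -4 by norm_num, zpow_neg,
      ← div_eq_mul_inv, inv_eq_one_div, div_le_div_iff₀ (by positivity) (by positivity)]
    simp only [zpow_ofNat]
    have h2 : (0.98 * ‖x‖ ^ 2) ^ 2 ≤ sqTerm Hi Q m x ^ 2 := by gcongr
    nlinarith [sq_nonneg (‖x‖ ^ 2)]

theorem firstBound_ratioTerm (hx : x ≠ 0) (hs : 0 < s) (hκ0 : 0 ≤ κ) (hκ : K = κ * s)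
    (hκx : κ * ‖x‖ ≤ 1 / 200) (hκx' : κ ^ 2 * ‖x‖ ≤ 1 / 200) (hHi : ‖Hi‖ ≤ s⁻¹) (hH : ‖H‖ ≤ K)
    (hQ : FirstBound Q x ‖x‖ 1 K K) (hR : FirstBound R x ‖x‖ 3 (3 * K) (3 * K)) (m : ℕ) :
    FirstBound (ratioTerm H Hi Q R (m + 1)) x ‖x‖ 1 (6 * κ) (40 * κ) := by
  have hr : 0 < ‖x‖ := norm_pos_iff.2 hx
  have hp := firstBound_preMap hx hs hκ0 hκ hκx hHi hQ (m + 1)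
  have hrem := firstBound_remTerm hx hs hκ0 hκ hκx hκx' hHi hH hQ hR m
  have hinv := firstBound_inv_sqTerm hx hs hκ0 hκ hκx hHi hQ (m + 1)
  have hKs : K * s⁻¹ = κ := by rw [hκ]; field_simp
  refine ((hrem.mul hr ((hp.linear Hi hHi).inner hr hp)).mul hr (hinv.mul hr hinv)).mono hr ?_ ?_
  · calc _ = K * s⁻¹ * (4 * 1.01 * 1.01 * 1.1 * 1.1) := by ring
      _ ≤ _ := by rw [hKs]; nlinarith
  · calc _ = K * s⁻¹ * (4 * 1.01 * 1.01 * (1.1 * 2.3 + 2.3 * 1.1) +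
          (4 * (1.01 * 1.01 + 1.01 * 1.01) + 4 * 1.01 * 1.01) * (1.1 * 1.1)) := by ring
      _ ≤ _ := by rw [hKs]; nlinarith

theorem hasDerivAt_quadRoot {t : ℝ} (ht : |t| ≤ 0.04) :
    ∃ d, HasDerivAt quadRoot d t ∧ |d| ≤ 0.7 ∧ |quadRoot t| ≤ 1.1 := by
  have ht' := abs_le.1 ht
  have hpos : 0 < 1 + 2 * t := by linarith
  have hs : 0.9 ≤ √(1 + 2 * t) := Real.le_sqrt_of_sq_le (by norm_num; linarith)
  have h1 : HasDerivAt (fun t : ℝ => 1 + √(1 + 2 * t)) (2 / (2 * √(1 + 2 * t))) t := by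
    have h2 : HasDerivAt (fun t : ℝ => 1 + 2 * t) 2 t := by
      simpa using ((hasDerivAt_id t).const_mul 2).const_add 1
    exact (h2.sqrt hpos.ne').const_add 1
  have h3 := (hasDerivAt_const t (2 : ℝ)).fun_div h1 (by positivity)
  refine ⟨_, h3, ?_, ?_⟩
  · set u := √(1 + 2 * t)
    have : |(0 * (1 + u) - 2 * (2 / (2 * u))) / (1 + u) ^ 2| = 2 / (u * (1 + u) ^ 2) := by
      have hu : 0 < u := by linarith
      rw [show (0 * (1 + u) - 2 * (2 / (2 * u))) / (1 + u) ^ 2 = -(2 / (u * (1 + u) ^ 2)) by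
        field_simp; ring, abs_neg, abs_of_pos (by positivity)]
    rw [this, div_le_iff₀ (by positivity)]
    nlinarith [mul_nonneg (sub_nonneg.2 hs) (sub_nonneg.2 hs)]
  · rw [quadRoot, abs_of_pos (by positivity), div_le_iff₀ (by positivity)]
    linarith

theorem firstBound_corrMap (hx : x ≠ 0) (hs : 0 < s) (hκ0 : 0 ≤ κ) (hκ : K = κ * s)
    (hκx : κ * ‖x‖ ≤ 1 / 200) (hκx' : κ ^ 2 * ‖x‖ ≤ 1 / 200) (hHi : ‖Hi‖ ≤ s⁻¹) (hH : ‖H‖ ≤ K)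
    (hQ : FirstBound Q x ‖x‖ 1 K K) (hR : FirstBound R x ‖x‖ 3 (3 * K) (3 * K)) (m : ℕ) :
    FirstBound (corrMap H Hi Q R (m + 1)) x ‖x‖ 2 (6 * κ) (30 * κ) := by
  have hr : 0 < ‖x‖ := norm_pos_iff.2 hx
  have hK : 0 ≤ K := (norm_nonneg _).trans hH
  have hp := firstBound_preMap hx hs hκ0 hκ hκx hHi hQ (m + 1)
  have hrem := firstBound_remTerm hx hs hκ0 hκ hκx hκx' hHi hH hQ hR m
  have hinv := firstBound_inv_sqTerm hx hs hκ0 hκ hκx hHi hQ (m + 1)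
  have hz := firstBound_ratioTerm hx hs hκ0 hκ hκx hκx' hHi hH hQ hR m
  have hz' := hz.val
  rw [zpow_one, Real.norm_eq_abs] at hz'
  -- The ratio is at most 6κ‖x‖ ≤ 0.03, inside the range |t| ≤ 0.04.
  obtain ⟨d, hd, hd1, hd2⟩ := hasDerivAt_quadRoot (hz'.trans (by nlinarith))
  have hq : FirstBound (fun y => quadRoot (ratioTerm H Hi Q R (m + 1) y)) x ‖x‖ 0 1.1 0.14 :=
    (hz.comp_real (q := 0) (c := 1.1) (d := 0.7 * ‖x‖) hd (by simpa using hd2)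
      (by simpa [mul_assoc, hr.ne'] using hd1) hr (by positivity)).mono hr le_rfl (by nlinarith)
  have hKs : K * s⁻¹ = κ := by rw [hκ]; field_simp
  refine (((hrem.mul hr hinv).mul hr hq).smul hr (hp.linear Hi hHi)).mono hr ?_ ?_
  · calc _ = K * s⁻¹ * (4 * 1.1 * 1.1 * 1.01) := by ring
      _ ≤ _ := by rw [hKs]; nlinarith
  · calc _ = K * s⁻¹ * (4 * 1.1 * 1.1 * 1.01 +
          (4 * 1.1 * 0.14 + (4 * 2.3 + 4 * 1.1) * 1.1) * 1.01) := by ring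
      _ ≤ _ := by rw [hKs]; nlinarith

end CorrectionFirstOrder

/-! ### Smoothness of the normalizing map at the critical point -/

section Removable

variable {E F : Type*} [NormedAddCommGroup E] [NormedSpace ℝ E] [NormedAddCommGroup F]
  [NormedSpace ℝ F]

/-- A map of class `C^N` away from `0`, whose derivatives of order `j ≤ N` are
`o(‖y‖ ^ (N - j))` at `0`, is of class `C^N`, and its derivatives at `0` vanish. -/
theorem contDiffAt_zero_of_isLittleO {N : ℕ} {w : E → F} {r : ℝ} (hr : 0 < r)
    (hw : ∀ y, y ≠ 0 → ‖y‖ < r → ContDiffAt ℝ N w y) (h0 : w 0 = 0)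
    (hs : ∀ j ≤ N, ∀ η > 0, ∃ δ > 0, ∀ y, y ≠ 0 → ‖y‖ < δ →
      ‖iteratedFDeriv ℝ j w y‖ ≤ η * ‖y‖ ^ (N - j)) :
    ContDiffAt ℝ N w 0 ∧ ∀ j ≤ N, iteratedFDeriv ℝ j w 0 = 0 := by
  classical
  let p : E → FormalMultilinearSeries ℝ E F := fun y j =>
    if y = 0 then 0 else iteratedFDeriv ℝ j w y
  have hp0 : ∀ j, p 0 j = 0 := fun j => if_pos rfl
  have hpn : ∀ y, y ≠ 0 → ∀ j, p y j = iteratedFDeriv ℝ j w y := fun y hy j => if_neg hy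
  have hev : ∀ y, y ≠ 0 → ∀ j, (fun z => p z j) =ᶠ[𝓝 y] iteratedFDeriv ℝ j w := fun y hy j => by
    filter_upwards [isOpen_ne.mem_nhds hy] with z hz using hpn z hz j
  have hsmall : ∀ j ≤ N, ∀ η > 0, ∃ δ > 0, ∀ y, ‖y‖ < δ → ‖p y j‖ ≤ η * ‖y‖ ^ (N - j) := by
    intro j hj η hη
    obtain ⟨δ, hδ, h⟩ := hs j hj η hη
    refine ⟨δ, hδ, fun y hy => ?_⟩
    by_cases hy0 : y = 0
    · subst hy0
      rw [hp0, norm_zero]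
      positivity
    · rw [hpn y hy0]
      exact h y hy0 hy
  -- The jets extended by 0 at the origin form a Taylor series: for m < N the exponent N − m is at
  -- least 1, so smallness of the m-th term says that its derivative at 0 is zero.
  have hT : HasFTaylorSeriesUpToOn N w p (ball 0 r) := by
    refine ⟨fun y hy => ?_, fun m hm y hy => ?_, fun m hm y hy => ?_⟩
    · by_cases hy0 : y = 0
      · subst hy0
        rw [hp0, h0]
        rfl
      · rw [hpn y hy0]
        rfl
    · have hm' : m < N := by exact_mod_cast hm
      refine HasFDerivAt.hasFDerivWithinAt ?_
      by_cases hy0 : y = 0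
      · subst hy0
        rw [hp0, hasFDerivAt_iff_isLittleO_nhds_zero, Asymptotics.isLittleO_iff]
        intro η hη
        obtain ⟨δ, hδ, h⟩ := hsmall m hm'.le η hη
        filter_upwards [ball_mem_nhds (0 : E) (lt_min hδ zero_lt_one)] with y hy
        rw [mem_ball_zero_iff, lt_min_iff] at hy
        have e : (ContinuousMultilinearMap.curryLeft (0 : E [×(m + 1)]→L[ℝ] F)) y = 0 := by
          ext; simp
        rw [zero_add, hp0, sub_zero, e, sub_zero]
        refine (h y hy.1).trans ?_
        gcongr
        calc ‖y‖ ^ (N - m) ≤ ‖y‖ ^ 1 :=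
              pow_le_pow_of_le_one (norm_nonneg y) hy.2.le (by omega)
          _ = ‖y‖ := pow_one _
      · have hd : DifferentiableAt ℝ (iteratedFDeriv ℝ m w) y :=
          ((hw y hy0 (mem_ball_zero_iff.1 hy)).iteratedFDeriv_right (m := 1)
            (by norm_cast; omega)).differentiableAt (by simp)
        rw [hpn y hy0]
        exact hd.hasFDerivAt.congr_of_eventuallyEq (hev y hy0 m)
    · have hm' : m ≤ N := by exact_mod_cast hm
      refine ContinuousAt.continuousWithinAt ?_
      by_cases hy0 : y = 0
      · subst hy0
        rw [ContinuousAt, hp0, tendsto_zero_iff_norm_tendsto_zero, Metric.tendsto_nhds]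
        intro η hη
        obtain ⟨δ, hδ, h⟩ := hsmall m hm' (η / 2) (half_pos hη)
        filter_upwards [ball_mem_nhds (0 : E) (lt_min hδ zero_lt_one)] with y hy
        rw [mem_ball_zero_iff, lt_min_iff] at hy
        rw [Real.dist_0_eq_abs, abs_norm]
        have h1 : ‖y‖ ^ (N - m) ≤ 1 := pow_le_one₀ (norm_nonneg y) hy.2.le
        nlinarith [h y hy.1]
      · exact ((hw y hy0 (mem_ball_zero_iff.1 hy)).iteratedFDeriv_right (m := 0) (i := m)
          (by norm_cast; omega)).continuousAt.congr (hev y hy0 m).symm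
  have h0r : (0 : E) ∈ ball (0 : E) r := mem_ball_self hr
  refine ⟨hT.contDiffOn.contDiffAt (isOpen_ball.mem_nhds h0r), fun j hj => ?_⟩
  rw [← iteratedFDerivWithin_of_isOpen j isOpen_ball h0r,
    ← hT.eq_iteratedFDerivWithin_of_uniqueDiffOn (by exact_mod_cast hj) isOpen_ball.uniqueDiffOn h0r,
    hp0]

end Removable

section Zero

variable {E : Type*} [NormedAddCommGroup E] [InnerProductSpace ℝ E]

theorem preMap_zero (Hi : E →L[ℝ] E) (Q : E → E →L[ℝ] E) (m : ℕ) : preMap Hi Q m 0 = 0 := by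
  simp [preMap]

theorem corrMap_zero (H Hi : E →L[ℝ] E) (Q : E → E →L[ℝ] E) (R : E → ℝ) (m : ℕ) :
    corrMap H Hi Q R m 0 = 0 := by
  rw [corrMap, preMap_zero, map_zero, smul_zero]

end Zero

/-! ### The normal form under quantitative hypotheses at 0 -/

section NormalForm

variable {E : Type*} [NormedAddCommGroup E] [InnerProductSpace ℝ E] [CompleteSpace E]

theorem norm_iteratedFDeriv_hessTail_le_const {k : ℕ} {f : E → ℝ} {K : ℝ} {y : E} (hK0 : 0 ≤ K)
    (hK : ∀ p, 1 ≤ p → p ≤ k → ‖iteratedFDeriv ℝ p f 0‖ ≤ K) (hy : ‖y‖ ≤ 1) (j : ℕ) :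
    ‖iteratedFDeriv ℝ j (hessTail k f) y‖ ≤ k * (2 * K) := by
  refine (norm_iteratedFDeriv_hessTail_le_sum hK j y).trans ?_
  calc _ ≤ ∑ i ∈ Finset.range (k - 2), 2 * K := by
        refine Finset.sum_le_sum fun i _ => ?_
        have h1 : ((i + 1).descFactorial j : ℝ) ≤ (i + 3).factorial := by
          by_cases hj : j ≤ i + 1
          · exact_mod_cast (Nat.le_of_dvd (Nat.factorial_pos _) (by
              rw [← Nat.factorial_mul_descFactorial hj]; exact dvd_mul_left _ _)).trans
              (Nat.factorial_le (by omega))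
          · rw [Nat.descFactorial_of_lt (by omega)]
            exact_mod_cast Nat.zero_le _
        have h2 : (0 : ℝ) < (i + 3).factorial := by positivity
        calc _ ≤ 2 / ((i + 3).factorial : ℝ) * ((i + 3).factorial * K * 1) := by
              gcongr
              exact pow_le_one₀ (norm_nonneg y) hy
          _ = _ := by field_simp
    _ = (k - 2 : ℕ) * (2 * K) := by rw [Finset.sum_const, Finset.card_range, nsmul_eq_mul]
    _ ≤ _ := by gcongr; omega

/-- The Hessian at `0`, as an operator. -/
def hess (f : E → ℝ) : E →L[ℝ] E := formOperator (fderiv ℝ (fderiv ℝ f) 0)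

theorem norm_hess_le_norm_iteratedFDeriv (f : E → ℝ) : ‖hess f‖ ≤ ‖iteratedFDeriv ℝ 2 f 0‖ := by
  refine (norm_formOperator_apply_le _).trans ?_
  rw [← norm_iteratedFDeriv_fderiv, norm_iteratedFDeriv_one]

/-- The remainder of the Taylor expansion of order `k` at `0`. -/
def taylorRem (k : ℕ) (f : E → ℝ) (y : E) : ℝ := f y - taylorPoly k f y

/-- The normalizing map of `f` at `0`, where `Hi` is the inverse of the Hessian. -/
def morseMap (k : ℕ) (f : E → ℝ) (Hi : E →L[ℝ] E) : E → E :=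
  normalMap (hess f) Hi (hessTail k f) (taylorRem k f) (k + 1)

theorem morseMap_zero (k : ℕ) (f : E → ℝ) (Hi : E →L[ℝ] E) : morseMap k f Hi 0 = 0 := by
  rw [morseMap, normalMap, preMap_zero, corrMap_zero, add_zero]

/-- The quantitative hypotheses on a function with a nondegenerate critical point at `0`. -/
structure MorseData (k : ℕ) (K s r : ℝ) (f : E → ℝ) (Hi : E →L[ℝ] E) : Prop where
  three_le : 3 ≤ k
  s_pos : 0 < s
  K_nonneg : 0 ≤ K
  r_pos : 0 < r
  r_le : r ≤ 1 / 200
  ratio_le : K / s * r ≤ 1 / 200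
  ratio_sq_le : (K / s) ^ 2 * r ≤ 1 / 200
  contDiffAt : ∀ y, ‖y‖ < r → ContDiffAt ℝ k f y
  bound : ∀ p, 1 ≤ p → p ≤ k → ∀ y, ‖y‖ < r → ‖iteratedFDeriv ℝ p f y‖ ≤ K
  crit : fderiv ℝ f 0 = 0
  hess_inv : ∀ u, hess f (Hi u) = u
  norm_inv_le : ‖Hi‖ ≤ s⁻¹

namespace MorseData

variable {k : ℕ} {K s r : ℝ} {f : E → ℝ} {Hi : E →L[ℝ] E} {x : E}

theorem norm_zero_lt (h : MorseData k K s r f Hi) : ‖(0 : E)‖ < r := by simpa using h.r_pos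

theorem bound_zero (h : MorseData k K s r f Hi)
    (p : ℕ) (h1 : 1 ≤ p) (hp : p ≤ k) : ‖iteratedFDeriv ℝ p f 0‖ ≤ K :=
  h.bound p h1 hp 0 h.norm_zero_lt

theorem norm_le_half (h : MorseData k K s r f Hi) (hx : ‖x‖ < r) : ‖x‖ ≤ 1 / 2 := by
  have := h.r_le
  linarith

theorem contDiffAt_two (h : MorseData k K s r f Hi) : ContDiffAt ℝ 2 f 0 :=
  (h.contDiffAt 0 h.norm_zero_lt).of_le (by exact_mod_cast (by have := h.three_le; omega))

theorem inner_hess (h : MorseData k K s r f Hi)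
    (u v : E) : inner ℝ (hess f u) v = inner ℝ u (hess f v) := by
  rw [hess, inner_formOperator, real_inner_comm, inner_formOperator]
  exact (h.contDiffAt_two.isSymmSndFDerivAt (by simp)).eq u v

theorem norm_hess_le (h : MorseData k K s r f Hi) : ‖hess f‖ ≤ K :=
  (norm_hess_le_norm_iteratedFDeriv f).trans
    (h.bound_zero 2 (by norm_num) (by have := h.three_le; omega))

theorem contDiffAt_taylorRem (h : MorseData k K s r f Hi)
    (hx : ‖x‖ < r) : ContDiffAt ℝ k (taylorRem k f) x :=
  (h.contDiffAt x hx).sub (contDiff_taylorPoly k f).contDiffAt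

theorem iteratedFDeriv_taylorRem (h : MorseData k K s r f Hi) {j : ℕ} (hj : j ≤ k) (hx : ‖x‖ < r) :
    iteratedFDeriv ℝ j (taylorRem k f) x =
      iteratedFDeriv ℝ j f x - iteratedFDeriv ℝ j (taylorPoly k f) x :=
  fun_iteratedFDeriv_sub_apply ((h.contDiffAt x hx).of_le (by exact_mod_cast hj))
    (contDiff_taylorPoly k f).contDiffAt

theorem iteratedFDeriv_taylorRem_zero (h : MorseData k K s r f Hi) {j : ℕ} (hj : j ≤ k) :
    iteratedFDeriv ℝ j (taylorRem k f) 0 = 0 := by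
  rw [h.iteratedFDeriv_taylorRem hj h.norm_zero_lt,
    iteratedFDeriv_taylorPoly_zero (h.contDiffAt 0 h.norm_zero_lt) hj, sub_self]

theorem norm_iteratedFDeriv_taylorRem_le (h : MorseData k K s r f Hi)
    {j : ℕ} (hj1 : 1 ≤ j) (hj : j ≤ k) (hx : ‖x‖ < r) :
    ‖iteratedFDeriv ℝ j (taylorRem k f) x‖ ≤ 3 * K := by
  rw [h.iteratedFDeriv_taylorRem hj hx]
  refine (norm_sub_le _ _).trans ?_
  have h1 := h.bound j hj1 hj x hx
  have h2 := norm_iteratedFDeriv_taylorPoly_le (k := k) h.K_nonneg h.bound_zero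
    (h.norm_le_half hx) hj1
  linarith

theorem norm_iteratedFDeriv_taylorRem_le_of (h : MorseData k K s r f Hi)
    {ε : ℝ} (hx : ‖x‖ < r) (hε0 : 0 ≤ ε)
    (hε : ∀ y, ‖y‖ ≤ ‖x‖ → ‖iteratedFDeriv ℝ k (taylorRem k f) y‖ ≤ ε) {j : ℕ} (hj : j ≤ k) :
    ‖iteratedFDeriv ℝ j (taylorRem k f) x‖ ≤ ε * ‖x‖ ^ (k - j) :=
  norm_iteratedFDeriv_le_of_vanishing hε0
    (fun y hy => h.contDiffAt_taylorRem (hy.trans_lt hx))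
    (fun j hj => h.iteratedFDeriv_taylorRem_zero hj.le) hε j (by omega) x le_rfl

/-- Three derivatives suffice: D³R is at most 3K, with K from f and 2K from its Taylor polynomial,
and it is integrated down from 0. -/
theorem firstBound_taylorRem (h : MorseData k K s r f Hi) (hx : ‖x‖ < r) :
    FirstBound (taylorRem k f) x ‖x‖ 3 (3 * K) (3 * K) := by
  have h3 := h.three_le
  have key : ∀ m j : ℕ, j + m = 3 → ‖iteratedFDeriv ℝ j (taylorRem k f) x‖ ≤ 3 * K * ‖x‖ ^ m :=
    fun m j hjm => norm_iteratedFDeriv_le_of_vanishing (k := 3) (r := ‖x‖)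
      (mul_nonneg (by norm_num) h.K_nonneg)
      (fun y hy => (h.contDiffAt_taylorRem (hy.trans_lt hx)).of_le (by exact_mod_cast h3))
      (fun j hj => h.iteratedFDeriv_taylorRem_zero (by omega))
      (fun y hy => h.norm_iteratedFDeriv_taylorRem_le (by norm_num) h3 (hy.trans_lt hx)) j hjm x
      le_rfl
  refine ⟨(h.contDiffAt_taylorRem hx).differentiableAt (by
    simpa using (by omega : k ≠ 0)), ?_, ?_⟩
  · simpa using! key 3 0 rfl
  · have := key 2 1 rfl
    rw [norm_iteratedFDeriv_one] at this
    simpa using! this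

theorem firstBound_hessTail (h : MorseData k K s r f Hi)
    (hx : ‖x‖ < r) : FirstBound (hessTail k f) x ‖x‖ 1 K K :=
  ⟨(contDiff_hessTail k f (m := 1)).contDiffAt.differentiableAt (by simp), by
    simpa using norm_hessTail_le h.K_nonneg h.bound_zero (h.norm_le_half hx), by
    simpa using norm_fderiv_hessTail_le h.K_nonneg h.bound_zero (h.norm_le_half hx)⟩

theorem ratio_eq (h : MorseData k K s r f Hi) : K = K / s * s := by
  have := h.s_pos
  field_simp

theorem ratio_nonneg (h : MorseData k K s r f Hi) : 0 ≤ K / s := div_nonneg h.K_nonneg h.s_pos.le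

theorem ratio_mul_le (h : MorseData k K s r f Hi) (hx : ‖x‖ < r) : K / s * ‖x‖ ≤ 1 / 200 :=
  (mul_le_mul_of_nonneg_left hx.le h.ratio_nonneg).trans h.ratio_le

theorem ratio_sq_mul_le (h : MorseData k K s r f Hi) (hx : ‖x‖ < r) : (K / s) ^ 2 * ‖x‖ ≤ 1 / 200 :=
  (mul_le_mul_of_nonneg_left hx.le (sq_nonneg _)).trans h.ratio_sq_le

theorem norm_preMap_ge (h : MorseData k K s r f Hi) (hx : ‖x‖ < r) (hx0 : x ≠ 0) :
    0.99 * ‖x‖ ≤ ‖preMap Hi (hessTail k f) (k + 1) x‖ :=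
  QuantMorse.norm_preMap_ge hx0 h.s_pos h.ratio_nonneg h.ratio_eq (h.ratio_mul_le hx)
    h.norm_inv_le (h.firstBound_hessTail hx) _

theorem abs_ratioTerm_le (h : MorseData k K s r f Hi) (hx : ‖x‖ < r) (hx0 : x ≠ 0) :
    |ratioTerm (hess f) Hi (hessTail k f) (taylorRem k f) (k + 1) x| ≤ 1 / 4 := by
  have h1 := (firstBound_ratioTerm hx0 h.s_pos h.ratio_nonneg h.ratio_eq (h.ratio_mul_le hx)
    (h.ratio_sq_mul_le hx) h.norm_inv_le h.norm_hess_le (h.firstBound_hessTail hx)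
    (h.firstBound_taylorRem hx) k).val
  rw [zpow_one, Real.norm_eq_abs] at h1
  have := h.ratio_mul_le hx
  linarith

theorem half_inner_morseMap (h : MorseData k K s r f Hi) (hx : ‖x‖ < r) :
    f x = f 0 + 1 / 2 * inner ℝ (hess f (morseMap k f Hi x)) (morseMap k f Hi x) := by
  by_cases hx0 : x = 0
  · subst hx0
    simp [morseMap_zero k f Hi]
  have h1 := h.norm_preMap_ge hx hx0
  have h2 := norm_pos_iff.2 hx0
  have h3 := half_inner_normalMap (m := k + 1) (R := taylorRem k f) (y := x) h.inner_hess h.hess_inv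
    (inner_hessTail_comm (h.contDiffAt 0 h.norm_zero_lt) x) (by
      rw [sqTerm, real_inner_self_eq_norm_sq]
      have : 0 < ‖preMap Hi (hessTail k f) (k + 1) x‖ := by linarith
      positivity) (by have := (abs_le.1 (h.abs_ratioTerm_le hx hx0)).1; linarith)
  rw [morseMap, h3, taylorRem, taylorPoly_eq_hessTail (by have := h.three_le; omega), h.crit]
  simp only [hess, zero_apply]
  ring

end MorseData

end NormalForm

/-! ### Uniform bounds on the derivatives of the normalizing map -/

/-- A function with a nondegenerate critical point at `0`, together with a nearby point. -/
structure PointedMorseData (k : ℕ) (K s : ℝ) where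
  n : ℕ
  r : ℝ
  f : EuclideanSpace ℝ (Fin n) → ℝ
  Hi : EuclideanSpace ℝ (Fin n) →L[ℝ] EuclideanSpace ℝ (Fin n)
  data : MorseData k K s r f Hi
  x : EuclideanSpace ℝ (Fin n)
  norm_lt : ‖x‖ < r

namespace PointedMorseData

variable {k : ℕ} {K s : ℝ}

theorem norm_le_one (i : PointedMorseData k K s) : ‖i.x‖ ≤ 1 := by
  linarith [i.data.norm_le_half i.norm_lt]

variable {ι : Type*} (p : ι → PointedMorseData k K s)

theorem jetBound_hessTail_one (hK : 0 ≤ K) (N : ℕ) :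
    JetBound N (fun i => hessTail k (p i).f) (fun i => (p i).x) (fun _ => 1) (fun _ => 1) :=
  ⟨k * (2 * K), by positivity, fun i => ⟨(contDiff_hessTail k _).contDiffAt, fun j _ => by
    simpa using norm_iteratedFDeriv_hessTail_le_const hK (p i).data.bound_zero (p i).norm_le_one j⟩⟩

theorem jetBound_hessTail (hK : 0 ≤ K) (hx : ∀ i, (p i).x ≠ 0) (N : ℕ) :
    JetBound N (fun i => hessTail k (p i).f) (fun i => (p i).x) (fun i => ‖(p i).x‖)
      (fun i => ‖(p i).x‖⁻¹) :=
  ⟨k * K, by positivity, fun i => ⟨(contDiff_hessTail k _).contDiffAt, fun j _ =>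
    norm_iteratedFDeriv_hessTail_le hK (p i).data.bound_zero
      ((p i).data.norm_le_half (p i).norm_lt) (hx i) j⟩⟩

theorem jetBound_taylorRem {ε : ι → ℝ} (hx : ∀ i, (p i).x ≠ 0)
    (hε : ∀ i y, ‖y‖ ≤ ‖(p i).x‖ → ‖iteratedFDeriv ℝ k (taylorRem k (p i).f) y‖ ≤ ε i) :
    JetBound k (fun i => taylorRem k (p i).f) (fun i => (p i).x)
      (fun i => ε i * ‖(p i).x‖ ^ k) (fun i => ‖(p i).x‖⁻¹) :=
  ⟨1, zero_le_one, fun i => ⟨(p i).data.contDiffAt_taylorRem (p i).norm_lt, fun j hj => by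
    have hε0 : 0 ≤ ε i := (norm_nonneg _).trans (hε i 0 (by simp))
    refine ((p i).data.norm_iteratedFDeriv_taylorRem_le_of (p i).norm_lt hε0 (hε i) hj).trans
      (le_of_eq ?_)
    rw [one_mul, mul_assoc, inv_pow, pow_sub₀ _ (norm_ne_zero_iff.2 (hx i)) hj]⟩⟩

theorem jetBound_corrMap {ε : ι → ℝ} (hk : 3 ≤ k) (hK : 0 ≤ K) (hx : ∀ i, (p i).x ≠ 0)
    (hε : ∀ i y, ‖y‖ ≤ ‖(p i).x‖ → ‖iteratedFDeriv ℝ k (taylorRem k (p i).f) y‖ ≤ ε i)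
    (hxε : ∀ i, ‖(p i).x‖ ≤ ε i) {cε : ℝ} (hcε : ∀ i, ε i ≤ cε) :
    JetBound k (fun i => corrMap (hess (p i).f) (p i).Hi (hessTail k (p i).f)
      (taylorRem k (p i).f) (k + 1)) (fun i => (p i).x)
      (fun i => ε i * ‖(p i).x‖ ^ (k - 1)) (fun i => ‖(p i).x‖⁻¹) :=
  QuantMorse.jetBound_corrMap hx (fun i => (p i).norm_le_one) (fun i => (p i).data.norm_inv_le)
    (fun i => (p i).data.norm_hess_le) (jetBound_hessTail p hK hx k) (jetBound_taylorRem p hx hε)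
    hxε hcε (by omega) (by omega)
    (fun i => by
      have h1 := (p i).data.norm_preMap_ge (p i).norm_lt (hx i)
      have h2 := norm_nonneg (p i).x
      linarith)
    (fun i => (p i).data.abs_ratioTerm_le (p i).norm_lt (hx i))

theorem jetBound_preMap (hK : 0 ≤ K) (N : ℕ) :
    JetBound N (fun i => preMap (p i).Hi (hessTail k (p i).f) (k + 1)) (fun i => (p i).x)
      (fun _ => 1) (fun _ => 1) :=
  jetBound_preMap_one (fun i => (p i).norm_le_one) (fun i => (p i).data.norm_inv_le)
    (jetBound_hessTail_one p hK N) _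

end PointedMorseData

/-- The derivatives of the correction term are bounded by those of `ε * ‖x‖ ^ (k - 1)`, where `ε`
bounds the `k`-th derivative of the Taylor remainder; the constant depends on `k`, `K`, `s`. -/
theorem exists_corrMap_bound (k : ℕ) (K s : ℝ) (hk : 3 ≤ k) (hK : 0 ≤ K) :
    ∃ C, 0 ≤ C ∧ ∀ (p : PointedMorseData k K s) (ε : ℝ), p.x ≠ 0 →
      (∀ y, ‖y‖ ≤ ‖p.x‖ → ‖iteratedFDeriv ℝ k (taylorRem k p.f) y‖ ≤ ε) → ‖p.x‖ ≤ ε →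
      ε ≤ 3 * K + 1 →
      ContDiffAt ℝ k (corrMap (hess p.f) p.Hi (hessTail k p.f) (taylorRem k p.f) (k + 1)) p.x ∧
      ∀ j ≤ k, ‖iteratedFDeriv ℝ j
        (corrMap (hess p.f) p.Hi (hessTail k p.f) (taylorRem k p.f) (k + 1)) p.x‖ ≤
          C * (ε * ‖p.x‖ ^ (k - 1)) * ‖p.x‖⁻¹ ^ j := by
  -- Indexing by all data together with ε makes the constant independent of the dimension, the
  -- function, the point and ε.
  let ι := {q : PointedMorseData k K s × ℝ // q.1.x ≠ 0 ∧
    (∀ y, ‖y‖ ≤ ‖q.1.x‖ → ‖iteratedFDeriv ℝ k (taylorRem k q.1.f) y‖ ≤ q.2) ∧ ‖q.1.x‖ ≤ q.2 ∧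
      q.2 ≤ 3 * K + 1}
  obtain ⟨C, hC, h⟩ := PointedMorseData.jetBound_corrMap (fun i : ι => i.1.1)
    (ε := fun i => i.1.2) hk hK (fun i => i.2.1) (fun i => i.2.2.1) (fun i => i.2.2.2.1)
    (fun i => i.2.2.2.2)
  exact ⟨C, hC, fun p ε h1 h2 h3 h4 => h ⟨(p, ε), h1, h2, h3, h4⟩⟩

theorem exists_preMap_bound (k : ℕ) (K s : ℝ) (hK : 0 ≤ K) :
    ∃ C, 0 ≤ C ∧ ∀ (p : PointedMorseData k K s),
      ContDiffAt ℝ k (preMap p.Hi (hessTail k p.f) (k + 1)) p.x ∧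
      ∀ j ≤ k, ‖iteratedFDeriv ℝ j (preMap p.Hi (hessTail k p.f) (k + 1)) p.x‖ ≤ C := by
  obtain ⟨C, hC, h⟩ := PointedMorseData.jetBound_preMap (fun i : PointedMorseData k K s => i) hK k
  exact ⟨C, hC, fun p => ⟨(h p).1, fun j hj => by simpa using (h p).2 j hj⟩⟩

section

variable {k : ℕ} {K s r : ℝ} {n : ℕ} {f : EuclideanSpace ℝ (Fin n) → ℝ}
  {Hi : EuclideanSpace ℝ (Fin n) →L[ℝ] EuclideanSpace ℝ (Fin n)}

theorem pow_mul_inv_pow_sub {t : ℝ} (ht : t ≠ 0) {j N : ℕ} (hj : j ≤ N) :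
    t ^ N * t⁻¹ ^ j = t ^ (N - j) := by
  rw [inv_pow, pow_sub₀ _ ht hj]

/-- The k-th derivative of R is continuous and vanishes at 0, so ε may be taken arbitrarily small
near 0. The constant C is fixed before ε, so Cε‖y‖^(k−1−j) is the little-o required. -/
theorem MorseData.corrMap_zero_jet (h : MorseData k K s r f Hi) :
    ContDiffAt ℝ (k - 1 : ℕ) (corrMap (hess f) Hi (hessTail k f) (taylorRem k f) (k + 1)) 0 ∧
    ∀ j ≤ k - 1, iteratedFDeriv ℝ j
      (corrMap (hess f) Hi (hessTail k f) (taylorRem k f) (k + 1)) 0 = 0 := by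
  have hk := h.three_le
  obtain ⟨C, hC, hb⟩ := exists_corrMap_bound k K s hk h.K_nonneg
  refine contDiffAt_zero_of_isLittleO h.r_pos (fun y hy0 hy => ?_) (corrMap_zero ..)
    (fun j hj η hη => ?_)
  · have h1 := (hb ⟨n, r, f, Hi, h, y, hy⟩ (3 * K + 1) hy0 (fun z hz =>
      (h.norm_iteratedFDeriv_taylorRem_le (by omega) le_rfl (hz.trans_lt hy)).trans (by linarith))
      (by
        have := h.norm_le_half hy
        have := h.K_nonneg
        change ‖y‖ ≤ _
        linarith) le_rfl).1
    exact h1.of_le (by exact_mod_cast Nat.sub_le k 1)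
  · have hcont : ContinuousAt (iteratedFDeriv ℝ k (taylorRem k f)) 0 :=
      ((h.contDiffAt_taylorRem h.norm_zero_lt).iteratedFDeriv_right (m := 0) (i := k)
        (by simp)).continuousAt
    have hK := h.K_nonneg
    set ε : ℝ := min (3 * K + 1) (η / (C + 1)) with hε
    have hε0 : 0 < ε := lt_min (by positivity) (by positivity)
    obtain ⟨δ, hδ, hδ'⟩ := Metric.continuousAt_iff.1 hcont ε hε0
    refine ⟨min δ (min ε r), lt_min hδ (lt_min hε0 h.r_pos), fun y hy0 hy => ?_⟩
    rw [lt_min_iff, lt_min_iff] at hy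
    have h1 := (hb ⟨n, r, f, Hi, h, y, hy.2.2⟩ ε hy0 (fun z hz => by
      have := hδ' (x := z) (by rw [dist_zero_right]; exact hz.trans_lt hy.1)
      rw [h.iteratedFDeriv_taylorRem_zero le_rfl, dist_zero_right] at this
      exact this.le) hy.2.1.le (min_le_left _ _)).2 j (by omega)
    refine h1.trans ?_
    change C * (ε * ‖y‖ ^ (k - 1)) * ‖y‖⁻¹ ^ j ≤ _
    rw [← mul_assoc, mul_assoc (C * ε), pow_mul_inv_pow_sub (norm_ne_zero_iff.2 hy0) hj]
    gcongr
    calc C * ε ≤ C * (η / (C + 1)) := by gcongr; exact min_le_right _ _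
      _ ≤ η := by rw [mul_div_assoc', div_le_iff₀ (by positivity)]; nlinarith

end

/-- The normalizing map is of class `C^(k-1)`, with derivatives bounded in terms of `k`, `K`, `s`
only. -/
theorem exists_morseMap_bound (k : ℕ) (K s : ℝ) (hk : 3 ≤ k) (hK : 0 ≤ K) :
    ∃ C, 0 ≤ C ∧ ∀ (p : PointedMorseData k K s),
      ContDiffAt ℝ (k - 1 : ℕ) (morseMap k p.f p.Hi) p.x ∧
      ∀ j ≤ k - 1, ‖iteratedFDeriv ℝ j (morseMap k p.f p.Hi) p.x‖ ≤ C := by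
  obtain ⟨C, hC, h⟩ := exists_preMap_bound k K s hK
  obtain ⟨C', hC', h'⟩ := exists_corrMap_bound k K s hk hK
  refine ⟨C + C' * (3 * K + 1), by positivity, fun p => ?_⟩
  have h1 : ContDiffAt ℝ (k - 1 : ℕ) (preMap p.Hi (hessTail k p.f) (k + 1)) p.x :=
    (h p).1.of_le (by exact_mod_cast Nat.sub_le k 1)
  have h2 : ContDiffAt ℝ (k - 1 : ℕ)
      (corrMap (hess p.f) p.Hi (hessTail k p.f) (taylorRem k p.f) (k + 1)) p.x ∧ ∀ j ≤ k - 1,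
      ‖iteratedFDeriv ℝ j (corrMap (hess p.f) p.Hi (hessTail k p.f) (taylorRem k p.f) (k + 1))
        p.x‖ ≤ C' * (3 * K + 1) := by
    -- At 0 the jet of the correction vanishes; elsewhere the crude choice ε = 3K + 1 suffices, the
    -- powers of ‖x‖ left over being at most 1.
    by_cases hx0 : p.x = 0
    · rw [hx0]
      refine ⟨p.data.corrMap_zero_jet.1, fun j hj => ?_⟩
      rw [p.data.corrMap_zero_jet.2 j hj, norm_zero]
      positivity
    · have h3 := h' p (3 * K + 1) hx0 (fun z hz =>
        (p.data.norm_iteratedFDeriv_taylorRem_le (by omega) le_rfl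
          (hz.trans_lt p.norm_lt)).trans (by linarith)) (by linarith [p.norm_le_one]) le_rfl
      refine ⟨h3.1.of_le (by exact_mod_cast Nat.sub_le k 1), fun j hj => ?_⟩
      refine (h3.2 j (by omega)).trans ?_
      rw [← mul_assoc, mul_assoc (C' * _), pow_mul_inv_pow_sub (norm_ne_zero_iff.2 hx0) hj]
      exact mul_le_of_le_one_right (by positivity) (pow_le_one₀ (norm_nonneg _) p.norm_le_one)
  refine ⟨h1.add h2.1, fun j hj => ?_⟩
  have h3 : iteratedFDeriv ℝ j (morseMap k p.f p.Hi) p.x = _ :=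
    fun_iteratedFDeriv_add_apply (h1.of_le (by exact_mod_cast hj))
      (h2.1.of_le (by exact_mod_cast hj))
  rw [h3]
  exact (norm_add_le _ _).trans (add_le_add ((h p).2 j (by omega)) (h2.2 j hj))

namespace MorseData

variable {k : ℕ} {K s r : ℝ} {n : ℕ} {f : EuclideanSpace ℝ (Fin n) → ℝ}
  {Hi : EuclideanSpace ℝ (Fin n) →L[ℝ] EuclideanSpace ℝ (Fin n)}
  {x : EuclideanSpace ℝ (Fin n)}

theorem contDiffAt_morseMap (h : MorseData k K s r f Hi) (hx : ‖x‖ < r) :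
    ContDiffAt ℝ (k - 1 : ℕ) (morseMap k f Hi) x := by
  obtain ⟨C, -, hC⟩ := exists_morseMap_bound k K s h.three_le h.K_nonneg
  exact (hC ⟨n, r, f, Hi, h, x, hx⟩).1

theorem norm_fderiv_morseMap_sub_le_of_ne (h : MorseData k K s r f Hi) (hx : ‖x‖ < r)
    (hx0 : x ≠ 0) : ‖fderiv ℝ (morseMap k f Hi) x - 1‖ ≤ 1 / 2 := by
  have h1 := firstBound_preMap_sub hx0 h.s_pos h.ratio_nonneg h.ratio_eq (h.ratio_mul_le hx)
    h.norm_inv_le (h.firstBound_hessTail hx) (k + 1)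
  have h2 := firstBound_corrMap hx0 h.s_pos h.ratio_nonneg h.ratio_eq (h.ratio_mul_le hx)
    (h.ratio_sq_mul_le hx) h.norm_inv_le h.norm_hess_le (h.firstBound_hessTail hx)
    (h.firstBound_taylorRem hx) k
  have h3 : HasFDerivAt (morseMap k f Hi) (1 + _ + _) x :=
    ((hasFDerivAt_id x).add h1.diff.hasFDerivAt).add h2.diff.hasFDerivAt
  rw [h3.fderiv, add_assoc, add_sub_cancel_left]
  have h4 := h1.der
  have h5 := h2.der
  norm_num at h4 h5
  -- The two deviations from the identity add up to at most 1/100 + 30κ‖x‖ ≤ 0.16.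
  have := h.ratio_mul_le hx
  refine (norm_add_le _ _).trans ?_
  linarith

theorem norm_fderiv_morseMap_sub_le (h : MorseData k K s r f Hi) (hx : ‖x‖ < r) :
    ‖fderiv ℝ (morseMap k f Hi) x - 1‖ ≤ 1 / 2 := by
  -- The first order bounds exist only off 0; at 0 the estimate is a limit, since the map is C¹
  -- there.
  by_cases hx0 : x = 0
  · have hk := h.three_le
    have hc : ContinuousAt (fun y => ‖fderiv ℝ (morseMap k f Hi) y - 1‖) x :=
      (((h.contDiffAt_morseMap hx).fderiv_right (m := 0)
        (by norm_cast; omega)).continuousAt.sub continuousAt_const).norm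
    rcases subsingleton_or_nontrivial (EuclideanSpace ℝ (Fin n)) with hs | hs
    · rw [Subsingleton.elim (fderiv ℝ (morseMap k f Hi) x - 1) 0, norm_zero]
      norm_num
    · have : (𝓝[≠] x).NeBot := Module.punctured_nhds_neBot ℝ _ x
      refine le_of_tendsto (hc.tendsto.mono_left nhdsWithin_le_nhds) (x := 𝓝[≠] x) ?_
      have hb : {y | ‖y‖ < r} ∈ 𝓝 x := (isOpen_lt continuous_norm continuous_const).mem_nhds hx
      filter_upwards [self_mem_nhdsWithin, nhdsWithin_le_nhds hb] with y hy hyr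
      exact h.norm_fderiv_morseMap_sub_le_of_ne hyr (by rw [← hx0]; exact hy)
  · exact h.norm_fderiv_morseMap_sub_le_of_ne hx hx0

end MorseData

/-! ### Inverting the normalizing map -/

section Unit

variable {E : Type*} [NormedAddCommGroup E] [NormedSpace ℝ E] [CompleteSpace E]

/-- Invertibility is the Neumann series. If Dz = y, then ‖z‖ ≤ ‖y‖ + ½‖z‖, which gives the bound 2.
-/
theorem exists_unit_of_norm_sub_one_le {D : E →L[ℝ] E} (h : ‖D - 1‖ ≤ 1 / 2) :
    ∃ u : (E →L[ℝ] E)ˣ, (u : E →L[ℝ] E) = D ∧ ‖((u⁻¹ : (E →L[ℝ] E)ˣ) : E →L[ℝ] E)‖ ≤ 2 := by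
  have h1 : ‖1 - D‖ < 1 := by
    rw [norm_sub_rev]
    linarith
  refine ⟨Units.oneSub (1 - D) h1, by simp, ?_⟩
  set u := Units.oneSub (1 - D) h1 with hu
  have hu' : (u : E →L[ℝ] E) = D := by simp [hu]
  refine ContinuousLinearMap.opNorm_le_bound _ (by norm_num) fun y => ?_
  set z := ((u⁻¹ : (E →L[ℝ] E)ˣ) : E →L[ℝ] E) y with hz
  have h2 : D z = y := by
    rw [hz, ← hu', ← mul_apply_eq_comp, Units.mul_inv, one_apply_eq_self]
  have h3 : ‖(D - 1) z‖ ≤ 1 / 2 * ‖z‖ := (D - 1).le_of_opNorm_le h z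
  rw [sub_apply, h2, one_apply_eq_self] at h3
  have h4 : ‖z‖ ≤ ‖y‖ + ‖y - z‖ := by
    have := norm_sub_le y (y - z)
    rwa [sub_sub_cancel] at this
  linarith

/-- On the ball v differs from the identity by a map of Lipschitz constant ½. It is therefore
injective, and the image of the closed ball of radius 2‖y‖ contains y. -/
theorem exists_inverse_chart [Nontrivial E] {v : E → E} {r : ℝ} {N : ℕ} (hN : N ≠ 0)
    (hv : ∀ x, ‖x‖ < r → ContDiffAt ℝ N v x) (h0 : v 0 = 0)
    (hD : ∀ x, ‖x‖ < r → ‖fderiv ℝ v x - 1‖ ≤ 1 / 2) :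
    ∃ e : OpenPartialHomeomorph E E, e.source = ball 0 r ∧ ⇑e = v ∧
      ball 0 (r / 2) ⊆ e.target ∧ ∀ y ∈ e.target, ContDiffAt ℝ N e.symm y ∧
        fderiv ℝ e.symm y = Ring.inverse (fderiv ℝ v (e.symm y)) := by
  have hd : ∀ x, ‖x‖ < r → DifferentiableAt ℝ v x := fun x hx =>
    (hv x hx).differentiableAt (by simpa using hN)
  have happ : ApproximatesLinearOn v ((ContinuousLinearEquiv.refl ℝ E : E ≃L[ℝ] E) : E →L[ℝ] E)
      (ball 0 r) (1 / 2) := by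
    intro x hx y hy
    have := (convex_ball (0 : E) r).norm_image_sub_le_of_norm_fderiv_le' (f := v) (φ := 1)
      (fun z hz => hd z (mem_ball_zero_iff.1 hz)) (fun z hz => hD z (mem_ball_zero_iff.1 hz)) hy hx
    simpa using! this
  have hn : ‖((ContinuousLinearEquiv.refl ℝ E).symm : E →L[ℝ] E)‖₊ = 1 :=
    NNReal.eq ContinuousLinearMap.norm_id
  have hc : Subsingleton E ∨
      (1 / 2 : NNReal) < ‖((ContinuousLinearEquiv.refl ℝ E).symm : E →L[ℝ] E)‖₊⁻¹ := by
    right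
    rw [hn, inv_one]
    exact NNReal.half_lt_self one_ne_zero
  refine ⟨happ.toOpenPartialHomeomorph v _ hc isOpen_ball, rfl, rfl, fun y hy => ?_, ?_⟩
  · rw [mem_ball_zero_iff] at hy
    have h1 := happ.closedBall_subset_target hc isOpen_ball (b := 0) (ε := 2 * ‖y‖)
      (by positivity) (closedBall_subset_ball (by linarith))
    refine h1 ?_
    rw [h0, mem_closedBall_zero_iff, hn]
    norm_num
    linarith
  · intro y hy
    set e := happ.toOpenPartialHomeomorph v _ hc isOpen_ball
    have hmem : ‖e.symm y‖ < r := mem_ball_zero_iff.1 (e.map_target hy)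
    obtain ⟨u, hu, -⟩ := exists_unit_of_norm_sub_one_le (hD _ hmem)
    have hder : HasFDerivAt e
        ((ContinuousLinearEquiv.ofUnit u : E ≃L[ℝ] E) : E →L[ℝ] E) (e.symm y) := by
      have h2 := (hd _ hmem).hasFDerivAt
      rw [← hu] at h2
      exact h2
    refine ⟨e.contDiffAt_symm hy hder (hv _ hmem), ?_⟩
    rw [(e.hasFDerivAt_symm hy hder).fderiv, ← hu, Ring.inverse_unit]
    rfl

end Unit

/-- Uniform bounds on the derivatives of local inverses. -/
theorem JetBound.inverse {ι : Type*} {E : ι → Type*} [∀ i, NormedAddCommGroup (E i)]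
    [∀ i, NormedSpace ℝ (E i)] [∀ i, CompleteSpace (E i)] {v g : ∀ i, E i → E i} {x : ∀ i, E i}
    (hx1 : ∀ i, ‖x i‖ ≤ 1) (hgx : ∀ i, g i (v i (x i)) = x i)
    (hD : ∀ i, ‖_root_.fderiv ℝ (v i) (x i) - 1‖ ≤ 1 / 2)
    (hg' : ∀ i, ∀ᶠ y in 𝓝 (v i (x i)),
      _root_.fderiv ℝ (g i) y = Ring.inverse (_root_.fderiv ℝ (v i) (g i y))) :
    ∀ {N : ℕ}, JetBound N v x (fun _ => 1) (fun _ => 1) →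
      (∀ i, ContDiffAt ℝ N (g i) (v i (x i))) →
      JetBound N g (fun i => v i (x i)) (fun _ => 1) (fun _ => 1)
  | 0, _, hg => ⟨1, zero_le_one, fun i => ⟨hg i, fun j hj => by
      obtain rfl : j = 0 := by omega
      simpa [hgx i] using hx1 i⟩⟩
  | N + 1, hv, hg => by
    have h1 : ∀ _ : ι, (0 : ℝ) ≤ 1 := fun _ => zero_le_one
    -- Dg is the inverse of Dv ∘ g and involves g undifferentiated, so jets of g through order N
    -- bound those of Dg through order N.
    have ih := JetBound.inverse hx1 hgx hD hg' (hv.order_mono (Nat.le_succ N))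
      (fun i => (hg i).of_le (by exact_mod_cast Nat.le_succ N))
    choose u hu hu2 using fun i => exists_unit_of_norm_sub_one_le (hD i)
    have hv' : JetBound N (fun i => _root_.fderiv ℝ (v i)) (fun i => g i (v i (x i)))
        (fun _ => 1) (fun _ => 1) := by
      simp_rw [hgx]
      simpa only [mul_one] using hv.fderiv
    have h2 : JetBound N (fun i y => _root_.fderiv ℝ (v i) (g i y)) (fun i => v i (x i))
        (fun _ => 1) (fun _ => 1) := hv'.comp ih h1
    have h3 : JetBound N (fun i => (Ring.inverse : (E i →L[ℝ] E i) → _))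
        (fun i => _root_.fderiv ℝ (v i) (g i (v i (x i)))) (fun _ => 1) (fun _ => 1) := by
      simp_rw [hgx, ← hu]
      exact JetBound.ringInverse u hu2 N
    refine JetBound.succ hg ⟨1, fun i => by simpa [hgx i] using hx1 i⟩ ?_ h1 h1
    simp only [mul_one]
    exact (JetBound.comp (f := fun i y => _root_.fderiv ℝ (v i) (g i y)) h3 h2 h1).congr
      fun i => (hg' i).mono fun y hy => hy.symm

/-- The inverse of the normalizing map is a chart of class `C^(k-1)` around the critical point,
with derivatives bounded in terms of `k`, `K`, `s` only. -/
theorem exists_morse_chart (k : ℕ) (K s : ℝ) (hk : 3 ≤ k) (hK : 0 ≤ K) :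
    ∃ C, 0 ≤ C ∧ ∀ (n : ℕ) (r : ℝ) (f : EuclideanSpace ℝ (Fin n) → ℝ)
      (Hi : EuclideanSpace ℝ (Fin n) →L[ℝ] EuclideanSpace ℝ (Fin n)), n ≠ 0 →
      MorseData k K s r f Hi →
      ∃ e : OpenPartialHomeomorph (EuclideanSpace ℝ (Fin n)) (EuclideanSpace ℝ (Fin n)),
        e.target = ball 0 r ∧ ball 0 (r / 2) ⊆ e.source ∧ e 0 = 0 ∧
        (∀ y ∈ e.source, ContDiffAt ℝ (k - 1 : ℕ) e y ∧ ‖fderiv ℝ e y‖ ≤ 2 ∧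
          ∀ j ≤ k - 1, ‖iteratedFDeriv ℝ j e y‖ ≤ C) ∧
        (∀ x ∈ e.target, ContDiffAt ℝ (k - 1 : ℕ) e.symm x) ∧
        ∀ y ∈ e.source, f (e y) = f 0 + 1 / 2 * inner ℝ (hess f y) y := by
  have key : ∀ (n : ℕ) (r : ℝ) (f : EuclideanSpace ℝ (Fin n) → ℝ)
      (Hi : EuclideanSpace ℝ (Fin n) →L[ℝ] EuclideanSpace ℝ (Fin n)), n ≠ 0 →
      MorseData k K s r f Hi →
      ∃ e : OpenPartialHomeomorph (EuclideanSpace ℝ (Fin n)) (EuclideanSpace ℝ (Fin n)),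
        e.source = ball 0 r ∧ ⇑e = morseMap k f Hi ∧
        ball 0 (r / 2) ⊆ e.target ∧ ∀ y ∈ e.target, ContDiffAt ℝ (k - 1 : ℕ) e.symm y ∧
          fderiv ℝ e.symm y = Ring.inverse (fderiv ℝ (morseMap k f Hi) (e.symm y)) := by
    intro n r f Hi hn h
    have : Nonempty (Fin n) := ⟨⟨0, Nat.pos_of_ne_zero hn⟩⟩
    exact exists_inverse_chart (by omega) (fun x hx => h.contDiffAt_morseMap hx)
      (morseMap_zero k f Hi) (fun x hx => h.norm_fderiv_morseMap_sub_le hx)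
  -- The charts are fixed for all data at once, so that their inverses form one family with one
  -- constant.
  choose e hes hec het hey using key
  let ι := {p : PointedMorseData k K s // p.n ≠ 0}
  obtain ⟨C₁, hC₁, hb⟩ := exists_morseMap_bound k K s hk hK
  have hv : JetBound (k - 1) (fun i : ι => morseMap k i.1.f i.1.Hi) (fun i => i.1.x)
      (fun _ => 1) (fun _ => 1) :=
    ⟨C₁, hC₁, fun i => ⟨(hb i.1).1, fun j hj => by simpa using (hb i.1).2 j hj⟩⟩
  let g : ∀ i : ι, OpenPartialHomeomorph (EuclideanSpace ℝ (Fin i.1.n))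
    (EuclideanSpace ℝ (Fin i.1.n)) := fun i => e _ _ _ _ i.2 i.1.data
  have hmem : ∀ i : ι, morseMap k i.1.f i.1.Hi i.1.x ∈ (g i).target := fun i => by
    rw [← hec _ _ _ _ i.2 i.1.data]
    exact (g i).map_source (by rw [hes, mem_ball_zero_iff]; exact i.1.norm_lt)
  have hinv : ∀ i : ι, (g i).symm (morseMap k i.1.f i.1.Hi i.1.x) = i.1.x := fun i => by
    rw [← hec _ _ _ _ i.2 i.1.data]
    exact (g i).left_inv (by rw [hes, mem_ball_zero_iff]; exact i.1.norm_lt)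
  obtain ⟨C, hC, hjet⟩ := JetBound.inverse (g := fun i : ι => (g i).symm)
    (fun i => i.1.norm_le_one) hinv
    (fun i => i.1.data.norm_fderiv_morseMap_sub_le i.1.norm_lt)
    (fun i => by
      filter_upwards [(g i).open_target.mem_nhds (hmem i)] with y hy
      exact (hey _ _ _ _ i.2 i.1.data y hy).2) hv
    (fun i => (hey _ _ _ _ i.2 i.1.data _ (hmem i)).1)
  refine ⟨C, hC, fun n r f Hi hn h => ?_⟩
  have hlt : ∀ y ∈ (e n r f Hi hn h).target, ‖(e n r f Hi hn h).symm y‖ < r := fun y hy => by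
    have := (e n r f Hi hn h).map_target hy
    rwa [hes, mem_ball_zero_iff] at this
  have hright : ∀ y ∈ (e n r f Hi hn h).target,
      morseMap k f Hi ((e n r f Hi hn h).symm y) = y := fun y hy => by
    have := (e n r f Hi hn h).right_inv hy
    rwa [hec] at this
  refine ⟨(e n r f Hi hn h).symm, hes n r f Hi hn h, het n r f Hi hn h, ?_, fun y hy => ?_,
    fun x hx => ?_, fun y hy => ?_⟩
  · have := hinv ⟨⟨n, r, f, Hi, h, 0, h.norm_zero_lt⟩, hn⟩
    rwa [morseMap_zero] at this
  · refine ⟨(hey n r f Hi hn h y hy).1, ?_, fun j hj => ?_⟩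
    · obtain ⟨u, hu, hu2⟩ :=
        exists_unit_of_norm_sub_one_le (h.norm_fderiv_morseMap_sub_le (hlt y hy))
      rw [(hey n r f Hi hn h y hy).2, ← hu, Ring.inverse_unit]
      exact hu2
    · have := (hjet ⟨⟨n, r, f, Hi, h, _, hlt y hy⟩, hn⟩).2 j hj
      simp only [one_pow, mul_one] at this
      rwa [hright y hy] at this
  · rw [OpenPartialHomeomorph.symm_symm, hec]
    have hx' : x ∈ (e n r f Hi hn h).source := hx
    rw [hes, mem_ball_zero_iff] at hx'
    exact h.contDiffAt_morseMap hx'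
  · rw [h.half_inner_morseMap (hlt y hy), hright y hy]

/-! ### Singular values and diagonalization of the Hessian -/

section Hessian

variable {n : ℕ} {H : EuclideanSpace ℝ (Fin n) →L[ℝ] EuclideanSpace ℝ (Fin n)}

theorem sigma_pos (hn : n ≠ 0) (hH : Module.finrank ℝ H.toLinearMap.range = n) :
    0 < sigma H n := by
  obtain ⟨m, rfl⟩ := Nat.exists_eq_succ_of_ne_zero hn
  exact (LinearMap.singularValues_pos_iff_lt_finrank_range _).2
    (by rw [hH]; exact Nat.lt_succ_self m)

/-- In an orthonormal eigenbasis of HᵀH, ‖Hx‖² is the sum of squared coordinates weighted by the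
squared singular values, the last of which is the smallest. -/
theorem sigma_mul_norm_le (hn : n ≠ 0) (x : EuclideanSpace ℝ (Fin n)) :
    sigma H n * ‖x‖ ≤ ‖H x‖ := by
  obtain ⟨m, rfl⟩ := Nat.exists_eq_succ_of_ne_zero hn
  set T := H.toLinearMap with hT
  have hfr : Module.finrank ℝ (EuclideanSpace ℝ (Fin (m + 1))) = m + 1 := by simp
  set b := T.isSymmetric_adjoint_comp_self.eigenvectorBasis hfr with hb
  have h0 : 0 ≤ T.singularValues m := T.singularValues_nonneg m
  refine le_of_sq_le_sq ?_ (norm_nonneg _)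
  have h1 : ‖H x‖ ^ 2 = ∑ i : Fin (m + 1), T.singularValues i ^ 2 * (b.repr x i) ^ 2 := by
    have e1 : ‖H x‖ ^ 2 = inner ℝ ((LinearMap.adjoint T ∘ₗ T) x) x := by
      rw [LinearMap.comp_apply, LinearMap.adjoint_inner_left, real_inner_self_eq_norm_sq]
      rfl
    rw [e1, ← b.sum_inner_mul_inner]
    refine Finset.sum_congr rfl fun i _ => ?_
    rw [real_inner_comm, ← b.repr_apply_apply, ← b.repr_apply_apply,
      T.isSymmetric_adjoint_comp_self.eigenvectorBasis_apply_self_apply hfr,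
      T.sq_singularValues_fin hfr]
    simp only [RCLike.ofReal_real_eq_id, id_eq]
    ring
  have h2 : ‖x‖ ^ 2 = ∑ i, (b.repr x i) ^ 2 := by
    rw [← b.repr.norm_map, EuclideanSpace.norm_sq_eq]
    simp
  rw [h1, mul_pow, h2, Finset.mul_sum]
  refine Finset.sum_le_sum fun i _ => ?_
  have h3 : T.singularValues m ≤ T.singularValues i :=
    T.singularValues_antitone (Nat.lt_succ_iff.1 i.2)
  change T.singularValues m ^ 2 * _ ≤ _
  gcongr

theorem exists_right_inverse {s : ℝ} (hs : 0 < s) (hH : ∀ x, s * ‖x‖ ≤ ‖H x‖) :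
    ∃ Hi : EuclideanSpace ℝ (Fin n) →L[ℝ] EuclideanSpace ℝ (Fin n),
      (∀ u, H (Hi u) = u) ∧ ‖Hi‖ ≤ s⁻¹ := by
  have hinj : Function.Injective H.toLinearMap := by
    rw [← LinearMap.ker_eq_bot, LinearMap.ker_eq_bot']
    intro x hx
    have h1 := hH x
    have h2 : H x = 0 := hx
    rw [h2, norm_zero] at h1
    exact norm_le_zero_iff.1 (by nlinarith)
  let T := LinearEquiv.ofInjectiveEndo H.toLinearMap hinj
  have hT : ∀ u, H (T.symm u) = u := fun u => T.apply_symm_apply u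
  refine ⟨LinearMap.toContinuousLinearMap T.symm.toLinearMap, hT, ?_⟩
  refine ContinuousLinearMap.opNorm_le_bound _ (by positivity) fun u => ?_
  have h1 := hH (T.symm u)
  rw [hT] at h1
  rw [inv_mul_eq_div, le_div_iff₀ hs, mul_comm]
  exact h1

/-- A symmetric operator with `s * ‖x‖ ≤ ‖H x‖` is reduced to signs by a change of variables of
norm at most `√(2 / s)`. -/
theorem exists_diagonalization {s : ℝ} (hs : 0 < s) (hH : ∀ x, s * ‖x‖ ≤ ‖H x‖)
    (hsymm : ∀ u v, inner ℝ (H u) v = inner ℝ u (H v)) :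
    ∃ (L : EuclideanSpace ℝ (Fin n) ≃L[ℝ] EuclideanSpace ℝ (Fin n)) (ε : Fin n → ℝ),
      (∀ i, ε i = 1 ∨ ε i = -1) ∧ (∀ y, ‖L y‖ ≤ √(2 / s) * ‖y‖) ∧
        ∀ y, 1 / 2 * inner ℝ (H (L y)) (L y) = ∑ i, ε i * y i ^ 2 := by
  have hfr : Module.finrank ℝ (EuclideanSpace ℝ (Fin n)) = n := by simp
  have hT : H.toLinearMap.IsSymmetric := hsymm
  set b := hT.eigenvectorBasis hfr with hb
  set μ := hT.eigenvalues hfr with hμ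
  have hHb : ∀ i, H (b i) = μ i • b i := fun i => hT.apply_eigenvectorBasis hfr i
  have hsμ : ∀ i, s ≤ |μ i| := fun i => by
    have := hH (b i)
    rwa [hHb, norm_smul, b.norm_eq_one, mul_one, mul_one, Real.norm_eq_abs] at this
  have hμ0 : ∀ i, 0 < |μ i| := fun i => hs.trans_le (hsμ i)
  -- Rescaling the i-th eigenvector by √(2/|μᵢ|) turns μᵢ/2 into the sign of μᵢ, and |μᵢ| ≥ s bounds
  -- the scaling.
  let w : Fin n → ℝ := fun i => √(2 / |μ i|)
  have hw0 : ∀ i, 0 < w i := fun i => Real.sqrt_pos.2 (div_pos two_pos (hμ0 i))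
  have hw2 : ∀ i, w i ^ 2 = 2 / |μ i| := fun i =>
    Real.sq_sqrt (div_nonneg zero_le_two (hμ0 i).le)
  let L : EuclideanSpace ℝ (Fin n) ≃L[ℝ] EuclideanSpace ℝ (Fin n) :=
    ((WithLp.linearEquiv 2 ℝ (Fin n → ℝ)).trans
      (b.toBasis.isUnitSMul (fun i => (hw0 i).ne'.isUnit)).equivFun.symm).toContinuousLinearEquiv
  have hL : ∀ y, L y = ∑ i, (y i * w i) • b i := fun y => by
    change (b.toBasis.isUnitSMul (fun i => (hw0 i).ne'.isUnit)).equivFun.symm (y.ofLp) = _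
    rw [Module.Basis.equivFun_symm_apply]
    refine Finset.sum_congr rfl fun i _ => ?_
    rw [Module.Basis.isUnitSMul_apply, smul_smul, b.coe_toBasis]
  have hHL : ∀ y, H (L y) = ∑ i, (μ i * (y i * w i)) • b i := fun y => by
    rw [hL, map_sum]
    refine Finset.sum_congr rfl fun i _ => ?_
    rw [map_smul, hHb, smul_smul, mul_comm]
  have hin : ∀ a c : Fin n → ℝ, inner ℝ (∑ i, a i • b i) (∑ i, c i • b i) = ∑ i, a i * c i := by
    intro a c
    rw [b.orthonormal.inner_sum]
    simp
  refine ⟨L, fun i => SignType.sign (μ i), fun i => ?_, fun y => ?_, fun y => ?_⟩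
  · rcases lt_or_gt_of_ne (abs_pos.1 (hμ0 i)) with h | h
    · right; simp [sign_neg h]
    · left; simp [sign_pos h]
  · refine le_of_sq_le_sq ?_ (by positivity)
    rw [mul_pow, Real.sq_sqrt (by positivity), ← real_inner_self_eq_norm_sq, hL, hin,
      EuclideanSpace.norm_sq_eq, Finset.mul_sum]
    refine Finset.sum_le_sum fun i _ => ?_
    rw [Real.norm_eq_abs, sq_abs]
    have h1 : w i ^ 2 ≤ 2 / s := by
      rw [hw2]
      exact div_le_div_of_nonneg_left zero_le_two hs (hsμ i)
    nlinarith [sq_nonneg (y i)]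
  · rw [hHL, hL, hin, Finset.mul_sum]
    refine Finset.sum_congr rfl fun i _ => ?_
    have h1 : μ i * (2 / |μ i|) = 2 * (SignType.sign (μ i) : ℝ) := by
      have h2 := (hμ0 i).ne'
      have h3 : (SignType.sign (μ i) : ℝ) * |μ i| = μ i := sign_mul_abs (μ i)
      field_simp
      linarith
    calc 1 / 2 * (μ i * (y i * w i) * (y i * w i)) = 1 / 2 * (μ i * w i ^ 2) * y i ^ 2 := by ring
      _ = _ := by rw [hw2, h1]; ring

end Hessian

/-! ### The radii -/

theorem rpow_half_eq_sqrt_pow {x : ℝ} (hx : 0 ≤ x) (m : ℕ) : x ^ ((m : ℝ) / 2) = √x ^ m := by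
  rw [Real.sqrt_eq_rpow, ← Real.rpow_natCast, ← Real.rpow_mul hx]
  congr 1
  ring

theorem chartRadius_pos {K σ : ℝ} (n : ℕ) (hK : 0 ≤ K) (hσ : 0 < σ) : 0 < chartRadius n K σ := by
  unfold chartRadius
  positivity

/-- Only the entry 1 of the minimum is kept, so the upper bound is free of n. -/
theorem chartRadius_le {K σ : ℝ} (n : ℕ) (hK : 0 ≤ K) (hσ : 0 < σ) :
    chartRadius n K σ ≤ √σ ^ 5 / (32 * √(K + 1) ^ 9) := by
  have h5 := rpow_half_eq_sqrt_pow hσ.le 5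
  have h9 := rpow_half_eq_sqrt_pow (by linarith : 0 ≤ K + 1) 9
  norm_num at h5 h9
  rw [← h5, ← h9]
  exact mul_le_of_le_one_right (by positivity) (min_le_left _ _)

/-- The constant 0.0884 is √2/16 rounded up. -/
theorem two_mul_sqrt_mul_chartRadius_le {K σ : ℝ} (n : ℕ) (hK : 0 ≤ K) (hσ : 0 < σ) :
    2 * (√(2 / σ) * chartRadius n K σ) ≤ 0.0884 * (σ ^ 2 / √(K + 1) ^ 9) := by
  have ha : 0 < √σ := Real.sqrt_pos.2 hσ
  have hb : 0 < √(K + 1) := Real.sqrt_pos.2 (by linarith)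
  have hs : σ = √σ ^ 2 := (Real.sq_sqrt hσ.le).symm
  have h2 : √2 ≤ 1.4143 := by
    rw [Real.sqrt_le_left (by norm_num)]
    norm_num
  calc _ ≤ 2 * (√(2 / σ) * (√σ ^ 5 / (32 * √(K + 1) ^ 9))) := by
        gcongr
        exact chartRadius_le n hK hσ
    _ = √2 / 16 * (σ ^ 2 / √(K + 1) ^ 9) := by
        rw [Real.sqrt_div zero_le_two]
        conv_rhs => rw [hs]
        field_simp
        norm_num
    _ ≤ _ := by
        gcongr
        linarith

theorem sq_div_sqrt_pow_le {K : ℝ} (hK : 0 ≤ K) : 0.0884 * (K ^ 2 / √(K + 1) ^ 9) ≤ 1 / 200 := by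
  set b := √(K + 1) with hb
  have hb1 : 1 ≤ b := by
    rw [hb, Real.one_le_sqrt]
    linarith
  have hbK : K = b ^ 2 - 1 := by rw [hb, Real.sq_sqrt (by linarith)]; ring
  have hb0 : 0 < b := by linarith
  rw [mul_div_assoc', div_le_iff₀ (by positivity)]
  -- For small b, K/b² = 1 − b⁻² is small; for large b, K = b² − 1 ≤ b⁴/4 and the spare factor b ≥
  -- 1.13 closes the gap.
  rcases le_total b 1.13 with h | h
  · have h1 : K ≤ 0.217 * b ^ 2 := by nlinarith
    have h2 : K ^ 2 ≤ (0.217 * b ^ 2) ^ 2 := by gcongr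
    have h3 : b ^ 4 ≤ b ^ 9 := pow_le_pow_right₀ hb1 (by norm_num)
    nlinarith
  · have h1 : K ≤ b ^ 4 / 4 := by nlinarith [sq_nonneg (b ^ 2 - 2)]
    have h2 : K ^ 2 ≤ (b ^ 4 / 4) ^ 2 := by gcongr
    have h3 : 1.13 * b ^ 8 ≤ b ^ 9 := by
      rw [pow_succ b 8, mul_comm]
      gcongr
    nlinarith

/-- As σ ≤ K, the 1 in the bracket is at most (K+1)²/σ². What remains is K against (K+1)^(3/2), with
16 · 0.0884 < 1.5. -/
theorem le_domainRadius {K σ : ℝ} (hσ : 0 < σ) (hσK : σ ≤ K) :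
    0.0884 * (σ ^ 2 / √(K + 1) ^ 9) ≤ domainRadius K σ := by
  have hK : 0 < K := hσ.trans_le hσK
  set b := √(K + 1) with hb
  have hb1 : 1 ≤ b := by
    rw [hb, Real.one_le_sqrt]
    linarith
  have hb2 : K + 1 = b ^ 2 := by rw [hb, Real.sq_sqrt (by linarith)]
  have hb0 : 0 < b := by linarith
  have h1 : 1 + (K + 1) ^ 2 / σ ^ 2 ≤ 2 * (b ^ 2) ^ 2 / σ ^ 2 := by
    rw [← hb2, le_div_iff₀ (by positivity), add_mul, div_mul_cancel₀ _ (by positivity)]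
    nlinarith
  have h2 : 1.5 * K ≤ b ^ 3 := by
    have : K = b ^ 2 - 1 := by linarith
    rw [this]
    nlinarith [mul_nonneg (sub_nonneg.2 hb1) (sq_nonneg (b - 1)),
      mul_nonneg (sub_nonneg.2 hb1) (sub_nonneg.2 hb1)]
  unfold domainRadius
  calc 0.0884 * (σ ^ 2 / b ^ 9) = (0.0884 * 16 * K) * (σ ^ 2 / (16 * K * b ^ 9)) := by
        field_simp
    _ ≤ b ^ 3 * (σ ^ 2 / (16 * K * b ^ 9)) := by
        gcongr
        linarith
    _ = 1 / (8 * K * b ^ 2 * (2 * (b ^ 2) ^ 2 / σ ^ 2)) := by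
        field_simp
        norm_num
    _ ≤ _ := by
        rw [← hb2] at h1 ⊢
        gcongr

theorem two_mul_sqrt_le {K σ : ℝ} (hσ : 0 < σ) (hσK : σ ≤ K) :
    2 * √(2 / σ) ≤ 32 * (K + 1) ^ 5 / σ ^ (5 / 2 : ℝ) := by
  have h5 := rpow_half_eq_sqrt_pow hσ.le 5
  norm_num at h5
  rw [h5, Real.sqrt_div zero_le_two]
  have ha : 0 < √σ := Real.sqrt_pos.2 hσ
  have hs : √σ ^ 4 = σ ^ 2 := by
    rw [show (4 : ℕ) = 2 * 2 from rfl, pow_mul, Real.sq_sqrt hσ.le]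
  have h2 : √2 ≤ 2 := by
    rw [Real.sqrt_le_left (by norm_num)]
    norm_num
  have h3 : σ ^ 2 ≤ (K + 1) ^ 5 :=
    (pow_le_pow_left₀ hσ.le (by linarith) 2).trans
      (pow_le_pow_right₀ (by linarith : (1 : ℝ) ≤ K + 1) (by norm_num))
  rw [mul_div_assoc', div_le_div_iff₀ ha (by positivity), pow_succ √σ 4, hs, ← mul_assoc]
  gcongr
  nlinarith [sq_nonneg σ]

/-! ### The quantitative Morse lemma -/

theorem iteratedFDeriv_const_add {E F : Type*} [NormedAddCommGroup E] [NormedSpace ℝ E]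
    [NormedAddCommGroup F] [NormedSpace ℝ F] {g : E → F} {x : E} {j : ℕ} (hj : j ≠ 0)
    (hg : ContDiffAt ℝ j g x) (c : F) :
    iteratedFDeriv ℝ j (fun y => c + g y) x = iteratedFDeriv ℝ j g x := by
  rw [fun_iteratedFDeriv_add_apply contDiffAt_const hg, iteratedFDeriv_const_of_ne hj]
  exact zero_add _

theorem norm_iteratedFDeriv_comp_equiv_le {E F : Type*} [NormedAddCommGroup E] [NormedSpace ℝ E]
    [NormedAddCommGroup F] [NormedSpace ℝ F] (g : E → F) (L : E ≃L[ℝ] E) (x : E) (j : ℕ) :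
    ‖iteratedFDeriv ℝ j (g ∘ L) x‖ ≤
      ‖iteratedFDeriv ℝ j g (L x)‖ * ‖(L : E →L[ℝ] E)‖ ^ j := by
  have h := L.iteratedFDerivWithin_comp_right g uniqueDiffOn_univ (mem_univ (L x)) j
  rw [preimage_univ, iteratedFDerivWithin_univ, iteratedFDerivWithin_univ] at h
  rw [h]
  refine (ContinuousMultilinearMap.norm_compContinuousLinearMap_le _ _).trans_eq ?_
  rw [Finset.prod_const, Finset.card_univ, Fintype.card_fin]

section

variable {n k : ℕ} {U : Set (EuclideanSpace ℝ (Fin n))} {x₀ : EuclideanSpace ℝ (Fin n)}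
  {f : EuclideanSpace ℝ (Fin n) → ℝ} {K σ : ℝ}

theorem hess_comp_add_left (hf : ContDiffAt ℝ 2 f x₀) :
    hess (fun y => f (x₀ + y)) = hessian f x₀ := by
  rw [hessian, fderiv_gradient hf, hess]
  congr 1
  have h1 : fderiv ℝ (fun y => f (x₀ + y)) = fun y => fderiv ℝ f (x₀ + y) :=
    funext fun y => fderiv_comp_add_left x₀
  rw [h1, fderiv_comp_add_left (f := fderiv ℝ f) x₀, add_zero]

/-- The explicit radii enter here: the three smallness conditions involve σ², Kσ and K² over
(K+1)^(9/2). The bound σ ≤ K, from testing the Hessian on a unit vector, reduces them all to K². -/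
theorem exists_morseData (hn : n ≠ 0) (hk : 3 ≤ k) (hU : IsOpen U) (hx₀ : x₀ ∈ U)
    (hf : ContDiffOn ℝ k f U) (hK : 0 ≤ K) (hfK : ckNorm k f U ≤ ENNReal.ofReal K)
    (hcrit : fderiv ℝ f x₀ = 0)
    (hrank : Module.finrank ℝ (hessian f x₀).toLinearMap.range = n)
    (hσ : σ = sigma (hessian f x₀) n) (hball : ball x₀ (domainRadius K σ) ⊆ U) :
    0 < σ ∧ σ ≤ K ∧ hess (fun y => f (x₀ + y)) = hessian f x₀ ∧
    2 * (√(2 / σ) * chartRadius n K σ) ≤ domainRadius K σ ∧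
    ∃ Hi, MorseData k K σ (2 * (√(2 / σ) * chartRadius n K σ)) (fun y => f (x₀ + y)) Hi := by
  rw [ckNorm_le_ofReal_iff hK] at hfK
  have hfx : ContDiffAt ℝ k f x₀ := hf.contDiffAt (hU.mem_nhds hx₀)
  have hH := hess_comp_add_left (hfx.of_le (by exact_mod_cast (by omega : 2 ≤ k)))
  have hσ0 : 0 < σ := hσ ▸ sigma_pos hn hrank
  have hlow : ∀ x, σ * ‖x‖ ≤ ‖hessian f x₀ x‖ := hσ ▸ sigma_mul_norm_le hn
  have htr : ∀ (j : ℕ) (y : EuclideanSpace ℝ (Fin n)),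
      iteratedFDeriv ℝ j (fun y => f (x₀ + y)) y = iteratedFDeriv ℝ j f (x₀ + y) := fun j y => by
    rw [iteratedFDeriv_comp_add_left]
  have hσK : σ ≤ K := by
    have : Nonempty (Fin n) := ⟨⟨0, Nat.pos_of_ne_zero hn⟩⟩
    obtain ⟨x, hx⟩ := exists_norm_eq (EuclideanSpace ℝ (Fin n)) zero_le_one
    have h1 := hlow x
    have h2 : ‖hessian f x₀ x‖ ≤ K * ‖x‖ := by
      refine ContinuousLinearMap.le_of_opNorm_le _ ?_ x
      rw [← hH]
      refine (norm_hess_le_norm_iteratedFDeriv _).trans ?_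
      rw [htr, add_zero]
      exact hfK 2 (by norm_num) (by omega) x₀ hx₀
    rw [hx] at h1 h2
    linarith
  have hK0 : 0 < K := hσ0.trans_le hσK
  have hr := two_mul_sqrt_mul_chartRadius_le n hK hσ0
  have hδ := chartRadius_pos n hK hσ0
  have hrd := hr.trans (le_domainRadius hσ0 hσK)
  have hb0 : 0 < √(K + 1) := Real.sqrt_pos.2 (by linarith)
  set r := 2 * (√(2 / σ) * chartRadius n K σ) with hr_def
  have hX := sq_div_sqrt_pow_le hK
  have hmem : ∀ y : EuclideanSpace ℝ (Fin n), ‖y‖ < r → x₀ + y ∈ U := fun y hy =>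
    hball (by rw [mem_ball, dist_self_add_left]; exact hy.trans_le hrd)
  obtain ⟨Hi, hHi, hHi'⟩ := exists_right_inverse hσ0 hlow
  refine ⟨hσ0, hσK, hH, hrd, Hi, ?_⟩
  refine ⟨hk, hσ0, hK, by positivity, ?_, ?_, ?_, fun y hy => ?_, fun p hp hpk y hy => ?_, ?_, ?_,
    hHi'⟩
  · refine (hr.trans ?_).trans hX
    gcongr
  · calc K / σ * r ≤ K / σ * (0.0884 * (σ ^ 2 / √(K + 1) ^ 9)) := by gcongr
      _ = 0.0884 * (K * σ / √(K + 1) ^ 9) := by field_simp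
      _ ≤ 0.0884 * (K ^ 2 / √(K + 1) ^ 9) := by
          rw [sq]
          gcongr
      _ ≤ _ := hX
  · calc (K / σ) ^ 2 * r ≤ (K / σ) ^ 2 * (0.0884 * (σ ^ 2 / √(K + 1) ^ 9)) := by gcongr
      _ = 0.0884 * (K ^ 2 / √(K + 1) ^ 9) := by field_simp
      _ ≤ _ := hX
  · exact (hf.contDiffAt (hU.mem_nhds (hmem y hy))).comp y (by fun_prop)
  · rw [htr]
    exact hfK p hp hpk _ (hmem y hy)
  · rw [fderiv_comp_add_left x₀, add_zero, hcrit]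
  · rw [hH]
    exact hHi

end

theorem morse_of_dim_ne_zero (K σ : ℝ) (k : ℕ) (hk : 3 ≤ k) (hK : 0 ≤ K) :
    ∃ M, 0 < M ∧ ∀ (n : ℕ) (_ : n ≠ 0) (U : Set (EuclideanSpace ℝ (Fin n))) (_ : IsOpen U)
      (x₀ : EuclideanSpace ℝ (Fin n)) (_ : x₀ ∈ U)
      (f : EuclideanSpace ℝ (Fin n) → ℝ) (_ : ContDiffOn ℝ k f U)
      (_ : ckNorm k f U ≤ ENNReal.ofReal K) (_ : fderiv ℝ f x₀ = 0)
      (_ : Module.finrank ℝ (hessian f x₀).toLinearMap.range = n)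
      (_ : σ = sigma (hessian f x₀) n) (_ : ball x₀ (domainRadius K σ) ⊆ U),
      ∃ φ : OpenPartialHomeomorph (EuclideanSpace ℝ (Fin n)) (EuclideanSpace ℝ (Fin n)),
        φ.source = ball 0 (chartRadius n K σ) ∧ φ.target ⊆ U ∧ φ 0 = x₀ ∧
        ContDiffOn ℝ ((k - 1 : ℕ) : WithTop ℕ∞) φ φ.source ∧
        ContDiffOn ℝ ((k - 1 : ℕ) : WithTop ℕ∞) φ.symm φ.target ∧
        (∀ x ∈ φ.source, ‖fderiv ℝ φ x‖ ≤ 32 * (K + 1) ^ 5 / σ ^ (5 / 2 : ℝ)) ∧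
        ckNorm (k - 1) φ φ.source ≤ ENNReal.ofReal M ∧
        ∃ ε : Fin n → ℝ, (∀ i, ε i = 1 ∨ ε i = -1) ∧
          ∀ x ∈ φ.source, f (φ x) = f x₀ + ∑ i, ε i * x i ^ 2 := by
  obtain ⟨C, hC, hchart⟩ := exists_morse_chart k K σ hk hK
  -- The base 1 + √(2/σ) ≥ 1 lets the exponent k cover every order; the final 1 keeps M positive
  -- when C = 0.
  refine ⟨C * (1 + √(2 / σ)) ^ k + 1, by positivity, ?_⟩
  intro n hn U hU x₀ hx₀ f hf hfK hcrit hrank hσ hball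
  obtain ⟨hσ0, hσK, hH, hrd, Hi, hD⟩ :=
    exists_morseData hn hk hU hx₀ hf hK hfK hcrit hrank hσ hball
  obtain ⟨e, het, hes, he0, hey, hex, hef⟩ := hchart n _ _ Hi hn hD
  obtain ⟨L, ε, hε, hLn, hLε⟩ := exists_diagonalization (H := hess fun y => f (x₀ + y)) hσ0
    (by rw [hH, hσ]; exact sigma_mul_norm_le hn) hD.inner_hess
  set δ := chartRadius n K σ with hδ
  have hδ0 : 0 < δ := chartRadius_pos n hK hσ0
  have hw : 0 < √(2 / σ) := Real.sqrt_pos.2 (by positivity)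
  have hLop : ‖(L : EuclideanSpace ℝ (Fin n) →L[ℝ] EuclideanSpace ℝ (Fin n))‖ ≤ √(2 / σ) :=
    ContinuousLinearMap.opNorm_le_bound _ hw.le hLn
  -- L sends the ball of radius δ into the ball of radius √(2/σ)δ = r/2, which lies in the domain of
  -- the chart.
  have hLs : ∀ y ∈ ball (0 : EuclideanSpace ℝ (Fin n)) δ, L y ∈ e.source := fun y hy => hes (by
    rw [mem_ball_zero_iff] at hy ⊢
    rw [mul_div_cancel_left₀ _ two_ne_zero]
    exact (hLn y).trans_lt (by gcongr))
  let φ : OpenPartialHomeomorph (EuclideanSpace ℝ (Fin n)) (EuclideanSpace ℝ (Fin n)) :=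
    ((L.toHomeomorph.transOpenPartialHomeomorph e).transHomeomorph
      (Homeomorph.addLeft x₀)).restrOpen (ball 0 δ) isOpen_ball
  have hφs : φ.source = ball 0 δ := inter_eq_right.2 hLs
  have hφ : ⇑φ = fun y => x₀ + (e ∘ L) y := rfl
  have hφsymm : ⇑φ.symm = fun z => L.symm (e.symm (-x₀ + z)) := rfl
  have hcd : ∀ y ∈ ball (0 : EuclideanSpace ℝ (Fin n)) δ, ContDiffAt ℝ (k - 1 : ℕ) (e ∘ L) y :=
    fun y hy => (hey _ (hLs y hy)).1.comp y L.contDiff.contDiffAt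
  have hφt : ∀ z ∈ φ.target, -x₀ + z ∈ e.target := fun z hz => by
    have h1 := φ.map_target hz
    rw [hφs] at h1
    have h2 := φ.right_inv hz
    rw [← h2, hφ]
    simp only [neg_add_cancel_left]
    exact e.map_source (hLs _ h1)
  refine ⟨φ, hφs, fun z hz => ?_, ?_, fun y hy => ?_, fun z hz => ?_, fun y hy => ?_, ?_, ε, hε,
    fun y hy => ?_⟩
  · have h1 := hφt z hz
    rw [het, mem_ball_zero_iff] at h1
    refine hball ?_
    rw [mem_ball, dist_eq_norm, sub_eq_neg_add]
    exact h1.trans_le hrd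
  · simp [hφ, he0]
  · rw [hφs] at hy
    exact (contDiffAt_const.add (hcd y hy)).contDiffWithinAt
  · rw [hφsymm]
    refine ContDiffAt.contDiffWithinAt (L.symm.contDiff.contDiffAt.comp z ?_)
    exact (hex _ (hφt z hz)).comp z (by fun_prop)
  · rw [hφs] at hy
    have h1 := (hey _ (hLs y hy)).1.differentiableAt (by simpa using (by omega : k - 1 ≠ 0))
    have h2 : HasFDerivAt φ ((fderiv ℝ e (L y)).comp
        (L : EuclideanSpace ℝ (Fin n) →L[ℝ] EuclideanSpace ℝ (Fin n))) y :=
      (h1.hasFDerivAt.comp y L.hasFDerivAt).const_add x₀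
    rw [h2.fderiv]
    refine (ContinuousLinearMap.opNorm_comp_le _ _).trans ?_
    exact (mul_le_mul (hey _ (hLs y hy)).2.1 hLop (norm_nonneg _) zero_le_two).trans
      (two_mul_sqrt_le hσ0 hσK)
  · rw [ckNorm_le_ofReal_iff (by positivity)]
    intro p hp hpk y hy
    rw [hφs] at hy
    rw [hφ, iteratedFDeriv_const_add (by omega)
      ((hcd y hy).of_le (by exact_mod_cast hpk))]
    refine (norm_iteratedFDeriv_comp_equiv_le _ _ _ _).trans ?_
    have h1 := (hey _ (hLs y hy)).2.2 p hpk
    have h2 : ‖(L : EuclideanSpace ℝ (Fin n) →L[ℝ] EuclideanSpace ℝ (Fin n))‖ ^ p ≤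
        (1 + √(2 / σ)) ^ k :=
      (pow_le_pow_left₀ (norm_nonneg _) (by linarith) p).trans
        (pow_le_pow_right₀ (by linarith) (by omega))
    have := mul_le_mul h1 h2 (by positivity) hC
    linarith
  · rw [hφs] at hy
    have h1 := hef _ (hLs y hy)
    rw [hLε] at h1
    simpa [hφ] using h1

theorem morse_of_dim_zero (k : ℕ) (U : Set (EuclideanSpace ℝ (Fin 0)))
    (x₀ : EuclideanSpace ℝ (Fin 0)) (hx₀ : x₀ ∈ U) (f : EuclideanSpace ℝ (Fin 0) → ℝ)
    {r c M : ℝ} (hc : 0 ≤ c) (hM : 0 ≤ M) :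
    ∃ φ : OpenPartialHomeomorph (EuclideanSpace ℝ (Fin 0)) (EuclideanSpace ℝ (Fin 0)),
      φ.source = ball 0 r ∧ φ.target ⊆ U ∧ φ 0 = x₀ ∧
      ContDiffOn ℝ ((k - 1 : ℕ) : WithTop ℕ∞) φ φ.source ∧
      ContDiffOn ℝ ((k - 1 : ℕ) : WithTop ℕ∞) φ.symm φ.target ∧
      (∀ x ∈ φ.source, ‖fderiv ℝ φ x‖ ≤ c) ∧
      ckNorm (k - 1) φ φ.source ≤ ENNReal.ofReal M ∧
      ∃ ε : Fin 0 → ℝ, (∀ i, ε i = 1 ∨ ε i = -1) ∧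
        ∀ x ∈ φ.source, f (φ x) = f x₀ + ∑ i, ε i * x i ^ 2 := by
  refine ⟨OpenPartialHomeomorph.ofSet (ball 0 r) isOpen_ball, rfl,
    fun y _ => Subsingleton.elim x₀ y ▸ hx₀, Subsingleton.elim _ _, contDiffOn_id, contDiffOn_id,
    fun x _ => ?_, ?_, fun _ => 1, fun i => i.elim0, fun x _ => ?_⟩
  · rw [Subsingleton.elim (fderiv ℝ _ x) 0, norm_zero]
    exact hc
  · rw [ckNorm_le_ofReal_iff hM]
    intro p _ _ x _
    rw [show iteratedFDeriv ℝ p _ x = 0 from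
      ContinuousMultilinearMap.ext fun _ => Subsingleton.elim _ _, norm_zero]
    exact hM
  · rw [Finset.univ_eq_empty, Finset.sum_empty, add_zero]
    exact congrArg f (Subsingleton.elim _ _)

end QuantMorse

end

theorem theorem4p3 :
    ∃ M : ℝ → ℝ → ℕ → ℝ, (∀ K σ k, 0 < M K σ k) ∧
      ∀ (n k : ℕ) (_hk : 3 ≤ k)
        (U : Set (EuclideanSpace ℝ (Fin n))) (_hU : IsOpen U)
        (x₀ : EuclideanSpace ℝ (Fin n)) (_hx₀ : x₀ ∈ U)
        (f : EuclideanSpace ℝ (Fin n) → ℝ) (_hf : ContDiffOn ℝ k f U)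
        (K : ℝ) (_hK : 0 ≤ K) (_hfK : QuantMorse.ckNorm k f U ≤ ENNReal.ofReal K)
        (_hcrit : fderiv ℝ f x₀ = 0)
        (_hrank : Module.finrank ℝ (QuantMorse.hessian f x₀).toLinearMap.range = n)
        (σ : ℝ) (_hσ : σ = QuantMorse.sigma (QuantMorse.hessian f x₀) n)
        (_hball : Metric.ball x₀ (QuantMorse.domainRadius K σ) ⊆ U),
        ∃ φ : OpenPartialHomeomorph (EuclideanSpace ℝ (Fin n)) (EuclideanSpace ℝ (Fin n)),
          φ.source = Metric.ball 0 (QuantMorse.chartRadius n K σ) ∧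
          φ.target ⊆ U ∧
          φ 0 = x₀ ∧
          ContDiffOn ℝ ((k - 1 : ℕ) : WithTop ℕ∞) φ φ.source ∧
          ContDiffOn ℝ ((k - 1 : ℕ) : WithTop ℕ∞) φ.symm φ.target ∧
          (∀ x ∈ φ.source, ‖fderiv ℝ φ x‖ ≤ 32 * (K + 1) ^ 5 / σ ^ (5 / 2 : ℝ)) ∧
          QuantMorse.ckNorm (k - 1) φ φ.source ≤ ENNReal.ofReal (M K σ k) ∧
          ∃ ε : Fin n → ℝ, (∀ i, ε i = 1 ∨ ε i = -1) ∧
            ∀ x ∈ φ.source, f (φ x) = f x₀ + ∑ i, ε i * x i ^ 2 := by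
  choose M hM0 hM using QuantMorse.morse_of_dim_ne_zero
  refine ⟨fun K σ k => if h : 3 ≤ k ∧ 0 ≤ K then M K σ k h.1 h.2 else 1, fun K σ k => ?_, ?_⟩
  · dsimp only
    split_ifs with h
    · exact hM0 K σ k h.1 h.2
    · exact one_pos
  intro n k hk U hU x₀ hx₀ f hf K hK hfK hcrit hrank σ hσ hball
  beta_reduce
  rw [dif_pos ⟨hk, hK⟩]
  rcases Nat.eq_zero_or_pos n with rfl | hn
  · have hσ1 : σ = 1 := hσ
    exact QuantMorse.morse_of_dim_zero k U x₀ hx₀ f (by rw [hσ1]; positivity) (hM0 K σ k hk hK).le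
  · exact hM K σ k hk hK n hn.ne' U hU x₀ hx₀ f hf hfK hcrit hrank hσ hball
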